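/- \textbf{Setting.} Let $X,U,W$ be complex Hilbert spaces, and let $V$ be a complex Hilbert space with scalar product $a(\cdot,\cdot)$, continuously and densely embedded in $X$. Duals are anti-duals; $X,U,W$ are identified with their own duals, so $V\subset X\subset V'$. Let $A\in\mathcal L(V,V')$, $\langle Ax,v\rangle=a(x,v)$, and let $B\in\mathcal L(U,V')$ with adjoint $B^*\in\mathcal L(V,U)$. Let $C$ be a skew-adjoint operator on $U$ with domain $D(C)$ (graph norm), extended to an operator $U\to D(C)'$ by $\langle Cu,v\rangle=-\langle u,Cv\rangle_U$, and let $D\in\mathcal L(W,D(C)')$ with adjoint $D^*\in\mathcal L(D(C),W)$. We extend $D^*$ by $$D^*u=\lim_{\varepsilon\to0^+}D^*(I-\varepsilon^2C^2)^{-1}u$$ to all $u\in U$ for which this limit exists in $W$. Put $\widehat C=-C-DD^*$ with domain $D(\widehat C)=\{u\in U:\ D^*u\text{ is defined and }Cu+DD^*u\in U\}$, and assume that $\widehat C$ is m-dissipative on $U$. On $\mathcal H=V\times X\times U$ with $\|(x,y,u)\|_{\mathcal H}^2=a(x,x)+\|y\|_X^2+\|u\|_U^2$ consider $$\mathcal A_d(x,y,u)=(y,\,-Ax-Bu,\,B^*y+\widehat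 Cu),\quad \mathcal D(\mathcal A_d)=\{(x,y,u)\in V\times V\times D(\widehat C):\ Ax+Bu\in X\},$$ $$\mathcal A_c(x,y,u)=(y,\,-Ax-Bu,\,B^*y-Cu),\quad \mathcal D(\mathcal A_c)=\{(x,y,u)\in V\times V\times D(C):\ Ax+Bu\in X\}.$$ \textbf{Theorem.} Assume that at least one of the following holds. (H) For every $\lambda\in\mathbb C$ with $\operatorname{Re}\lambda>0$ the operator $$H(\lambda)=-D^*\bigl(\lambda I+C+\lambda B^*(\lambda^2+A)^{-1}B\bigr)^{-1}D$$ is defined on all of $W$ and belongs to $\mathcal L(W)$, and there is $\beta>0$ such that $\|H(\lambda)\|_{\mathcal L(W)}$ is bounded on the line $\operatorname{Re}\lambda=\beta$. (Here $\lambda^2+A:V\to V'$ and $\lambda I+C+\lambda B^*(\lambda^2+A)^{-1}B:U\to D(C)'$, which are invertible for $\operatorname{Re}\lambda>0$.) (B) $D$ is bounded into $U$, that is, $D\in\mathcal L(W,U)$. Then the following two statements are equivalent. 1. (Exponential stability.) There are constants $c,\omega>0$ such that for every $z_0\in\mathcal D(\mathcal A_d)$ the solution $z\in C^1([0,\infty),\mathcal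 H)$ of $z'=\mathcal A_dz$, $z(0)=z_0$, with energy $E(t)=\frac12\|z(t)\|_{\mathcal H}^2$, satisfies $$E(t)\le c\,e^{-\omega t}E(0)\qquad\text{for all }t\ge0.$$ 2. (Observability.) There are $T>0$ and $c(T)>0$ such that for every $z_0\in\mathcal D(\mathcal A_c)$ the solution $z_1=(x_1,y_1,u_1)\in C^1([0,\infty),\mathcal H)$ of $z_1'=\mathcal A_cz_1$, $z_1(0)=z_0$, satisfies $$\int_0^T\|D^*u_1(s)\|_W^2\,ds\ \ge\ c(T)\,\|z_0\|_{\mathcal H}^2 .$$ -/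

import Mathlib

open Filter Topology Set

noncomputable section

namespace DynFeedback

/-! ### Anti-duals and adjoints -/

/-- The anti-dual `E'` of a normed space: continuous conjugate-linear functionals on `E`. -/
abbrev AntiDual (E : Type*) [NormedAddCommGroup E] [NormedSpace ℂ E] : Type _ :=
  E →L⋆[ℂ] ℂ

/-- A bounded map `j : E → K` into a Hilbert space `K` (identified with its own anti-dual) induces
`K → E'`, `k ↦ (v ↦ ⟨k, j v⟩_K)`. Mathlib's `inner` is conjugate-linear in its first
argument, so the scalar product `⟨k, l⟩_K`, linear in `k`, is `inner ℂ l k`. -/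
def pivot {E K : Type*} [NormedAddCommGroup E] [NormedSpace ℂ E]
    [NormedAddCommGroup K] [InnerProductSpace ℂ K] (j : E →L[ℂ] K) : K →L[ℂ] AntiDual E :=
  ((innerSL ℂ).comp j).flip

/-- The adjoint `T* : E → K` of `T : K → E'`, where `K` is a Hilbert space identified with its
dual: `⟨k, T* v⟩_K = ⟨T k, v⟩_{E', E}`. -/
def adj {E K : Type*} [NormedAddCommGroup E] [NormedSpace ℂ E]
    [NormedAddCommGroup K] [InnerProductSpace ℂ K] [CompleteSpace K]
    (T : K →L[ℂ] AntiDual E) : E →L[ℂ] K :=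
  ((InnerProductSpace.toDual ℂ K).symm.toContinuousLinearEquiv :
    StrongDual ℂ K →L⋆[ℂ] K).comp T.flip

theorem inner_adj {E K : Type*} [NormedAddCommGroup E] [NormedSpace ℂ E]
    [NormedAddCommGroup K] [InnerProductSpace ℂ K] [CompleteSpace K]
    (T : K →L[ℂ] AntiDual E) (v : E) (k : K) : inner ℂ (adj T v) k = T k v := by
  simp [adj]

/-! ### Unbounded operators -/

section Operators

variable {E : Type*} [NormedAddCommGroup E] [InnerProductSpace ℂ E]

/-- `K` is m-dissipative: `Re ⟨K x, x⟩ ≤ 0` on the domain, and `λ - K` is onto for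
some `λ > 0`. -/
def IsMDissipative (K : E →ₗ.[ℂ] E) : Prop :=
  (∀ x : K.domain, (inner ℂ (x : E) (K x)).re ≤ 0) ∧
    ∃ l : ℝ, 0 < l ∧ ∀ f : E, ∃ x : K.domain, (l : ℂ) • (x : E) - K x = f

/-- `K` is skew-adjoint: densely defined with `K† = -K` (equality of domains included). -/
def IsSkewAdjointOp [CompleteSpace E] (K : E →ₗ.[ℂ] E) : Prop :=
  Dense (K.domain : Set E) ∧ K.adjoint = -K

/-- `z` is a classical solution on `[0, ∞)` of `z' = K z`, `z 0 = z₀`: it is `C¹` with values in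
`E`, stays in the domain of `K`, and satisfies the equation (one-sided derivative at `0`). -/
def IsSolution (K : E →ₗ.[ℂ] E) (z₀ : E) (z : ℝ → E) : Prop :=
  z 0 = z₀ ∧ ContDiffOn ℝ 1 z (Ici 0) ∧
    ∀ t : ℝ, 0 ≤ t → ∃ h : z t ∈ K.domain, HasDerivWithinAt z (K ⟨z t, h⟩) (Ici 0) t

/-- The domain of `K` as a space of its own, to be given the graph norm. -/
def GraphDomain (K : E →ₗ.[ℂ] E) : Type _ := K.domain

instance (K : E →ₗ.[ℂ] E) : AddCommGroup (GraphDomain K) :=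
  inferInstanceAs (AddCommGroup K.domain)

instance (K : E →ₗ.[ℂ] E) : Module ℂ (GraphDomain K) :=
  inferInstanceAs (Module ℂ K.domain)

/-- `v ↦ (v, K v)`. -/
def graphMap (K : E →ₗ.[ℂ] E) : GraphDomain K →ₗ[ℂ] WithLp 2 (E × E) :=
  (WithLp.linearEquiv 2 ℂ (E × E)).symm.toLinearMap.comp (K.domain.subtype.prod K.toFun)

theorem graphMap_injective (K : E →ₗ.[ℂ] E) : Function.Injective (graphMap K) := by
  intro a b h
  have h' := congrArg WithLp.fst h
  exact Subtype.ext h'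

/-- The graph norm `(‖v‖² + ‖K v‖²)^(1/2)`. -/
instance (K : E →ₗ.[ℂ] E) : NormedAddCommGroup (GraphDomain K) :=
  NormedAddCommGroup.induced _ _ (graphMap K) (graphMap_injective K)

instance (K : E →ₗ.[ℂ] E) : NormedSpace ℂ (GraphDomain K) :=
  NormedSpace.induced ℂ (GraphDomain K) (WithLp 2 (E × E)) (graphMap K)

/-- `v ↦ (v, K v)` as a bounded map for the graph norm. -/
def graphMapL (K : E →ₗ.[ℂ] E) : GraphDomain K →L[ℂ] WithLp 2 (E × E) :=
  (graphMap K).mkContinuous 1 (fun v => by rw [one_mul]; exact le_of_eq rfl)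

/-- The inclusion `D(K) → E`. -/
def domIncl (K : E →ₗ.[ℂ] E) : GraphDomain K →L[ℂ] E :=
  (WithLp.fstL 2 ℂ E E).comp (graphMapL K)

/-- `K` as a bounded operator `D(K) → E`. -/
def domApply (K : E →ₗ.[ℂ] E) : GraphDomain K →L[ℂ] E :=
  (WithLp.sndL 2 ℂ E E).comp (graphMapL K)

end Operators

/-! ### The feedback operator `-C - D D*` -/

section Feedback

variable {U W : Type*} [NormedAddCommGroup U] [InnerProductSpace ℂ U]
  [NormedAddCommGroup W] [InnerProductSpace ℂ W] [CompleteSpace W]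

/-- The extension `U → D(C)'` of a skew-adjoint `C`: `⟨C u, v⟩ = -⟨u, C v⟩` for `v ∈ D(C)`. -/
def extC (C : U →ₗ.[ℂ] U) : U →L[ℂ] AntiDual (GraphDomain C) :=
  -pivot (domApply C)

/-- `D` is a bounded operator `W → U`, where `U` is seen inside `D(C)'`. -/
def IsBoundedInto (C : U →ₗ.[ℂ] U) (D : W →L[ℂ] AntiDual (GraphDomain C)) : Prop :=
  ∃ D₀ : W →L[ℂ] U, D = (pivot (domIncl C)).comp D₀

/-- The graph of the natural extension of `D* : D(C) → W` to a subspace of `U`: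
`D* u = lim_{ε → 0+} D* (1 - ε² C²)⁻¹ u` for all `u ∈ U` for which the limit exists in `W`.
As `C² ≤ 0`, the operators `(1 - ε² C²)⁻¹` are self-adjoint contractions which commute with `C`
and tend strongly to the identity in `U` and in `D(C)`, so that this is `D*` on `D(C)`. -/
def starExtGraph (C : U →ₗ.[ℂ] U) (D : W →L[ℂ] AntiDual (GraphDomain C)) :
    Submodule ℂ (U × W) where
  carrier := {p | ∃ r : ℝ → GraphDomain C,
    (∀ ε : ℝ, 0 < ε → ∃ s : GraphDomain C, domIncl C s = domApply C (r ε) ∧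
      domIncl C (r ε) - ((ε : ℂ) ^ 2) • domApply C s = p.1) ∧
    Tendsto (fun ε => adj D (r ε)) (𝓝[>] 0) (𝓝 p.2)}
  add_mem' := by
    rintro p q ⟨r, hr, hr'⟩ ⟨t, ht, ht'⟩
    refine ⟨fun ε => r ε + t ε, fun ε hε => ?_, ?_⟩
    · obtain ⟨s, hs, hs'⟩ := hr ε hε
      obtain ⟨s₂, hs₂, hs₂'⟩ := ht ε hε
      refine ⟨s + s₂, by simp [hs, hs₂], ?_⟩
      rw [Prod.fst_add, ← hs', ← hs₂']
      simp only [map_add, smul_add]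
      abel
    · simpa using hr'.add ht'
  zero_mem' := ⟨fun _ => 0, fun ε _ => ⟨0, by simp, by simp⟩, by simp⟩
  smul_mem' := by
    rintro c p ⟨r, hr, hr'⟩
    refine ⟨fun ε => c • r ε, fun ε hε => ?_, ?_⟩
    · obtain ⟨s, hs, hs'⟩ := hr ε hε
      refine ⟨c • s, by simp [hs], ?_⟩
      rw [Prod.smul_fst, ← hs']
      simp only [map_smul, smul_sub, smul_comm c]
    · simpa using hr'.const_smul c

/-- `D*`, extended to its natural domain in `U`. -/
def starExt (C : U →ₗ.[ℂ] U) (D : W →L[ℂ] AntiDual (GraphDomain C)) : U →ₗ.[ℂ] W :=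
  (starExtGraph C D).toLinearPMap

/-- The graph of `-C - D D*`: all `(u, f) ∈ U × U` such that `D* u` is defined and
`f = -C u - D D* u` in `D(C)'`. -/
def feedbackGraph (C : U →ₗ.[ℂ] U) (D : W →L[ℂ] AntiDual (GraphDomain C)) :
    Submodule ℂ (U × U) where
  carrier := {p | ∃ h : p.1 ∈ (starExt C D).domain,
    pivot (domIncl C) p.2 = -extC C p.1 - D (starExt C D ⟨p.1, h⟩)}
  add_mem' := by
    rintro p q ⟨h, hp⟩ ⟨h', hq⟩
    refine ⟨add_mem h h', ?_⟩
    have : starExt C D ⟨(p + q).1, add_mem h h'⟩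
        = starExt C D ⟨p.1, h⟩ + starExt C D ⟨q.1, h'⟩ := (starExt C D).map_add ⟨_, h⟩ ⟨_, h'⟩
    rw [this, Prod.snd_add, Prod.fst_add, map_add, map_add, map_add, hp, hq]
    abel
  zero_mem' := by
    refine ⟨zero_mem _, ?_⟩
    have : starExt C D ⟨(0 : U × U).1, zero_mem _⟩ = 0 := (starExt C D).map_zero
    rw [this]
    simp
  smul_mem' := by
    rintro c p ⟨h, hp⟩
    refine ⟨Submodule.smul_mem _ c h, ?_⟩
    have : starExt C D ⟨(c • p).1, Submodule.smul_mem _ c h⟩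
        = c • starExt C D ⟨p.1, h⟩ := (starExt C D).map_smul c ⟨_, h⟩
    rw [this, Prod.smul_snd, Prod.smul_fst, map_smul, map_smul, map_smul, hp, smul_sub, smul_neg]

/-- The unbounded operator `-C - D D*` on `U`, with its maximal domain
`{u : D* u is defined and C u + D D* u ∈ U}`. -/
def feedback (C : U →ₗ.[ℂ] U) (D : W →L[ℂ] AntiDual (GraphDomain C)) : U →ₗ.[ℂ] U :=
  (feedbackGraph C D).toLinearPMap

open Classical in
/-- `D* u` for `u ∈ D(C)`; the value `0` elsewhere is never used. -/
def obsOut (C : U →ₗ.[ℂ] U) (D : W →L[ℂ] AntiDual (GraphDomain C)) (u : U) : W :=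
  if h : u ∈ C.domain then adj D (⟨u, h⟩ : C.domain) else 0

end Feedback

/-! ### The coupled system -/

section System

variable {V X U W : Type*}
  [NormedAddCommGroup V] [InnerProductSpace ℂ V]
  [NormedAddCommGroup X] [InnerProductSpace ℂ X]
  [NormedAddCommGroup U] [InnerProductSpace ℂ U] [CompleteSpace U]
  [NormedAddCommGroup W] [InnerProductSpace ℂ W] [CompleteSpace W]

variable (V X U) in
/-- The energy space `V × X × U`, with
`‖(x, y, u)‖² = a(x, x) + ‖y‖² + ‖u‖²`; the scalar product of the Hilbert space `V` is `a`. -/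
abbrev EnergySpace : Type _ := WithLp 2 (V × WithLp 2 (X × U))

variable (V) in
/-- The operator `A : V → V'` of the form `a`: `⟨A x, v⟩ = a(x, v)`. -/
def formOp : V →L[ℂ] AntiDual V := pivot (ContinuousLinearMap.id ℂ V)

/-- The graph of `(x, y, u) ↦ (y, -A x - B u, B* y + K u)` with domain
`{(x, y, u) ∈ V × V × D(K) : A x + B u ∈ X}`; `ι : V → X` is the inclusion. -/
def systemGraph (ι : V →L[ℂ] X) (B : U →L[ℂ] AntiDual V) (K : U →ₗ.[ℂ] U) :
    Submodule ℂ (EnergySpace V X U × EnergySpace V X U) where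
  carrier := {p | p.1.snd.fst = ι p.2.fst ∧
    formOp V p.1.fst + B p.1.snd.snd = -pivot ι p.2.snd.fst ∧
    ∃ h : p.1.snd.snd ∈ K.domain, p.2.snd.snd = adj B p.2.fst + K ⟨p.1.snd.snd, h⟩}
  add_mem' := by
    rintro p q ⟨h1, h2, h3, h4⟩ ⟨k1, k2, k3, k4⟩
    refine ⟨by simp [h1, k1], ?_, add_mem h3 k3, ?_⟩
    · simp only [Prod.fst_add, Prod.snd_add, WithLp.add_fst, WithLp.add_snd, map_add, neg_add,
        ← h2, ← k2]
      abel
    · have : K ⟨(p + q).1.snd.snd, add_mem h3 k3⟩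
        = K ⟨p.1.snd.snd, h3⟩ + K ⟨q.1.snd.snd, k3⟩ := K.map_add ⟨_, h3⟩ ⟨_, k3⟩
      rw [this]
      simp only [Prod.snd_add, WithLp.add_fst, WithLp.add_snd, map_add, h4, k4]
      abel
  zero_mem' := by
    refine ⟨by simp, by simp, zero_mem _, ?_⟩
    have : K ⟨(0 : EnergySpace V X U × EnergySpace V X U).1.snd.snd, zero_mem _⟩ = 0 := K.map_zero
    rw [this]
    simp
  smul_mem' := by
    rintro c p ⟨h1, h2, h3, h4⟩
    refine ⟨by simp [h1], ?_, Submodule.smul_mem _ c h3, ?_⟩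
    · ext v
      have key := congrArg (fun f : AntiDual V => c * f v) h2
      simpa [mul_add] using key
    · have : K ⟨(c • p).1.snd.snd, Submodule.smul_mem _ c h3⟩
        = c • K ⟨p.1.snd.snd, h3⟩ := K.map_smul c ⟨_, h3⟩
      rw [this]
      simp only [Prod.smul_snd, WithLp.smul_fst, WithLp.smul_snd, map_smul, h4, smul_add]

/-- The operator `(x, y, u) ↦ (y, -A x - B u, B* y + K u)` on the energy space. -/
def systemOp (ι : V →L[ℂ] X) (B : U →L[ℂ] AntiDual V) (K : U →ₗ.[ℂ] U) :
    EnergySpace V X U →ₗ.[ℂ] EnergySpace V X U :=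
  (systemGraph ι B K).toLinearPMap

/-- The damped operator `𝒜_d`. -/
def dampedOp (ι : V →L[ℂ] X) (B : U →L[ℂ] AntiDual V) (C : U →ₗ.[ℂ] U)
    (D : W →L[ℂ] AntiDual (GraphDomain C)) : EnergySpace V X U →ₗ.[ℂ] EnergySpace V X U :=
  systemOp ι B (feedback C D)

/-- The conservative operator `𝒜_c`. -/
def conservativeOp (ι : V →L[ℂ] X) (B : U →L[ℂ] AntiDual V) (C : U →ₗ.[ℂ] U) :
    EnergySpace V X U →ₗ.[ℂ] EnergySpace V X U :=
  systemOp ι B (-C)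

/-- The energy `E = ‖z‖² / 2`. -/
def energy (z : EnergySpace V X U) : ℝ := ‖z‖ ^ 2 / 2

/-- `λ² + A : V → V'`. -/
def waveOp (ι : V →L[ℂ] X) (l : ℂ) : V →L[ℂ] AntiDual V :=
  l ^ 2 • (pivot ι).comp ι + formOp V

/-- `λ I + C + λ B* (λ² + A)⁻¹ B : U → D(C)'`. -/
def charOp (ι : V →L[ℂ] X) (B : U →L[ℂ] AntiDual V) (C : U →ₗ.[ℂ] U) (l : ℂ) :
    U →L[ℂ] AntiDual (GraphDomain C) :=
  l • pivot (domIncl C) + extC C +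
    l • (pivot (domIncl C)).comp ((adj B).comp ((waveOp ι l).inverse.comp B))

/-- Assumption (H). For `Re λ > 0` the operator
`H(λ) = -D* (λ I + C + λ B* (λ² + A)⁻¹ B)⁻¹ D` is defined on all of `W` and bounded, and `‖H(λ)‖`
is bounded on some vertical line `Re λ = β > 0`. (For `Re λ > 0` both operators inverted here
are invertible, so `inverse` takes no junk value.) -/
def TransferBound (ι : V →L[ℂ] X) (B : U →L[ℂ] AntiDual V) (C : U →ₗ.[ℂ] U)
    (D : W →L[ℂ] AntiDual (GraphDomain C)) : Prop :=
  ∃ H : ℂ → (W →L[ℂ] W),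
    (∀ l : ℂ, 0 < l.re → ∀ w : W,
      ∃ h : (charOp ι B C l).inverse (D w) ∈ (starExt C D).domain,
        H l w = -starExt C D ⟨(charOp ι B C l).inverse (D w), h⟩) ∧
    ∃ β : ℝ, 0 < β ∧ ∃ M : ℝ, ∀ l : ℂ, l.re = β → ‖H l‖ ≤ M

/-- Exponential stability of `z' = 𝒜_d z`. -/
def ExponentiallyStable (ι : V →L[ℂ] X) (B : U →L[ℂ] AntiDual V) (C : U →ₗ.[ℂ] U)
    (D : W →L[ℂ] AntiDual (GraphDomain C)) : Prop :=
  ∃ c : ℝ, 0 < c ∧ ∃ ω : ℝ, 0 < ω ∧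
    ∀ z₀ ∈ (dampedOp ι B C D).domain, ∀ z : ℝ → EnergySpace V X U,
      IsSolution (dampedOp ι B C D) z₀ z →
        ∀ t : ℝ, 0 ≤ t → energy (z t) ≤ c * Real.exp (-ω * t) * energy (z 0)

/-- The observability inequality for `z' = 𝒜_c z`. -/
def Observable (ι : V →L[ℂ] X) (B : U →L[ℂ] AntiDual V) (C : U →ₗ.[ℂ] U)
    (D : W →L[ℂ] AntiDual (GraphDomain C)) : Prop :=
  ∃ T : ℝ, 0 < T ∧ ∃ c : ℝ, 0 < c ∧
    ∀ z₀ ∈ (conservativeOp ι B C).domain, ∀ z₁ : ℝ → EnergySpace V X U,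
      IsSolution (conservativeOp ι B C) z₀ z₁ →
        c * ‖z₀‖ ^ 2 ≤ ∫ s in (0 : ℝ)..T, ‖obsOut C D (z₁ s).snd.snd‖ ^ 2

end System

end DynFeedback

end

open DynFeedback

noncomputable section

namespace DynFeedback

/-! ### M-dissipative operators -/

section MDissipative

variable {E : Type*} [NormedAddCommGroup E] [InnerProductSpace ℂ E]

/-! The equivalence rests on two relations between a state `p` of the conservative system and a
state `q` of the damped one, with outputs `Oc p` and `Od q` (the values of `D*` on their third
components). The wave coupling and `C` are skew, so the real part of `⟨p - q, 𝒜_c p - 𝒜_d q⟩` is `Re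
⟨Od q, Oc p⟩ - ‖Od q‖²` (`energyIdentity_system`). With `p = 0` this says that damping dissipates
exactly the output. The other relation concerns frequencies: if `λ (p - q) = 𝒜_c p - 𝒜_d q`,
eliminating the wave part leaves `(λ + C + λ B* (λ² + A)⁻¹ B)(u_p - u_q) = D (Od q)`, hence `Oc p -
Od q = -H(λ) Od q`. Under (H) this is bounded by `M ‖Od q‖` on a vertical line
(`frequencyBound_of_transferBound`); under (B) the energy identity alone gives such a bound
(`frequencyBound_of_isBoundedInto`).

Decay gives observability without the frequency bound (`observable_of_decay`). For a conservative
`P` and a damped `Q` starting close to `P 0`, the energy identity bounds `∫ ‖Od Q‖²` by `∫ ‖Oc P‖²`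
plus the initial discrepancy, while decay forces `Q` to dissipate a fixed fraction of its energy
through `Od`.

Conversely, let `Q` be damped. Since the two domains differ, no conservative classical trajectory
need start at `Q 0`. Instead `exists_companion` builds `P` with `P 0 = 0`, driven by `Q` up to time
`1` and free afterwards, so that `P - min(t, 1) Q` starts at zero and has derivative `𝒜_c P - 𝒜_d
(min(t, 1) Q)`. Plancherel turns the frequency bound into a bound of the output difference by the
damped output in `L²(e^{-2βt} dt)` (`integral_output_le`). Observability of `P` after time `1` and
the energy identity before it then bound `‖Q 0‖²` by the weighted output of `Q`
(`exists_norm_sq_le_of_observable`). The weight makes the output after a late time `S` negligible,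
so a fixed fraction of the energy is lost by time `S` (`decay_of_observable`), and iteration gives
exponential decay.

Trajectories of both systems come from Yosida approximation of m-dissipative operators
(`exists_trajectory`, `systemOp_isMDissipative`). -/

theorem domIncl_injective (K : E →ₗ.[ℂ] E) : Function.Injective (domIncl K) :=
  fun _ _ h => Subtype.ext h

theorem norm_sq_graphDomain (K : E →ₗ.[ℂ] E) (p : GraphDomain K) :
    ‖p‖ ^ 2 = ‖domIncl K p‖ ^ 2 + ‖domApply K p‖ ^ 2 := by
  change ‖graphMap K p‖ ^ 2 = _
  rw [WithLp.prod_norm_sq_eq_of_L2]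
  rfl

theorem norm_domIncl_le (K : E →ₗ.[ℂ] E) (p : GraphDomain K) : ‖domIncl K p‖ ≤ ‖p‖ := by
  have := norm_sq_graphDomain K p
  exact abs_le_of_sq_le_sq' (by nlinarith [sq_nonneg ‖domApply K p‖]) (norm_nonneg _) |>.2

theorem norm_domApply_le (K : E →ₗ.[ℂ] E) (p : GraphDomain K) : ‖domApply K p‖ ≤ ‖p‖ := by
  have := norm_sq_graphDomain K p
  exact abs_le_of_sq_le_sq' (by nlinarith [sq_nonneg ‖domIncl K p‖]) (norm_nonneg _) |>.2

theorem norm_graphDomain_le (K : E →ₗ.[ℂ] E) (p : GraphDomain K) :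
    ‖p‖ ≤ ‖domIncl K p‖ + ‖domApply K p‖ := by
  have := norm_sq_graphDomain K p
  refine abs_le_of_sq_le_sq' ?_ (by positivity) |>.2
  nlinarith [norm_nonneg (domIncl K p), norm_nonneg (domApply K p)]

theorem IsMDissipative.re_inner_nonpos {K : E →ₗ.[ℂ] E} (hK : IsMDissipative K)
    (p : GraphDomain K) : (inner ℂ (domIncl K p) (domApply K p)).re ≤ 0 :=
  hK.1 p

/-- `‖l x‖ ≤ ‖l x - K x‖` for dissipative `K`. -/
theorem norm_le_of_re_inner_nonpos {x y : E} (h : (inner ℂ x y).re ≤ 0) {l : ℝ} :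
    l * ‖x‖ ≤ ‖(l : ℂ) • x - y‖ := by
  have h1 : (inner ℂ x ((l : ℂ) • x - y)).re = l * ‖x‖ ^ 2 - (inner ℂ x y).re := by
    rw [inner_sub_right, inner_smul_right, inner_self_eq_norm_sq_to_K]
    simp [← Complex.ofReal_pow]
  have h2 : (inner ℂ x ((l : ℂ) • x - y)).re ≤ ‖x‖ * ‖(l : ℂ) • x - y‖ :=
    (Complex.re_le_norm _).trans (norm_inner_le_norm _ _)
  rcases (norm_nonneg x).eq_or_lt with h0 | h0
  · rw [← h0]; simp
  · refine le_of_mul_le_mul_left ?_ h0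
    nlinarith

/-- Lipschitz perturbations of the resolvent equation. -/
theorem exists_resolvent_perturb [CompleteSpace E] {K : E →ₗ.[ℂ] E}
    (hd : ∀ x : K.domain, (inner ℂ (x : E) (K x)).re ≤ 0) {l : ℝ} (hl : 0 < l)
    (hs : ∀ f : E, ∃ x : K.domain, (l : ℂ) • (x : E) - K x = f)
    (G : E → E) {k : ℝ} (hk : k < l) (hG : ∀ a b, ‖G a - G b‖ ≤ k * ‖a - b‖) (f : E) :
    ∃ x : K.domain, (l : ℂ) • (x : E) - K x = f + G x := by
  choose R hR using hs
  have hRl : ∀ a b, ‖(R a : E) - R b‖ ≤ ‖a - b‖ / l := by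
    intro a b
    rw [le_div_iff₀ hl, mul_comm]
    have := norm_le_of_re_inner_nonpos (l := l) (hd (R a - R b))
    refine this.trans (le_of_eq ?_)
    rw [LinearPMap.map_sub]
    conv_rhs => rw [← hR a, ← hR b]
    congr 1
    push_cast
    rw [smul_sub]; abel
  -- A negative Lipschitz constant is possible only if `E` is a single point.
  rcases lt_or_ge k 0 with hk0 | hk0
  · have hsub : ∀ a b : E, a = b := by
      intro a b
      by_contra hab
      have : 0 < ‖a - b‖ := norm_pos_iff.2 (sub_ne_zero.2 hab)
      nlinarith [hG a b, norm_nonneg (G a - G b)]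
    exact ⟨0, hsub _ _⟩
  -- The solution is a fixed point of `x ↦ (l - K)⁻¹ (f + G x)`, a contraction of ratio `k / l`.
  have hc : ContractingWith (NNReal.mk (k / l) (by positivity)) (fun x => (R (f + G x) : E)) := by
    refine ⟨by rw [← NNReal.coe_lt_coe]; simpa [div_lt_one hl] using hk, ?_⟩
    refine LipschitzWith.of_dist_le_mul fun a b => ?_
    rw [dist_eq_norm, dist_eq_norm]
    refine (hRl _ _).trans ?_
    rw [add_sub_add_left_eq_sub, NNReal.coe_mk, div_mul_eq_mul_div]
    gcongr
    exact hG a b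
  have hfix := hc.fixedPoint_isFixedPt
  set x := ContractingWith.fixedPoint _ hc
  refine ⟨R (f + G x), ?_⟩
  rw [hR]
  congr 2
  exact hfix.symm

/-- Continuation in the parameter: surjectivity at `a` passes to every `b` in `(0, 2a)`, because the
perturbation `(a - b) x` has Lipschitz constant `|a - b| < a`. Multiplying by `3/2` repeatedly
climbs above any target, and one last step descends to it. -/
theorem IsMDissipative.surjective [CompleteSpace E] {K : E →ₗ.[ℂ] E} (hK : IsMDissipative K)
    {l : ℝ} (hl : 0 < l) (f : E) : ∃ x : K.domain, (l : ℂ) • (x : E) - K x = f := by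
  obtain ⟨hd, l₀, hl₀, hs⟩ := hK
  have step : ∀ a b : ℝ, 0 < a → 0 < b → b < 2 * a →
      (∀ f : E, ∃ x : K.domain, (a : ℂ) • (x : E) - K x = f) →
      ∀ f : E, ∃ x : K.domain, (b : ℂ) • (x : E) - K x = f := by
    intro a b ha hb hab h f
    obtain ⟨x, hx⟩ := exists_resolvent_perturb hd ha h (fun x => ((a : ℂ) - b) • x)
      (k := |a - b|) (abs_sub_lt_iff.2 ⟨by linarith, by linarith⟩)
      (fun x y => by rw [← smul_sub, norm_smul, ← Complex.ofReal_sub, Complex.norm_real]; rfl) f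
    refine ⟨x, ?_⟩
    calc (b : ℂ) • (x : E) - K x = ((a : ℂ) • (x : E) - K x) - ((a : ℂ) - b) • (x : E) := by module
      _ = f := by rw [hx]; abel
  have iter : ∀ n : ℕ, ∀ f : E, ∃ x : K.domain,
      (((3 / 2 : ℝ) ^ n * l₀ : ℝ) : ℂ) • (x : E) - K x = f := by
    intro n
    induction n with
    | zero => simpa using hs
    | succ n ih =>
      refine step _ _ (by positivity) (by positivity) ?_ ih
      rw [pow_succ]
      have : 0 < (3 / 2 : ℝ) ^ n * l₀ := by positivity
      linarith
  obtain ⟨n, hn⟩ := pow_unbounded_of_one_lt (l / l₀) (by norm_num : (1 : ℝ) < 3 / 2)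
  refine step _ _ (by positivity) hl ?_ (iter n) f
  rw [div_lt_iff₀ hl₀] at hn
  linarith

/-- Bounded dissipative perturbations. -/
theorem IsMDissipative.vadd [CompleteSpace E] {K : E →ₗ.[ℂ] E} (hK : IsMDissipative K)
    (N : E →L[ℂ] E) (hN : ∀ x, (inner ℂ x (N x)).re ≤ 0) :
    IsMDissipative ((N : E →ₗ[ℂ] E) +ᵥ K) := by
  -- At the parameter `‖N‖ + 1` the term `N` is a perturbation of Lipschitz constant smaller than
  -- the parameter.
  refine ⟨fun x => ?_, ‖N‖ + 1, by positivity, fun f => ?_⟩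
  · rw [LinearPMap.vadd_apply, inner_add_right, Complex.add_re]
    exact add_nonpos (hN _) (hK.1 x)
  · obtain ⟨x, hx⟩ := exists_resolvent_perturb hK.1 (l := ‖N‖ + 1) (by positivity)
      (hK.surjective (by positivity)) N (k := ‖N‖) (by linarith)
      (fun a b => by rw [← map_sub]; exact N.le_opNorm _) f
    refine ⟨x, ?_⟩
    rw [LinearPMap.vadd_apply]
    change _ - (N x + K x) = f
    rw [add_comm (N _), ← sub_sub, hx, add_sub_cancel_right]

theorem IsMDissipative.norm_le_resolvent {K : E →ₗ.[ℂ] E} (hK : IsMDissipative K) {l : ℝ}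
    (hl : 0 < l) (p : GraphDomain K) :
    ‖p‖ ≤ (1 / l + 2) * ‖(l : ℂ) • domIncl K p - domApply K p‖ := by
  have h := norm_le_of_re_inner_nonpos (l := l) (hK.re_inner_nonpos p)
  have h2 : ‖domApply K p‖ ≤ ‖(l : ℂ) • domIncl K p‖ +
      ‖(l : ℂ) • domIncl K p - domApply K p‖ := by
    have := norm_sub_le ((l : ℂ) • domIncl K p) ((l : ℂ) • domIncl K p - domApply K p)
    rwa [sub_sub_cancel] at this
  rw [norm_smul, Complex.norm_real, Real.norm_of_nonneg hl.le] at h2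
  have h3 := norm_graphDomain_le K p
  have h4 : ‖domIncl K p‖ ≤ 1 / l * ‖(l : ℂ) • domIncl K p - domApply K p‖ := by
    rw [one_div, inv_mul_eq_div, le_div_iff₀ hl]; linarith
  linarith

/-- `l - K` as a linear bijection of `D(K)` onto `E`. -/
def resolventLinearEquiv [CompleteSpace E] {K : E →ₗ.[ℂ] E} (hK : IsMDissipative K) {l : ℝ}
    (hl : 0 < l) : GraphDomain K ≃ₗ[ℂ] E :=
  LinearEquiv.ofBijective ((l : ℂ) • domIncl K - domApply K : GraphDomain K →L[ℂ] E).toLinearMap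
    ⟨by
      rw [← LinearMap.ker_eq_bot, LinearMap.ker_eq_bot']
      intro p hp
      have h := hK.norm_le_resolvent hl p
      have hp' : (l : ℂ) • domIncl K p - domApply K p = 0 := hp
      rw [hp', norm_zero, mul_zero] at h
      exact norm_le_zero_iff.1 h,
    fun f => hK.surjective hl f⟩

/-- `l - K` as an isomorphism of `D(K)` onto `E`. -/
def resolventEquiv [CompleteSpace E] {K : E →ₗ.[ℂ] E} (hK : IsMDissipative K) {l : ℝ}
    (hl : 0 < l) : GraphDomain K ≃L[ℂ] E :=
  (resolventLinearEquiv hK hl).toContinuousLinearEquivOfBounds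
    (‖(l : ℂ) • domIncl K - domApply K‖) (1 / l + 2)
    (fun p => ((l : ℂ) • domIncl K - domApply K).le_opNorm p)
    (fun f => by
      obtain ⟨p, rfl⟩ := (resolventLinearEquiv hK hl).surjective f
      rw [LinearEquiv.symm_apply_apply]
      exact hK.norm_le_resolvent hl p)

theorem resolventEquiv_apply [CompleteSpace E] {K : E →ₗ.[ℂ] E} (hK : IsMDissipative K) {l : ℝ}
    (hl : 0 < l) (p : GraphDomain K) :
    resolventEquiv hK hl p = (l : ℂ) • domIncl K p - domApply K p := rfl

theorem IsMDissipative.completeSpace [CompleteSpace E] {K : E →ₗ.[ℂ] E} (hK : IsMDissipative K) :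
    CompleteSpace (GraphDomain K) :=
  (completeSpace_congr (e := (resolventEquiv hK one_pos).toLinearEquiv.toEquiv)
    (resolventEquiv hK one_pos).isUniformEmbedding).2 inferInstance

/-- A vector orthogonal to the domain has the form `p - K p`; pairing it with `p` gives `‖p‖² = Re
⟨p, K p⟩ ≤ 0`. -/
theorem IsMDissipative.denseRange [CompleteSpace E] {K : E →ₗ.[ℂ] E} (hK : IsMDissipative K) :
    DenseRange (domIncl K) := by
  have h : (LinearMap.range (domIncl K : GraphDomain K →ₗ[ℂ] E)).topologicalClosure = ⊤ := by
    rw [Submodule.topologicalClosure_eq_top_iff, Submodule.eq_bot_iff]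
    intro y hy
    obtain ⟨p, rfl⟩ := (resolventEquiv hK one_pos).surjective y
    have h1 := hy (domIncl K p) ⟨p, rfl⟩
    rw [resolventEquiv_apply, Complex.ofReal_one, one_smul, inner_sub_right] at h1
    have h2 := congrArg Complex.re h1
    rw [Complex.sub_re, inner_self_eq_norm_sq_to_K, Complex.zero_re] at h2
    have h3 := hK.re_inner_nonpos p
    have h4 : ‖domIncl K p‖ ^ 2 ≤ 0 := by
      have : ((‖domIncl K p‖ : ℂ) ^ 2).re = ‖domIncl K p‖ ^ 2 := by
        rw [← Complex.ofReal_pow, Complex.ofReal_re]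
      erw [this] at h2
      linarith
    have h5 : domIncl K p = 0 := by
      rw [← norm_eq_zero]; nlinarith [norm_nonneg (domIncl K p)]
    have : p = 0 := domIncl_injective K (by rw [h5, map_zero])
    rw [this, map_zero]
  rw [DenseRange, dense_iff_closure_eq]
  have := congrArg (fun s : Submodule ℂ E => (s : Set E)) h
  simpa [LinearMap.coe_range] using this

end MDissipative

/-! ### Generation of trajectories -/

section Generation

variable {E : Type*} [NormedAddCommGroup E] [InnerProductSpace ℂ E]

theorem hasDerivWithinAt_norm_sq {z : ℝ → E} {z' : E} {s : Set ℝ} {t : ℝ}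
    (h : HasDerivWithinAt z z' s t) :
    HasDerivWithinAt (fun r => ‖z r‖ ^ 2) (2 * (inner ℂ (z t) z').re) s t := by
  let := InnerProductSpace.rclikeToReal ℂ E
  have := HasDerivWithinAt.norm_sq (F := E) h
  rwa [real_inner_eq_re_inner ℂ] at this

/-- A function on `[0, ∞)` with right derivative at most `c` grows at most linearly. -/
theorem le_add_mul_of_hasDerivWithinAt {f f' : ℝ → ℝ} {c : ℝ}
    (hf : ∀ t, 0 ≤ t → HasDerivWithinAt f (f' t) (Ici 0) t) (hc : ∀ t, 0 ≤ t → f' t ≤ c)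
    {t : ℝ} (ht : 0 ≤ t) : f t ≤ f 0 + c * t := by
  refine image_le_of_deriv_right_le_deriv_boundary (a := 0) (b := t) (f' := f')
    (B := fun s => f 0 + c * s) (B' := fun _ => c)
    (fun s hs => ((hf s hs.1).continuousWithinAt.mono Icc_subset_Ici_self))
    (fun s hs => (hf s hs.1).mono (Ici_subset_Ici.2 hs.1)) (by simp) (by fun_prop)
    (fun s _ => ?_) (fun s hs => hc s hs.1) (right_mem_Icc.2 ht)
  simpa using (((hasDerivAt_id s).const_mul c).const_add (f 0)).hasDerivWithinAt

/-! ### Contraction groups of bounded dissipative operators -/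

section Exp

variable [CompleteSpace E]

theorem hasDerivAt_exp_apply (A : E →L[ℂ] E) (x : E) (t : ℝ) :
    HasDerivAt (fun s : ℝ => NormedSpace.exp (s • A) x) (NormedSpace.exp (t • A) (A x)) t := by
  have h := hasDerivAt_exp_smul_const (𝕂 := ℝ) A t
  exact ((ContinuousLinearMap.apply ℂ E x).restrictScalars ℝ).hasFDerivAt.comp_hasDerivAt t h

theorem exp_apply_comm (A : E →L[ℂ] E) (x : E) (t : ℝ) :
    NormedSpace.exp (t • A) (A x) = A (NormedSpace.exp (t • A) x) := by
  have h : Commute (t • A) A := (Commute.refl A).smul_left t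
  exact congrArg (fun B : E →L[ℂ] E => B x) h.exp_left.eq

theorem norm_exp_apply_le {A : E →L[ℂ] E} (hA : ∀ x, (inner ℂ x (A x)).re ≤ 0) (x : E) {t : ℝ}
    (ht : 0 ≤ t) : ‖NormedSpace.exp (t • A) x‖ ≤ ‖x‖ := by
  have h := le_add_mul_of_hasDerivWithinAt (c := 0)
    (fun s _ => hasDerivWithinAt_norm_sq (hasDerivAt_exp_apply A x s).hasDerivWithinAt)
    (fun s _ => by
      rw [exp_apply_comm]
      linarith [hA (NormedSpace.exp (s • A) x)]) ht
  simp only [zero_smul, NormedSpace.exp_zero, one_apply_eq_self, zero_mul,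
    add_zero] at h
  exact (sq_le_sq₀ (norm_nonneg _) (norm_nonneg _)).1 h

end Exp

/-! ### The Yosida approximation -/

section Yosida

variable [CompleteSpace E] {K : E →ₗ.[ℂ] E} (hK : IsMDissipative K) {l : ℝ} (hl : 0 < l)

/-- `l (l - K)⁻¹` with values in the domain. -/
def yosidaPt : E →L[ℂ] GraphDomain K :=
  (l : ℂ) • ((resolventEquiv hK hl).symm : E →L[ℂ] GraphDomain K)

/-- The Yosida approximation `l K (l - K)⁻¹`. -/
def yosida : E →L[ℂ] E := (domApply K).comp (yosidaPt hK hl)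

theorem domIncl_yosidaPt (x : E) :
    domIncl K (yosidaPt hK hl x) = x + (l : ℂ)⁻¹ • yosida hK hl x := by
  have hl' : (l : ℂ) ≠ 0 := by exact_mod_cast hl.ne'
  have h := (resolventEquiv hK hl).apply_symm_apply x
  rw [resolventEquiv_apply] at h
  simp only [yosida, yosidaPt, ContinuousLinearMap.comp_apply, smul_apply,
    map_smul, smul_smul, inv_mul_cancel₀ hl', one_smul, ContinuousLinearEquiv.coe_coe]
  nth_rw 2 [← h]
  abel

/-- With `J = l (l - K)⁻¹` and `Y = K J` one has `x = J x - l⁻¹ Y x`, so `Re ⟨x, Y x⟩` is the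
nonpositive `Re ⟨J x, K J x⟩` minus `l⁻¹ ‖Y x‖²`. -/
theorem re_inner_yosida (x : E) : (inner ℂ x (yosida hK hl x)).re ≤ 0 := by
  have h := hK.re_inner_nonpos (yosidaPt hK hl x)
  rw [domIncl_yosidaPt] at h
  change (inner ℂ (x + (l : ℂ)⁻¹ • yosida hK hl x) (yosida hK hl x)).re ≤ 0 at h
  rw [inner_add_left, inner_smul_left, inner_self_eq_norm_sq_to_K, map_inv₀, Complex.conj_ofReal,
    Complex.add_re, ← Complex.ofReal_inv] at h
  have h2 : (((l⁻¹ : ℝ) : ℂ) * (‖yosida hK hl x‖ : ℂ) ^ 2).re = l⁻¹ * ‖yosida hK hl x‖ ^ 2 := by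
    rw [← Complex.ofReal_pow, ← Complex.ofReal_mul, Complex.ofReal_re]
  erw [h2] at h
  have : 0 ≤ l⁻¹ * ‖yosida hK hl x‖ ^ 2 := by positivity
  linarith

theorem norm_domIncl_yosidaPt_le (x : E) : ‖domIncl K (yosidaPt hK hl x)‖ ≤ ‖x‖ := by
  have h := norm_le_of_re_inner_nonpos (l := l)
    (hK.re_inner_nonpos ((resolventEquiv hK hl).symm x))
  rw [← resolventEquiv_apply hK hl, ContinuousLinearEquiv.apply_symm_apply] at h
  simpa [yosidaPt, norm_smul, abs_of_pos hl] using h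

/-- On the domain `K` commutes with its resolvent. The approximations are therefore bounded there
uniformly in `l`, and they converge. -/
theorem yosida_domIncl (p : GraphDomain K) :
    yosida hK hl (domIncl K p) = domIncl K (yosidaPt hK hl (domApply K p)) := by
  have h : yosidaPt hK hl (domIncl K p) - p = (resolventEquiv hK hl).symm (domApply K p) := by
    rw [ContinuousLinearEquiv.eq_symm_apply, map_sub]
    simp only [yosidaPt, smul_apply, map_smul,
      ContinuousLinearEquiv.coe_coe, ContinuousLinearEquiv.apply_symm_apply]
    rw [resolventEquiv_apply]
    abel
  have h2 := (resolventEquiv hK hl).apply_symm_apply (domApply K p)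
  rw [resolventEquiv_apply] at h2
  have h3 : yosidaPt hK hl (domIncl K p) = p + (resolventEquiv hK hl).symm (domApply K p) := by
    rw [← h]; abel
  simp only [yosida, ContinuousLinearMap.comp_apply]
  rw [h3, map_add]
  nth_rw 1 [← h2]
  simp [yosidaPt]

theorem norm_yosida_domIncl_le (p : GraphDomain K) :
    ‖yosida hK hl (domIncl K p)‖ ≤ ‖domApply K p‖ := by
  rw [yosida_domIncl]
  exact norm_domIncl_yosidaPt_le hK hl _

end Yosida

/-! ### Convergence of the approximating semigroups -/

section Semigroup

variable [CompleteSpace E] {K : E →ₗ.[ℂ] E} (hK : IsMDissipative K)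

/-- The semigroup generated by the `n`-th Yosida approximation. -/
def yosidaFlow (n : ℕ) (t : ℝ) : E →L[ℂ] E :=
  NormedSpace.exp (t • yosida hK (Nat.cast_add_one_pos n : (0 : ℝ) < (n : ℝ) + 1))

theorem norm_yosidaFlow_le (n : ℕ) {t : ℝ} (ht : 0 ≤ t) (x : E) :
    ‖yosidaFlow hK n t x‖ ≤ ‖x‖ :=
  norm_exp_apply_le (re_inner_yosida hK _) x ht

theorem tendsto_yosidaPt (x : E) : Tendsto (fun n : ℕ =>
    domIncl K (yosidaPt hK (Nat.cast_add_one_pos n : (0 : ℝ) < (n : ℝ) + 1) x)) atTop (𝓝 x) := by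
  rw [Metric.tendsto_atTop]
  intro ε hε
  obtain ⟨_, hp, p, rfl⟩ := Metric.dense_iff.1 hK.denseRange x (ε / 3) (by positivity)
  obtain ⟨N, hN⟩ := exists_nat_gt (‖domApply K p‖ / (ε / 3))
  refine ⟨N, fun n hn => ?_⟩
  have hn0 : (0 : ℝ) < (n : ℝ) + 1 := Nat.cast_add_one_pos n
  rw [dist_eq_norm]
  have hp' : ‖x - domIncl K p‖ < ε / 3 := by
    rw [← dist_eq_norm, dist_comm]; exact hp
  have h1 := norm_domIncl_yosidaPt_le hK hn0 (x - domIncl K p)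
  have h2 := domIncl_yosidaPt hK hn0 (domIncl K p)
  have h3 : ‖domIncl K (yosidaPt hK hn0 (domIncl K p)) - domIncl K p‖ < ε / 3 := by
    rw [h2, add_sub_cancel_left, norm_smul, norm_inv, Complex.norm_real,
      Real.norm_of_nonneg hn0.le, inv_mul_lt_iff₀ hn0]
    refine (norm_yosida_domIncl_le hK hn0 p).trans_lt ?_
    rw [div_lt_iff₀ (by positivity)] at hN
    have : (N : ℝ) ≤ n := by exact_mod_cast hn
    nlinarith
  have h4 : domIncl K (yosidaPt hK hn0 x) - x = domIncl K (yosidaPt hK hn0 (x - domIncl K p))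
      + (domIncl K (yosidaPt hK hn0 (domIncl K p)) - domIncl K p) - (x - domIncl K p) := by
    rw [map_sub, map_sub]; abel
  rw [h4]
  refine (norm_sub_le _ _).trans_lt ?_
  have := norm_add_le (domIncl K (yosidaPt hK hn0 (x - domIncl K p)))
    (domIncl K (yosidaPt hK hn0 (domIncl K p)) - domIncl K p)
  linarith

theorem yosidaFlow_hasDerivAt (n : ℕ) (x : E) (t : ℝ) :
    HasDerivAt (fun s => yosidaFlow hK n s x) (yosidaFlow hK n t
      (yosida hK (Nat.cast_add_one_pos n : (0 : ℝ) < (n : ℝ) + 1) x)) t :=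
  hasDerivAt_exp_apply _ _ _

theorem yosidaFlow_zero (n : ℕ) (x : E) : yosidaFlow hK n 0 x = x := by
  simp [yosidaFlow]

/-- With `a`, `b` the two flows and `Y_n a`, `Y_m b` their derivatives, dissipativity is applied to
the difference of the regularized points `a + (n+1)⁻¹ Y_n a` and `b + (m+1)⁻¹ Y_m b`. The
corrections are small because `‖Y_n a‖` and `‖Y_m b‖` are at most the initial `‖K p‖`. -/
theorem norm_yosidaFlow_sub_sq_le (p : GraphDomain K) (n m : ℕ) {t : ℝ} (ht : 0 ≤ t) :
    ‖yosidaFlow hK n t (domIncl K p) - yosidaFlow hK m t (domIncl K p)‖ ^ 2 ≤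
      4 * ‖domApply K p‖ ^ 2 * (((n : ℝ) + 1)⁻¹ + ((m : ℝ) + 1)⁻¹) * t := by
  have hn0 : (0 : ℝ) < (n : ℝ) + 1 := Nat.cast_add_one_pos n
  have hm0 : (0 : ℝ) < (m : ℝ) + 1 := Nat.cast_add_one_pos m
  have h := le_add_mul_of_hasDerivWithinAt
    (c := 4 * ‖domApply K p‖ ^ 2 * (((n : ℝ) + 1)⁻¹ + ((m : ℝ) + 1)⁻¹))
    (fun s _ => hasDerivWithinAt_norm_sq ((yosidaFlow_hasDerivAt hK n (domIncl K p) s).sub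
      (yosidaFlow_hasDerivAt hK m (domIncl K p) s)).hasDerivWithinAt) ?_ ht
  · simpa [yosidaFlow_zero] using h
  intro s hs
  set Yn := yosida hK hn0
  set Ym := yosida hK hm0
  set a := yosidaFlow hK n s (domIncl K p) with ha
  set b := yosidaFlow hK m s (domIncl K p) with hb
  have ea : yosidaFlow hK n s (Yn (domIncl K p)) = Yn a := exp_apply_comm _ _ _
  have eb : yosidaFlow hK m s (Ym (domIncl K p)) = Ym b := exp_apply_comm _ _ _
  have na : ‖Yn a‖ ≤ ‖domApply K p‖ := by
    rw [← ea]
    exact (norm_yosidaFlow_le hK n hs _).trans (norm_yosida_domIncl_le hK hn0 p)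
  have nb : ‖Ym b‖ ≤ ‖domApply K p‖ := by
    rw [← eb]
    exact (norm_yosidaFlow_le hK m hs _).trans (norm_yosida_domIncl_le hK hm0 p)
  rw [ea, eb]
  have hd := hK.re_inner_nonpos (yosidaPt hK hn0 a - yosidaPt hK hm0 b)
  rw [map_sub, map_sub, domIncl_yosidaPt, domIncl_yosidaPt] at hd
  change (inner ℂ (a + (((n : ℝ) + 1 : ℝ) : ℂ)⁻¹ • Yn a - (b + (((m : ℝ) + 1 : ℝ) : ℂ)⁻¹ • Ym b))
    (Yn a - Ym b)).re ≤ 0 at hd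
  have e : a + (((n : ℝ) + 1 : ℝ) : ℂ)⁻¹ • Yn a - (b + (((m : ℝ) + 1 : ℝ) : ℂ)⁻¹ • Ym b)
      = (a - b) + ((((n : ℝ) + 1 : ℝ) : ℂ)⁻¹ • Yn a - (((m : ℝ) + 1 : ℝ) : ℂ)⁻¹ • Ym b) := by abel
  rw [e, inner_add_left, Complex.add_re] at hd
  have hc : ‖inner ℂ ((((n : ℝ) + 1 : ℝ) : ℂ)⁻¹ • Yn a - (((m : ℝ) + 1 : ℝ) : ℂ)⁻¹ • Ym b)
      (Yn a - Ym b)‖ ≤ ((((n : ℝ) + 1)⁻¹ + ((m : ℝ) + 1)⁻¹) * ‖domApply K p‖)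
        * (2 * ‖domApply K p‖) := by
    refine (norm_inner_le_norm _ _).trans ?_
    refine mul_le_mul ?_ ?_ (norm_nonneg _) (by positivity)
    · refine (norm_sub_le _ _).trans ?_
      rw [norm_smul, norm_smul, norm_inv, norm_inv, Complex.norm_real, Complex.norm_real,
        Real.norm_of_nonneg hn0.le, Real.norm_of_nonneg hm0.le, add_mul]
      gcongr
    · refine (norm_sub_le _ _).trans ?_
      linarith
  have := (abs_le.1 (Complex.abs_re_le_norm
    (inner ℂ ((((n : ℝ) + 1 : ℝ) : ℂ)⁻¹ • Yn a - (((m : ℝ) + 1 : ℝ) : ℂ)⁻¹ • Ym b)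
      (Yn a - Ym b)))).1
  change 2 * (inner ℂ (a - b) (Yn a - Ym b)).re ≤ _
  nlinarith

theorem exists_tendsto_yosidaFlow {t : ℝ} (ht : 0 ≤ t) (x : E) :
    ∃ y, Tendsto (fun n => yosidaFlow hK n t x) atTop (𝓝 y) := by
  apply cauchySeq_tendsto_of_complete
  rw [Metric.cauchySeq_iff]
  intro ε hε
  obtain ⟨_, hp, p, rfl⟩ := Metric.dense_iff.1 hK.denseRange x (ε / 3) (by positivity)
  obtain ⟨N, hN⟩ := exists_nat_gt (8 * ‖domApply K p‖ ^ 2 * t / (ε / 3) ^ 2)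
  rw [div_lt_iff₀ (by positivity)] at hN
  refine ⟨N, fun n hn m hm => ?_⟩
  have hp' : ‖x - domIncl K p‖ < ε / 3 := by
    rw [← dist_eq_norm, dist_comm]; exact hp
  have inv_le : ∀ k : ℕ, N ≤ k → ((k : ℝ) + 1)⁻¹ ≤ ((N : ℝ) + 1)⁻¹ := by
    intro k hk
    have : (N : ℝ) ≤ k := by exact_mod_cast hk
    gcongr
  have h1 : ‖yosidaFlow hK n t (domIncl K p) - yosidaFlow hK m t (domIncl K p)‖ < ε / 3 := by
    refine (sq_lt_sq₀ (norm_nonneg _) (by positivity)).1 ?_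
    refine (norm_yosidaFlow_sub_sq_le hK p n m ht).trans_lt ?_
    have h2 : ((n : ℝ) + 1)⁻¹ + ((m : ℝ) + 1)⁻¹ ≤ 2 * ((N : ℝ) + 1)⁻¹ := by
      linarith [inv_le n hn, inv_le m hm]
    have h3 : 4 * ‖domApply K p‖ ^ 2 * (((n : ℝ) + 1)⁻¹ + ((m : ℝ) + 1)⁻¹) * t ≤
        4 * ‖domApply K p‖ ^ 2 * (2 * ((N : ℝ) + 1)⁻¹) * t := by gcongr
    refine h3.trans_lt ?_
    have h5 : 4 * ‖domApply K p‖ ^ 2 * (2 * ((N : ℝ) + 1)⁻¹) * t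
        = (8 * ‖domApply K p‖ ^ 2 * t) / ((N : ℝ) + 1) := by field_simp; ring
    rw [h5, div_lt_iff₀ (by positivity)]
    nlinarith [sq_nonneg (ε / 3)]
  have h2 := norm_yosidaFlow_le hK n ht (x - domIncl K p)
  have h3 := norm_yosidaFlow_le hK m ht (x - domIncl K p)
  rw [dist_eq_norm]
  have e : yosidaFlow hK n t x - yosidaFlow hK m t x = yosidaFlow hK n t (x - domIncl K p)
      + (yosidaFlow hK n t (domIncl K p) - yosidaFlow hK m t (domIncl K p))
      - yosidaFlow hK m t (x - domIncl K p) := by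
    rw [map_sub, map_sub]; abel
  rw [e]
  refine (norm_sub_le _ _).trans_lt ?_
  have := norm_add_le (yosidaFlow hK n t (x - domIncl K p))
    (yosidaFlow hK n t (domIncl K p) - yosidaFlow hK m t (domIncl K p))
  linarith

end Semigroup

/-- A trajectory of `z' = K z` on `[0, ∞)`, continuous for the graph norm (the values at negative
times are irrelevant). -/
def IsTrajectory (K : E →ₗ.[ℂ] E) (P : ℝ → GraphDomain K) : Prop :=
  Continuous P ∧ ∀ t, 0 ≤ t →
    HasDerivWithinAt (fun s => domIncl K (P s)) (domApply K (P t)) (Ici 0) t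

theorem continuous_graphDomain {K : E →ₗ.[ℂ] E} {T : Type*} [TopologicalSpace T]
    {P : T → GraphDomain K} (h1 : Continuous fun t => domIncl K (P t))
    (h2 : Continuous fun t => domApply K (P t)) : Continuous P := by
  have h : IsUniformInducing (graphMap K) := ⟨rfl⟩
  rw [h.isInducing.continuous_iff]
  exact (WithLp.prod_continuous_toLp 2 E E).comp (h1.prodMk h2)

theorem exists_trajectory [CompleteSpace E] {K : E →ₗ.[ℂ] E} (hK : IsMDissipative K)
    (p : GraphDomain K) : ∃ P, IsTrajectory K P ∧ P 0 = p := by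
  -- Clamping time at `0` makes the limits exist for every real `t`, so that continuity can be
  -- stated on the whole line.
  have hlim : ∀ (t : ℝ) (x : E), ∃ y,
      Tendsto (fun n => yosidaFlow hK n (max t 0) x) atTop (𝓝 y) :=
    fun t x => exists_tendsto_yosidaFlow hK (le_max_right _ _) x
  choose S hS using hlim
  have hsub : ∀ t x y, ‖S t x - S t y‖ ≤ ‖x - y‖ := by
    intro t x y
    refine le_of_tendsto ((hS t x).sub (hS t y)).norm (Eventually.of_forall fun n => ?_)
    rw [← map_sub]
    exact norm_yosidaFlow_le hK n (le_max_right _ _) _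
  have hlip : ∀ (q : GraphDomain K) (s t : ℝ),
      ‖S s (domIncl K q) - S t (domIncl K q)‖ ≤ ‖domApply K q‖ * |s - t| := by
    intro q s t
    refine le_of_tendsto ((hS s _).sub (hS t _)).norm (Eventually.of_forall fun n => ?_)
    have := (convex_Ici (0 : ℝ)).norm_image_sub_le_of_norm_hasDerivWithin_le
      (f := fun r => yosidaFlow hK n r (domIncl K q)) (C := ‖domApply K q‖)
      (fun r _ => (yosidaFlow_hasDerivAt hK n (domIncl K q) r).hasDerivWithinAt)
      (fun r hr => (norm_yosidaFlow_le hK n hr _).trans (norm_yosida_domIncl_le hK _ q))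
      (le_max_right t 0) (le_max_right s 0)
    refine this.trans ?_
    gcongr
    exact abs_max_sub_max_le_abs _ _ _
  have hcont : ∀ x, Continuous fun t => S t x := by
    intro x
    rw [Metric.continuous_iff]
    intro t ε hε
    obtain ⟨_, hq, q, rfl⟩ := Metric.dense_iff.1 hK.denseRange x (ε / 3) (by positivity)
    have hq' : ‖x - domIncl K q‖ < ε / 3 := by
      rw [← dist_eq_norm, dist_comm]; exact hq
    refine ⟨ε / 3 / (‖domApply K q‖ + 1), by positivity, fun s hs => ?_⟩
    rw [Real.dist_eq, lt_div_iff₀ (by positivity)] at hs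
    have h1 := hsub s x (domIncl K q)
    have h2 := hsub t x (domIncl K q)
    have h3 := hlip q s t
    rw [dist_eq_norm]
    have e : S s x - S t x = (S s x - S s (domIncl K q)) + (S s (domIncl K q) - S t (domIncl K q))
      - (S t x - S t (domIncl K q)) := by abel
    rw [e]
    refine (norm_sub_le _ _).trans_lt ?_
    have := norm_add_le (S s x - S s (domIncl K q)) (S s (domIncl K q) - S t (domIncl K q))
    nlinarith [abs_nonneg (s - t)]
  set x := domIncl K p with hx
  set y := domApply K p with hy
  have hY : ∀ t, Tendsto (fun n : ℕ => yosidaFlow hK n (max t 0)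
      (yosida hK (Nat.cast_add_one_pos n : (0 : ℝ) < (n : ℝ) + 1) x)) atTop (𝓝 (S t y)) := by
    intro t
    have h1 : Tendsto (fun n : ℕ => yosidaFlow hK n (max t 0)
      (yosida hK (Nat.cast_add_one_pos n : (0 : ℝ) < (n : ℝ) + 1) x - y)) atTop (𝓝 0) := by
      refine squeeze_zero_norm (fun n => norm_yosidaFlow_le hK n (le_max_right _ _) _) ?_
      have := (tendsto_yosidaPt hK y).sub_const y
      simp only [sub_self] at this
      simpa [hx, hy, yosida_domIncl] using this.norm
    have := h1.add (hS t y)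
    simpa [map_sub] using this
  -- Limit of the integrated approximate equations; the dominating constant is `‖K p‖`.
  have hint : ∀ t, 0 ≤ t → S t x = x + ∫ s in (0 : ℝ)..t, S s y := by
    intro t ht
    have h1 : Tendsto (fun n : ℕ => ∫ s in (0 : ℝ)..t, yosidaFlow hK n (max s 0)
        (yosida hK (Nat.cast_add_one_pos n : (0 : ℝ) < (n : ℝ) + 1) x)) atTop
        (𝓝 (∫ s in (0 : ℝ)..t, S s y)) := by
      refine intervalIntegral.tendsto_integral_filter_of_dominated_convergence (fun _ => ‖y‖)
        (Eventually.of_forall fun n => ?_) (Eventually.of_forall fun n => ?_)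
        intervalIntegrable_const (Eventually.of_forall fun s _ => hY s)
      · have : Continuous fun s : ℝ => yosidaFlow hK n (max s 0)
            (yosida hK (Nat.cast_add_one_pos n : (0 : ℝ) < (n : ℝ) + 1) x) :=
          (continuous_iff_continuousAt.2 fun r =>
            (yosidaFlow_hasDerivAt hK n _ r).continuousAt).comp (by fun_prop)
        exact this.aestronglyMeasurable
      · exact Eventually.of_forall fun s _ => (norm_yosidaFlow_le hK n (le_max_right _ _) _).trans
          (norm_yosida_domIncl_le hK _ p)
    have h2 : ∀ n : ℕ, ∫ s in (0 : ℝ)..t, yosidaFlow hK n (max s 0)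
        (yosida hK (Nat.cast_add_one_pos n : (0 : ℝ) < (n : ℝ) + 1) x)
        = yosidaFlow hK n (max t 0) x - x := by
      intro n
      have hc : Continuous fun s : ℝ => yosidaFlow hK n s
            (yosida hK (Nat.cast_add_one_pos n : (0 : ℝ) < (n : ℝ) + 1) x) :=
        continuous_iff_continuousAt.2 fun r => (yosidaFlow_hasDerivAt hK n _ r).continuousAt
      have := intervalIntegral.integral_eq_sub_of_hasDerivAt
        (fun s _ => yosidaFlow_hasDerivAt hK n x s) (hc.intervalIntegrable 0 t)
      rw [yosidaFlow_zero] at this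
      rw [max_eq_left ht, ← this]
      refine intervalIntegral.integral_congr fun s hs => ?_
      rw [uIcc_of_le ht] at hs
      simp only [max_eq_left hs.1]
    simp only [h2] at h1
    have := tendsto_nhds_unique h1 ((hS t x).sub_const x)
    rw [this]; abel
  have hdom : ∀ t, ∃ q : GraphDomain K, domIncl K q = S t x ∧ domApply K q = S t y := by
    intro t
    have hgn : ∀ n : ℕ, yosida hK (Nat.cast_add_one_pos n : (0 : ℝ) < (n : ℝ) + 1)
        (yosidaFlow hK n (max t 0) x) = yosidaFlow hK n (max t 0)
        (yosida hK (Nat.cast_add_one_pos n : (0 : ℝ) < (n : ℝ) + 1) x) :=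
      fun n => (exp_apply_comm _ _ _).symm
    have h1 : Tendsto (fun n : ℕ => domIncl K (yosidaPt hK
        (Nat.cast_add_one_pos n : (0 : ℝ) < (n : ℝ) + 1) (yosidaFlow hK n (max t 0) x)))
        atTop (𝓝 (S t x)) := by
      simp only [domIncl_yosidaPt, hgn]
      have h0 : Tendsto (fun n : ℕ => (((n : ℝ) + 1 : ℝ) : ℂ)⁻¹) atTop (𝓝 0) := by
        have := (Complex.continuous_ofReal.tendsto 0).comp tendsto_one_div_add_atTop_nhds_zero_nat
        simpa [Function.comp_def] using this
      simpa using (hS t x).add (h0.smul (hY t))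
    have h2 : Tendsto (fun n : ℕ => domApply K (yosidaPt hK
        (Nat.cast_add_one_pos n : (0 : ℝ) < (n : ℝ) + 1) (yosidaFlow hK n (max t 0) x)))
        atTop (𝓝 (S t y)) := by
      have := hY t
      simp only [← hgn] at this
      exact this
    -- Convergence of a point and of its image under `K` is convergence in the graph norm, since the
    -- point is the bounded operator `(1 - K)⁻¹` applied to the difference of the two.
    have h3 : Tendsto (fun n : ℕ => yosidaPt hK
        (Nat.cast_add_one_pos n : (0 : ℝ) < (n : ℝ) + 1) (yosidaFlow hK n (max t 0) x))
        atTop (𝓝 ((resolventEquiv hK one_pos).symm (S t x - S t y))) := by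
      have := ((resolventEquiv hK one_pos).symm.continuous.tendsto _).comp (h1.sub h2)
      refine this.congr fun n => ?_
      rw [Function.comp_apply, ContinuousLinearEquiv.symm_apply_eq, resolventEquiv_apply,
        Complex.ofReal_one, one_smul]
    exact ⟨_, tendsto_nhds_unique (((domIncl K).continuous.tendsto _).comp h3) h1,
      tendsto_nhds_unique (((domApply K).continuous.tendsto _).comp h3) h2⟩
  choose P hP1 hP2 using hdom
  refine ⟨P, ⟨continuous_graphDomain (by simpa only [hP1] using hcont x)
    (by simpa only [hP2] using hcont y), fun t ht => ?_⟩, ?_⟩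
  · simp only [hP1, hP2]
    have h1 : HasDerivAt (fun u => ∫ s in (0 : ℝ)..u, S s y) (S t y) t :=
      intervalIntegral.integral_hasDerivAt_right ((hcont y).intervalIntegrable _ _)
        ((hcont y).stronglyMeasurableAtFilter _ _) (hcont y).continuousAt
    exact (h1.const_add x).hasDerivWithinAt.congr (fun s hs => hint s hs) (hint t ht)
  · apply domIncl_injective K
    rw [hP1, hint 0 le_rfl, intervalIntegral.integral_same, add_zero]

end Generation

/-! ### A Plancherel estimate for Laplace transforms -/

section Plancherel

open MeasureTheory FourierTransform
open scoped ContDiff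

variable {W : Type*} [NormedAddCommGroup W] [InnerProductSpace ℂ W]

theorem continuous_fourier_of_integrable {f : ℝ → W} (hf : Integrable f) : Continuous (𝓕 f) :=
  VectorFourier.fourierIntegral_continuous Real.continuous_fourierChar
    (by exact continuous_inner) hf

variable [CompleteSpace W]

/-- The `L²` transform is defined through tempered distributions and the integral transform
satisfies the Fubini exchange formula, so both have the same integral against each smooth compactly
supported test function. -/
theorem fourier_toLp_ae_eq {f : ℝ → W} (hf : Integrable f) (hf2 : MemLp f 2) :
    (𝓕 (hf2.toLp f) : Lp W 2 (volume : Measure ℝ)) =ᵐ[volume] 𝓕 f := by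
  refine ae_eq_of_integral_contDiff_smul_eq
    ((Lp.memLp (𝓕 (hf2.toLp f))).locallyIntegrable (by norm_num))
    (continuous_fourier_of_integrable hf).locallyIntegrable fun φ hφ hφ2 => ?_
  have hφ1 : ContDiff ℝ ∞ (fun x => (φ x : ℂ)) := Complex.ofRealCLM.contDiff.comp hφ
  have hφ3 : HasCompactSupport (fun x => (φ x : ℂ)) := hφ2.comp_left (g := Complex.ofReal) rfl
  set ψ := hφ3.toSchwartzMap hφ1 with hψ
  have hψa : ∀ x, ψ x = (φ x : ℂ) := fun x => rfl
  have h1 := congrArg (fun T => T ψ) (Lp.fourier_toTemperedDistribution_eq (hf2.toLp f))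
  simp only [TemperedDistribution.fourier_apply, Lp.toTemperedDistribution_apply] at h1
  have h2 := VectorFourier.integral_fourierIntegral_smul_eq_flip (L := innerₗ ℝ)
    (μ := volume) (ν := volume) Real.continuous_fourierChar continuous_inner
    (ψ.integrable (μ := volume)) hf
  have h3 : ∫ x, (𝓕 ψ) x • (hf2.toLp f) x = ∫ x, (𝓕 ψ) x • f x := by
    refine integral_congr_ae ?_
    filter_upwards [hf2.coeFn_toLp] with x hx
    rw [hx]
  rw [h3] at h1
  have h4 : ∫ x, (𝓕 ψ) x • f x = ∫ x, ψ x • 𝓕 f x := by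
    rw [flip_innerₗ] at h2
    exact h2
  rw [h4] at h1
  have e : ∀ (x : ℝ) (w : W), φ x • w = ψ x • w := by
    intro x w
    rw [hψa]
    exact (Complex.coe_smul _ _).symm
  simp only [e]
  exact h1.symm

/-- Plancherel for integrable square-integrable functions. -/
theorem eLpNorm_fourier_eq {f : ℝ → W} (hf : Integrable f) (hf2 : MemLp f 2) :
    eLpNorm (𝓕 f) 2 volume = eLpNorm f 2 volume := by
  have h := Lp.norm_fourier_eq (hf2.toLp f)
  rw [Lp.norm_def, Lp.norm_def, ENNReal.toReal_eq_toReal_iff' (Lp.eLpNorm_ne_top _)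
    (Lp.eLpNorm_ne_top _), eLpNorm_congr_ae (fourier_toLp_ae_eq hf hf2),
    eLpNorm_congr_ae hf2.coeFn_toLp] at h
  exact h

theorem integral_norm_sq_le_of_fourier_le {g k : ℝ → W} (hg : Integrable g) (hg2 : MemLp g 2)
    (hk : Integrable k) (hk2 : MemLp k 2) {M : ℝ} (hM : 0 ≤ M)
    (h : ∀ x, ‖𝓕 g x‖ ≤ M * ‖𝓕 k x‖) :
    ∫ x, ‖g x‖ ^ 2 ≤ M ^ 2 * ∫ x, ‖k x‖ ^ 2 := by
  have h1 := eLpNorm_le_mul_eLpNorm_of_ae_le_mul (Eventually.of_forall h) (μ := volume) 2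
  rw [eLpNorm_fourier_eq hg hg2, eLpNorm_fourier_eq hk hk2] at h1
  have e : ∀ {f : ℝ → W}, MemLp f 2 → (eLpNorm f 2 volume).toReal ^ 2 = ∫ x, ‖f x‖ ^ 2 := by
    intro f hf
    rw [hf.eLpNorm_eq_integral_rpow_norm (by norm_num) (by norm_num),
      ENNReal.toReal_ofReal (by positivity)]
    simp only [ENNReal.toReal_ofNat, Real.rpow_ofNat]
    rw [← Real.rpow_natCast, ← Real.rpow_mul (by positivity)]
    norm_num
  rw [← e hg2, ← e hk2, ← mul_pow]
  have h2 := ENNReal.toReal_mono (ENNReal.mul_ne_top ENNReal.ofReal_ne_top hk2.eLpNorm_ne_top) h1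
  rw [ENNReal.toReal_mul, ENNReal.toReal_ofReal hM] at h2
  gcongr

theorem integrableOn_exp_smul {F : Type*} [NormedAddCommGroup F] [NormedSpace ℂ F]
    {f : ℝ → F} (hf : Continuous f) {C : ℝ} (hC : ∀ t, 0 ≤ t → ‖f t‖ ≤ C) {l : ℂ}
    (hl : 0 < l.re) : IntegrableOn (fun t : ℝ => Complex.exp (-l * t) • f t) (Ioi 0) := by
  refine Integrable.mono' (g := fun t => Real.exp (-l.re * t) * C)
    ((exp_neg_integrableOn_Ioi 0 hl).mul_const C) ?_ ?_
  · exact Continuous.aestronglyMeasurable (by fun_prop)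
  · filter_upwards [ae_restrict_mem measurableSet_Ioi] with t ht
    rw [norm_smul, Complex.norm_exp]
    have : (-l * t).re = -l.re * t := by simp
    rw [this]
    gcongr
    exact hC t (le_of_lt ht)

theorem integrableOn_exp_norm_sq {F : Type*} [NormedAddCommGroup F]
    {f : ℝ → F} (hf : Continuous f) {C : ℝ} (hC : ∀ t, 0 ≤ t → ‖f t‖ ≤ C) {β : ℝ}
    (hβ : 0 < β) : IntegrableOn (fun t : ℝ => Real.exp (-(2 * β) * t) * ‖f t‖ ^ 2) (Ioi 0) := by
  refine Integrable.mono' (g := fun t => Real.exp (-(2 * β) * t) * C ^ 2)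
    ((exp_neg_integrableOn_Ioi 0 (by positivity)).mul_const _) ?_ ?_
  · exact Continuous.aestronglyMeasurable (by fun_prop)
  · filter_upwards [ae_restrict_mem measurableSet_Ioi] with t ht
    rw [Real.norm_of_nonneg (by positivity)]
    have := hC t (le_of_lt ht)
    gcongr

/-- Plancherel for Laplace transforms on a vertical line: a bound of the transforms on the line
`Re l = β` is a bound of the functions in the weighted space `L²(0, ∞; e^{-2βt} dt)`. -/
theorem integral_exp_norm_sq_le_of_laplace_le {g k : ℝ → W} (hg : Continuous g)
    (hk : Continuous k) {C : ℝ} (hgC : ∀ t, 0 ≤ t → ‖g t‖ ≤ C) (hkC : ∀ t, 0 ≤ t → ‖k t‖ ≤ C)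
    {β M : ℝ} (hβ : 0 < β) (hM : 0 ≤ M)
    (h : ∀ l : ℂ, l.re = β → ‖∫ t in Ioi (0 : ℝ), Complex.exp (-l * t) • g t‖ ≤
      M * ‖∫ t in Ioi (0 : ℝ), Complex.exp (-l * t) • k t‖) :
    ∫ t in Ioi (0 : ℝ), Real.exp (-(2 * β) * t) * ‖g t‖ ^ 2 ≤
      M ^ 2 * ∫ t in Ioi (0 : ℝ), Real.exp (-(2 * β) * t) * ‖k t‖ ^ 2 := by
  -- Extended by zero to negative times and weighted by `e^{-βt}`, a function has as Fourier
  -- transform at `x` its Laplace transform at `β + 2πix`.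
  let Φ : (ℝ → W) → ℝ → W := fun f =>
    (Ioi (0 : ℝ)).indicator fun t : ℝ => Complex.exp (-(β : ℂ) * t) • f t
  have hint : ∀ {f : ℝ → W}, Continuous f → (∀ t, 0 ≤ t → ‖f t‖ ≤ C) → Integrable (Φ f) := by
    intro f hf hfC
    rw [integrable_indicator_iff measurableSet_Ioi]
    exact integrableOn_exp_smul hf hfC (by simpa using hβ)
  have hsq : ∀ (f : ℝ → W) (t : ℝ), ‖Φ f t‖ ^ 2 =
      (Ioi (0 : ℝ)).indicator (fun t => Real.exp (-(2 * β) * t) * ‖f t‖ ^ 2) t := by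
    intro f t
    by_cases ht : t ∈ Ioi (0 : ℝ)
    · simp only [Φ, indicator_of_mem ht]
      rw [norm_smul, Complex.norm_exp, mul_pow, ← Real.exp_nat_mul]
      congr 2
      simp; ring
    · simp only [Φ, indicator_of_notMem ht]
      simp
  have hmem : ∀ {f : ℝ → W}, Continuous f → (∀ t, 0 ≤ t → ‖f t‖ ≤ C) → MemLp (Φ f) 2 := by
    intro f hf hfC
    rw [memLp_two_iff_integrable_sq_norm (hint hf hfC).aestronglyMeasurable]
    simp only [hsq]
    rw [integrable_indicator_iff measurableSet_Ioi]
    exact integrableOn_exp_norm_sq hf hfC hβ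
  have hsqi : ∀ f : ℝ → W, ∫ t, ‖Φ f t‖ ^ 2 =
      ∫ t in Ioi (0 : ℝ), Real.exp (-(2 * β) * t) * ‖f t‖ ^ 2 := by
    intro f
    simp only [hsq]
    rw [integral_indicator measurableSet_Ioi]
  have hF : ∀ (f : ℝ → W) (x : ℝ), 𝓕 (Φ f) x = ∫ t in Ioi (0 : ℝ),
      Complex.exp (-((β : ℂ) + (2 * Real.pi * x : ℝ) * Complex.I) * t) • f t := by
    intro f x
    rw [Real.fourier_eq, ← integral_indicator measurableSet_Ioi]
    congr 1
    ext t
    by_cases ht : t ∈ Ioi (0 : ℝ)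
    · simp only [Φ, indicator_of_mem ht]
      rw [Circle.smul_def, smul_smul, Real.fourierChar_apply, ← Complex.exp_add]
      congr 2
      simp
      ring
    · simp only [Φ, indicator_of_notMem ht, smul_zero]
  rw [← hsqi, ← hsqi]
  refine integral_norm_sq_le_of_fourier_le (hint hg hgC) (hmem hg hgC) (hint hk hkC)
    (hmem hk hkC) hM fun x => ?_
  rw [hF, hF]
  exact h _ (by simp)

end Plancherel

/-! ### Trajectories -/

section Trajectories

theorem hasDerivWithinAt_clm {F G : Type*} [NormedAddCommGroup F] [NormedSpace ℂ F]
    [NormedAddCommGroup G] [NormedSpace ℂ G] (T : F →L[ℂ] G) {z : ℝ → F} {z' : F} {s : Set ℝ}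
    {t : ℝ} (h : HasDerivWithinAt z z' s t) :
    HasDerivWithinAt (fun r => T (z r)) (T z') s t :=
  (T.restrictScalars ℝ).hasFDerivAt.comp_hasDerivWithinAt t h

variable {E : Type*} [NormedAddCommGroup E] [InnerProductSpace ℂ E] {K : E →ₗ.[ℂ] E}

theorem IsTrajectory.isSolution {P : ℝ → GraphDomain K} (hP : IsTrajectory K P) :
    IsSolution K (domIncl K (P 0)) (fun t => domIncl K (P t)) := by
  refine ⟨rfl, ?_, fun t ht => ⟨(show K.domain from P t).2, hP.2 t ht⟩⟩
  rw [contDiffOn_one_iff_derivWithin (uniqueDiffOn_Ici 0)]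
  refine ⟨fun t ht => (hP.2 t ht).differentiableWithinAt, ?_⟩
  refine (((domApply K).continuous.comp hP.1).continuousOn).congr fun t ht => ?_
  exact (hP.2 t ht).derivWithin (uniqueDiffOn_Ici 0 t ht)

/-- The value and its derivative are both continuous on `[0, ∞)`, which is continuity for the graph
norm; freezing the solution at negative times makes it global. -/
theorem IsSolution.exists_trajectory {z₀ : E} {z : ℝ → E} (h : IsSolution K z₀ z) :
    ∃ P, IsTrajectory K P ∧ ∀ t, 0 ≤ t → domIncl K (P t) = z t := by
  obtain ⟨-, hd, hs⟩ := h
  rw [contDiffOn_one_iff_derivWithin (uniqueDiffOn_Ici 0)] at hd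
  have hmax : Continuous fun t : ℝ => max t 0 := by fun_prop
  choose hm hz using fun t : ℝ => hs (max t 0) (le_max_right _ _)
  let P : ℝ → GraphDomain K := fun t => (⟨z (max t 0), hm t⟩ : K.domain)
  have hP1 : ∀ t, domIncl K (P t) = z (max t 0) := fun t => rfl
  have hP2 : ∀ t, domApply K (P t) = derivWithin z (Ici 0) (max t 0) := fun t =>
    ((hz t).derivWithin (uniqueDiffOn_Ici 0 _ (mem_Ici.2 (le_max_right _ _)))).symm
  have hP3 : ∀ t, 0 ≤ t → domIncl K (P t) = z t := fun t ht => by rw [hP1, max_eq_left ht]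
  refine ⟨P, ⟨continuous_graphDomain ?_ ?_, fun t ht => ?_⟩, hP3⟩
  · simp only [hP1]
    exact hd.1.continuousOn.comp_continuous hmax fun t => mem_Ici.2 (le_max_right _ _)
  · simp only [hP2]
    exact hd.2.comp_continuous hmax fun t => mem_Ici.2 (le_max_right _ _)
  · refine HasDerivWithinAt.congr (f := z) ?_ (fun s hs => hP3 s hs) (hP3 t ht)
    have := hz t
    change HasDerivWithinAt z (domApply K (P t)) (Ici 0) (max t 0) at this
    rwa [max_eq_left ht] at this

theorem IsTrajectory.shift {P : ℝ → GraphDomain K} (hP : IsTrajectory K P) {a : ℝ} (ha : 0 ≤ a) :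
    IsTrajectory K (fun t => P (t + a)) := by
  refine ⟨hP.1.comp (by fun_prop), fun t ht => ?_⟩
  have h1 : HasDerivWithinAt (fun s : ℝ => s + a) 1 (Ici 0) t :=
    ((hasDerivAt_id t).add_const a).hasDerivWithinAt
  have h2 := (hP.2 (t + a) (by positivity)).scomp t h1
    (fun s (hs : 0 ≤ s) => (by positivity : 0 ≤ s + a))
  rw [one_smul] at h2
  exact h2

theorem IsTrajectory.sub {P Q : ℝ → GraphDomain K} (hP : IsTrajectory K P)
    (hQ : IsTrajectory K Q) : IsTrajectory K (fun t => P t - Q t) := by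
  refine ⟨hP.1.sub hQ.1, fun t ht => ?_⟩
  simp only [map_sub]
  exact (hP.2 t ht).sub (hQ.2 t ht)

theorem IsTrajectory.norm_domIncl_le (hK : ∀ p, (inner ℂ (domIncl K p) (domApply K p)).re ≤ 0)
    {P : ℝ → GraphDomain K} (hP : IsTrajectory K P) {t : ℝ} (ht : 0 ≤ t) :
    ‖domIncl K (P t)‖ ≤ ‖domIncl K (P 0)‖ := by
  have h := le_add_mul_of_hasDerivWithinAt (c := 0)
    (fun s hs => hasDerivWithinAt_norm_sq (hP.2 s hs))
    (fun s _ => by linarith [hK (P s)]) ht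
  rw [zero_mul, add_zero] at h
  exact (sq_le_sq₀ (norm_nonneg _) (norm_nonneg _)).1 h

/-- The difference quotient of a trajectory with its own time shift is again a trajectory, hence
nonincreasing in norm; the step size then tends to zero. -/
theorem IsTrajectory.norm_domApply_le (hK : ∀ p, (inner ℂ (domIncl K p) (domApply K p)).re ≤ 0)
    {P : ℝ → GraphDomain K} (hP : IsTrajectory K P) {t : ℝ} (ht : 0 ≤ t) :
    ‖domApply K (P t)‖ ≤ ‖domApply K (P 0)‖ := by
  have key : ∀ t, 0 ≤ t → Tendsto (fun h => ‖h⁻¹ • (domIncl K (P (h + t)) - domIncl K (P t))‖)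
      (𝓝[>] 0) (𝓝 ‖domApply K (P t)‖) := by
    intro t ht
    have h1 := ((hP.shift ht).2 0 le_rfl).mono Ioi_subset_Ici_self
    rw [hasDerivWithinAt_iff_tendsto_slope' (by simp)] at h1
    simpa [slope_fun_def] using h1.norm
  refine le_of_tendsto_of_tendsto (key t ht) (key 0 le_rfl) ?_
  filter_upwards [self_mem_nhdsWithin] with h hh
  rw [norm_smul, norm_smul]
  have := IsTrajectory.norm_domIncl_le hK ((hP.shift (le_of_lt hh)).sub hP) ht
  simp only [map_sub] at this
  rw [add_comm t h, zero_add] at this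
  rw [add_zero]
  gcongr

theorem IsTrajectory.exists_bound (hK : ∀ p, (inner ℂ (domIncl K p) (domApply K p)).re ≤ 0)
    {P : ℝ → GraphDomain K} (hP : IsTrajectory K P) : ∃ C, ∀ t, 0 ≤ t → ‖P t‖ ≤ C :=
  ⟨_, fun t ht => (norm_graphDomain_le K (P t)).trans
    (add_le_add (hP.norm_domIncl_le hK ht) (hP.norm_domApply_le hK ht))⟩

/-- Right derivatives suffice here, which allows trajectories glued at an intermediate time. -/
theorem norm_sq_sub_eq_integral [CompleteSpace E] {z z' : ℝ → E} (hz : Continuous z)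
    (hz' : Continuous z') (h : ∀ t, 0 ≤ t → HasDerivWithinAt z (z' t) (Ici t) t) {a b : ℝ}
    (ha : 0 ≤ a) (hab : a ≤ b) :
    ‖z b‖ ^ 2 - ‖z a‖ ^ 2 = ∫ t in a..b, 2 * (inner ℂ (z t) (z' t)).re := by
  refine (intervalIntegral.integral_eq_sub_of_hasDeriv_right_of_le hab
    (f := fun t => ‖z t‖ ^ 2) (by fun_prop) (fun t ht => ?_) ?_).symm
  · exact hasDerivWithinAt_norm_sq ((h t (ha.trans ht.1.le)).mono Ioi_subset_Ici_self)
  · exact Continuous.intervalIntegrable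
      (continuous_const.mul (Complex.continuous_re.comp (hz.inner hz'))) _ _

/-- The function `e^{-lt} (z' - l z)` is the derivative of `e^{-lt} z`, which vanishes at `0` by
hypothesis and at infinity by boundedness. -/
theorem laplace_deriv [CompleteSpace E] {z z' : ℝ → E} (hz : Continuous z)
    (hz' : Continuous z') (h : ∀ t, 0 ≤ t → HasDerivWithinAt z (z' t) (Ici t) t) (h0 : z 0 = 0)
    {C : ℝ} (hC : ∀ t, 0 ≤ t → ‖z t‖ ≤ C) (hC' : ∀ t, 0 ≤ t → ‖z' t‖ ≤ C) {l : ℂ}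
    (hl : 0 < l.re) :
    ∫ t in Ioi (0 : ℝ), Complex.exp (-l * t) • z' t =
      l • ∫ t in Ioi (0 : ℝ), Complex.exp (-l * t) • z t := by
  have hi := integrableOn_exp_smul hz hC hl
  have hi' := integrableOn_exp_smul hz' hC' hl
  have hd : ∀ t : ℝ, HasDerivAt (fun t : ℝ => Complex.exp (-l * t))
      (Complex.exp (-l * t) * (-l)) t := by
    intro t
    have := ((hasDerivAt_id (t : ℂ)).const_mul (-l)).cexp.comp_ofReal
    simpa using this
  have hF : ∀ R : ℝ, 0 ≤ R → ∫ t in (0 : ℝ)..R, (Complex.exp (-l * t) • z' t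
      - l • Complex.exp (-l * t) • z t) = Complex.exp (-l * R) • z R := by
    intro R hR
    have := intervalIntegral.integral_eq_sub_of_hasDeriv_right_of_le hR
      (f := fun t : ℝ => Complex.exp (-l * t) • z t)
      (f' := fun t : ℝ => Complex.exp (-l * t) • z' t - l • Complex.exp (-l * t) • z t)
      (by fun_prop) (fun t ht => ?_) (Continuous.intervalIntegrable (by fun_prop) _ _)
    · rw [this, h0, smul_zero, sub_zero]
    · have := (hd t).hasDerivWithinAt.smul ((h t ht.1.le).mono Ioi_subset_Ici_self)
      exact this.congr_deriv (by module)
  have ht1 : Tendsto (fun R : ℝ => ∫ t in (0 : ℝ)..R, (Complex.exp (-l * t) • z' t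
      - l • Complex.exp (-l * t) • z t)) atTop (𝓝 (∫ t in Ioi (0 : ℝ),
        (Complex.exp (-l * t) • z' t - l • Complex.exp (-l * t) • z t))) :=
    MeasureTheory.intervalIntegral_tendsto_integral_Ioi 0 (hi'.sub (hi.smul l)) tendsto_id
  have ht2 : Tendsto (fun R : ℝ => ∫ t in (0 : ℝ)..R, (Complex.exp (-l * t) • z' t
      - l • Complex.exp (-l * t) • z t)) atTop (𝓝 0) := by
    have h1 : Tendsto (fun R : ℝ => Complex.exp (-l * R) • z R) atTop (𝓝 0) := by
      have h2 : Tendsto (fun R : ℝ => Real.exp (-(l.re * R)) * C) atTop (𝓝 (0 * C)) :=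
        (Real.tendsto_exp_neg_atTop_nhds_zero.comp
          (tendsto_id.const_mul_atTop hl)).mul_const C
      rw [zero_mul] at h2
      refine squeeze_zero_norm' ?_ h2
      filter_upwards [eventually_ge_atTop 0] with R hR
      rw [norm_smul, Complex.norm_exp]
      have : (-l * R).re = -(l.re * R) := by simp
      rw [this]
      gcongr
      exact hC R hR
    refine h1.congr' ?_
    filter_upwards [eventually_ge_atTop 0] with R hR
    exact (hF R hR).symm
  have := tendsto_nhds_unique ht1 ht2
  rw [← MeasureTheory.integral_smul, ← sub_eq_zero, ← MeasureTheory.integral_sub hi'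
    (g := fun t : ℝ => l • Complex.exp (-l * t) • z t) (hi.smul l)]
  exact this

end Trajectories

/-! ### Trajectories driven by another trajectory -/

section Forced

variable {E : Type*} [NormedAddCommGroup E] [InnerProductSpace ℂ E]

/-- The operator `(p, q) ↦ (K p + q - p, L q - q)` on `E × E`. -/
def pairOp (K L : E →ₗ.[ℂ] E) : WithLp 2 (E × E) →ₗ.[ℂ] WithLp 2 (E × E) where
  domain := K.domain.comap (WithLp.fstL 2 ℂ E E).toLinearMap ⊓
    L.domain.comap (WithLp.sndL 2 ℂ E E).toLinearMap
  toFun :=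
    { toFun := fun z => WithLp.toLp 2
        (K ⟨z.1.fst, z.2.1⟩ + z.1.snd - z.1.fst, L ⟨z.1.snd, z.2.2⟩ - z.1.snd)
      map_add' := by
        intro a b
        have h1 : K ⟨(a + b).1.fst, (a + b).2.1⟩ = K ⟨a.1.fst, a.2.1⟩ + K ⟨b.1.fst, b.2.1⟩ :=
          K.map_add ⟨_, a.2.1⟩ ⟨_, b.2.1⟩
        have h2 : L ⟨(a + b).1.snd, (a + b).2.2⟩ = L ⟨a.1.snd, a.2.2⟩ + L ⟨b.1.snd, b.2.2⟩ :=
          L.map_add ⟨_, a.2.2⟩ ⟨_, b.2.2⟩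
        rw [h1, h2, ← WithLp.toLp_add]
        congr 1
        ext
        · simp; abel
        · simp; abel
      map_smul' := by
        intro c a
        have h1 : K ⟨(c • a).1.fst, (c • a).2.1⟩ = c • K ⟨a.1.fst, a.2.1⟩ :=
          K.map_smul c ⟨_, a.2.1⟩
        have h2 : L ⟨(c • a).1.snd, (c • a).2.2⟩ = c • L ⟨a.1.snd, a.2.2⟩ :=
          L.map_smul c ⟨_, a.2.2⟩
        rw [h1, h2, RingHom.id_apply, ← WithLp.toLp_smul]
        congr 1
        ext
        · simp [smul_sub]
        · simp [smul_sub] }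

theorem pairOp_isMDissipative [CompleteSpace E] {K L : E →ₗ.[ℂ] E} (hK : IsMDissipative K)
    (hL : IsMDissipative L) : IsMDissipative (pairOp K L) := by
  refine ⟨fun z => ?_, 1, one_pos, fun f => ?_⟩
  · have h1 := hK.1 ⟨z.1.fst, z.2.1⟩
    have h2 := hL.1 ⟨z.1.snd, z.2.2⟩
    have e : (inner ℂ (z : WithLp 2 (E × E)) (pairOp K L z)) =
        inner ℂ z.1.fst (K ⟨z.1.fst, z.2.1⟩) + inner ℂ z.1.fst z.1.snd
          - inner ℂ z.1.fst z.1.fst + (inner ℂ z.1.snd (L ⟨z.1.snd, z.2.2⟩)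
          - inner ℂ z.1.snd z.1.snd) := by
      rw [← inner_add_right, ← inner_sub_right, ← inner_sub_right]
      rfl
    rw [e]
    have h3 : (inner ℂ z.1.fst z.1.snd).re ≤ ‖z.1.fst‖ * ‖z.1.snd‖ :=
      (Complex.re_le_norm _).trans (norm_inner_le_norm _ _)
    have h4 : ∀ x : E, (inner ℂ x x).re = ‖x‖ ^ 2 := fun x => by
      rw [inner_self_eq_norm_sq_to_K]
      rw [← Complex.ofReal_re (‖x‖ ^ 2), Complex.ofReal_pow]
      rfl
    simp only [Complex.add_re, Complex.sub_re, h4]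
    -- The shift by `-1` pays for the coupling: `ab - a² - b² ≤ 0`.
    nlinarith [sq_nonneg (‖z.1.fst‖ - ‖z.1.snd‖), sq_nonneg ‖z.1.fst‖, sq_nonneg ‖z.1.snd‖]
  -- The system is triangular and the shift turns `1` into `2`: solve for `q`, then for `p` with `q`
  -- in the right-hand side.
  · obtain ⟨q, hq⟩ := hL.surjective two_pos f.snd
    obtain ⟨p, hp⟩ := hK.surjective two_pos (f.fst + q)
    refine ⟨⟨WithLp.toLp 2 (p, q), p.2, q.2⟩, ?_⟩
    rw [Complex.ofReal_one, one_smul]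
    have e1 : (p : E) - (K p + q - p) = f.fst := by
      have : (p : E) - (K p + q - p) = ((2 : ℝ) : ℂ) • (p : E) - K p - q := by
        push_cast; module
      rw [this, hp]; abel
    have e2 : (q : E) - (L q - q) = f.snd := by
      rw [← hq]; push_cast; module
    exact congrArg (WithLp.toLp 2) (Prod.ext e1 e2)

/-- Duhamel's formula is avoided by treating forcing and response as one autonomous trajectory of
`pairOp K L`. Multiplication by `e^t` undoes the shift, and contractivity identifies the second
component with the given `Q`. -/
theorem exists_forced_trajectory [CompleteSpace E] {K L : E →ₗ.[ℂ] E} (hK : IsMDissipative K)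
    (hL : IsMDissipative L) {Q : ℝ → GraphDomain L} (hQ : IsTrajectory L Q) :
    ∃ P : ℝ → GraphDomain K, Continuous P ∧ P 0 = 0 ∧ ∀ t, 0 ≤ t →
      HasDerivWithinAt (fun s => domIncl K (P s)) (domApply K (P t) + domIncl L (Q t))
        (Ici 0) t := by
  obtain ⟨R, hR, hR0⟩ := exists_trajectory (pairOp_isMDissipative hK hL)
    (⟨WithLp.toLp 2 (0, domIncl L (Q 0)), K.domain.zero_mem, (show L.domain from Q 0).2⟩ :
      (pairOp K L).domain)
  let r : ℝ → (pairOp K L).domain := R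
  let p : ℝ → GraphDomain K := fun t => (⟨(r t).1.fst, (r t).2.1⟩ : K.domain)
  let q : ℝ → GraphDomain L := fun t => (⟨(r t).1.snd, (r t).2.2⟩ : L.domain)
  have hp1 : ∀ t, domIncl K (p t) = WithLp.fstL 2 ℂ E E (domIncl _ (R t)) := fun t => rfl
  have hq1 : ∀ t, domIncl L (q t) = WithLp.sndL 2 ℂ E E (domIncl _ (R t)) := fun t => rfl
  have hp2 : ∀ t, domApply K (p t) = WithLp.fstL 2 ℂ E E (domApply _ (R t))
      - domIncl L (q t) + domIncl K (p t) := by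
    intro t
    change domApply K (p t) = domApply K (p t) + domIncl L (q t) - domIncl K (p t)
      - domIncl L (q t) + domIncl K (p t)
    abel
  have hq2 : ∀ t, domApply L (q t) = WithLp.sndL 2 ℂ E E (domApply _ (R t))
      + domIncl L (q t) := by
    intro t
    change domApply L (q t) = domApply L (q t) - domIncl L (q t) + domIncl L (q t)
    abel
  have cR1 : Continuous fun t => domIncl _ (R t) := (domIncl _).continuous.comp hR.1
  have cR2 : Continuous fun t => domApply _ (R t) := (domApply _).continuous.comp hR.1
  have cp1 : Continuous fun t => domIncl K (p t) := by
    simp only [hp1]; exact (WithLp.fstL 2 ℂ E E).continuous.comp cR1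
  have cq1 : Continuous fun t => domIncl L (q t) := by
    simp only [hq1]; exact (WithLp.sndL 2 ℂ E E).continuous.comp cR1
  have cp : Continuous p := continuous_graphDomain cp1 (by
    simp only [hp2]
    exact (((WithLp.fstL 2 ℂ E E).continuous.comp cR2).sub cq1).add cp1)
  have cq : Continuous q := continuous_graphDomain cq1 (by
    simp only [hq2]
    exact ((WithLp.sndL 2 ℂ E E).continuous.comp cR2).add cq1)
  have dexp : ∀ t : ℝ, HasDerivAt (fun s : ℝ => (Real.exp s : ℂ)) (Real.exp t : ℂ) t :=
    fun t => (Real.hasDerivAt_exp t).ofReal_comp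
  have cexp : Continuous fun s : ℝ => (Real.exp s : ℂ) := by fun_prop
  have dp : ∀ t, 0 ≤ t → HasDerivWithinAt (fun s => domIncl K ((Real.exp s : ℂ) • p s))
      (domApply K ((Real.exp t : ℂ) • p t) + domIncl L ((Real.exp t : ℂ) • q t)) (Ici 0) t := by
    intro t ht
    have h1 : HasDerivWithinAt (fun s => WithLp.fstL 2 ℂ E E (domIncl _ (R s)))
        (WithLp.fstL 2 ℂ E E (domApply _ (R t))) (Ici 0) t :=
      hasDerivWithinAt_clm (WithLp.fstL 2 ℂ E E) (hR.2 t ht)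
    have h2 := (dexp t).hasDerivWithinAt.smul h1
    simp only [map_smul]
    exact h2.congr_deriv (by rw [hp2, hp1]; module)
  have dq : ∀ t, 0 ≤ t → HasDerivWithinAt (fun s => domIncl L ((Real.exp s : ℂ) • q s))
      (domApply L ((Real.exp t : ℂ) • q t)) (Ici 0) t := by
    intro t ht
    have h1 : HasDerivWithinAt (fun s => WithLp.sndL 2 ℂ E E (domIncl _ (R s)))
        (WithLp.sndL 2 ℂ E E (domApply _ (R t))) (Ici 0) t :=
      hasDerivWithinAt_clm (WithLp.sndL 2 ℂ E E) (hR.2 t ht)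
    have h2 := (dexp t).hasDerivWithinAt.smul h1
    simp only [map_smul]
    exact h2.congr_deriv (by rw [hq2, hq1]; module)
  have hq : IsTrajectory L (fun t => (Real.exp t : ℂ) • q t) := ⟨cexp.smul cq, dq⟩
  have hq0 : q 0 = Q 0 := by
    apply domIncl_injective L
    rw [hq1, hR0]
    rfl
  have huniq : ∀ t, 0 ≤ t → domIncl L ((Real.exp t : ℂ) • q t) = domIncl L (Q t) := by
    intro t ht
    have := (hq.sub hQ).norm_domIncl_le hL.re_inner_nonpos ht
    rw [Real.exp_zero, Complex.ofReal_one, one_smul, hq0, sub_self, map_zero, norm_zero,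
      norm_le_zero_iff, map_sub, sub_eq_zero] at this
    exact this
  refine ⟨fun t => (Real.exp t : ℂ) • p t, cexp.smul cp, ?_, fun t ht => ?_⟩
  · have : p 0 = 0 := by
      apply domIncl_injective K
      rw [hp1, hR0, map_zero]
      rfl
    simp only [this, smul_zero]
  · rw [← huniq t ht]
    exact dp t ht

end Forced

/-! ### Outputs and the energy identity -/

section Abstract

open MeasureTheory

theorem integrableOn_exp_smul_clm {F G : Type*} [NormedAddCommGroup F] [NormedSpace ℂ F]
    [NormedAddCommGroup G] [NormedSpace ℂ G] (L : F →L[ℂ] G) {f : ℝ → F} {l : ℂ} {s : Set ℝ}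
    (hf : IntegrableOn (fun t : ℝ => Complex.exp (-l * t) • f t) s) :
    IntegrableOn (fun t : ℝ => Complex.exp (-l * t) • L (f t)) s := by
  have := L.integrable_comp hf
  simp only [map_smul] at this
  exact this

theorem integral_exp_smul_clm {F G : Type*} [NormedAddCommGroup F] [NormedSpace ℂ F]
    [CompleteSpace F] [NormedAddCommGroup G] [NormedSpace ℂ G] [CompleteSpace G] (L : F →L[ℂ] G)
    {f : ℝ → F} {l : ℂ} {s : Set ℝ}
    (hf : IntegrableOn (fun t : ℝ => Complex.exp (-l * t) • f t) s) :
    ∫ t in s, Complex.exp (-l * t) • L (f t) = L (∫ t in s, Complex.exp (-l * t) • f t) := by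
  rw [← L.integral_comp_comm hf]
  simp only [map_smul]

variable {E W : Type*} [NormedAddCommGroup E] [InnerProductSpace ℂ E] [CompleteSpace E]
  [NormedAddCommGroup W] [InnerProductSpace ℂ W]
  {Kc Kd : E →ₗ.[ℂ] E} {Oc : GraphDomain Kc →L[ℂ] W} {Od : GraphDomain Kd →L[ℂ] W}

/-- The energy identity which relates a conservative generator `Kc` with observation `Oc` to the
generator `Kd` damped through its output `Od`. -/
def EnergyIdentity (Oc : GraphDomain Kc →L[ℂ] W) (Od : GraphDomain Kd →L[ℂ] W) : Prop :=
  ∀ (p : GraphDomain Kc) (q : GraphDomain Kd),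
    (inner ℂ (domIncl Kc p - domIncl Kd q) (domApply Kc p - domApply Kd q)).re =
      (inner ℂ (Od q) (Oc p)).re - ‖Od q‖ ^ 2

/-- The closed loop bound on the line `Re l = β`. -/
def FrequencyBound (Oc : GraphDomain Kc →L[ℂ] W) (Od : GraphDomain Kd →L[ℂ] W) (β M : ℝ) :
    Prop :=
  ∀ l : ℂ, l.re = β → ∀ (p : GraphDomain Kc) (q : GraphDomain Kd),
    l • (domIncl Kc p - domIncl Kd q) = domApply Kc p - domApply Kd q →
      ‖Oc p - Od q‖ ≤ M * ‖Od q‖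

theorem norm_sq_sub_eq_of_energyIdentity (hE : EnergyIdentity Oc Od) {P : ℝ → GraphDomain Kc}
    {Q : ℝ → GraphDomain Kd} (hP : Continuous P) (hQ : Continuous Q)
    (h : ∀ t, 0 ≤ t → HasDerivWithinAt (fun s => domIncl Kc (P s) - domIncl Kd (Q s))
      (domApply Kc (P t) - domApply Kd (Q t)) (Ici t) t) {a b : ℝ} (ha : 0 ≤ a) (hab : a ≤ b) :
    ‖domIncl Kc (P b) - domIncl Kd (Q b)‖ ^ 2 - ‖domIncl Kc (P a) - domIncl Kd (Q a)‖ ^ 2 =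
      ∫ t in a..b, 2 * ((inner ℂ (Od (Q t)) (Oc (P t))).re - ‖Od (Q t)‖ ^ 2) := by
  rw [norm_sq_sub_eq_integral (z := fun s => domIncl Kc (P s) - domIncl Kd (Q s))
    (by fun_prop) (by fun_prop) h ha hab]
  exact intervalIntegral.integral_congr fun t _ => congrArg (2 * ·) (hE _ _)

/-- The case of a zero conservative trajectory. -/
theorem IsTrajectory.norm_sq_sub_eq (hE : EnergyIdentity Oc Od) {Q : ℝ → GraphDomain Kd}
    (hQ : IsTrajectory Kd Q) {a b : ℝ} (ha : 0 ≤ a) (hab : a ≤ b) :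
    ‖domIncl Kd (Q a)‖ ^ 2 - ‖domIncl Kd (Q b)‖ ^ 2 = 2 * ∫ t in a..b, ‖Od (Q t)‖ ^ 2 := by
  have h := norm_sq_sub_eq_of_energyIdentity hE (P := fun _ => 0) continuous_const hQ.1
    (fun t ht => by
      simp only [map_zero, zero_sub]
      exact ((hQ.2 t ht).mono (Ici_subset_Ici.2 ht)).neg) ha hab
  simp only [map_zero, zero_sub, norm_neg, inner_zero_right, Complex.zero_re,
    intervalIntegral.integral_const_mul, intervalIntegral.integral_neg] at h
  linarith

/-- Decay of the damped system implies observability of the conservative one. -/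
theorem observable_of_decay (hd : IsMDissipative Kd) (hE : EnergyIdentity Oc Od) {T : ℝ}
    (hT : 0 ≤ T) (hs : ∀ Q, IsTrajectory Kd Q →
      ‖domIncl Kd (Q T)‖ ^ 2 ≤ 1 / 2 * ‖domIncl Kd (Q 0)‖ ^ 2) {P : ℝ → GraphDomain Kc}
    (hP : IsTrajectory Kc P) :
    1 / 4 * ‖domIncl Kc (P 0)‖ ^ 2 ≤ ∫ t in (0 : ℝ)..T, ‖Oc (P t)‖ ^ 2 := by
  have key : ∀ q : GraphDomain Kd, 1 / 4 * ‖domIncl Kd q‖ ^ 2 ≤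
      ‖domIncl Kc (P 0) - domIncl Kd q‖ ^ 2 + ∫ t in (0 : ℝ)..T, ‖Oc (P t)‖ ^ 2 := by
    intro q
    obtain ⟨Q, hQ, rfl⟩ := exists_trajectory hd q
    have hPc := hP.1
    have hQc := hQ.1
    have h1 := norm_sq_sub_eq_of_energyIdentity hE hP.1 hQ.1
      (fun t ht => ((hP.2 t ht).sub (hQ.2 t ht)).mono (Ici_subset_Ici.2 ht)) le_rfl hT
    have h2 := hQ.norm_sq_sub_eq hE le_rfl hT
    have h3 : ∫ t in (0 : ℝ)..T, 2 * ((inner ℂ (Od (Q t)) (Oc (P t))).re - ‖Od (Q t)‖ ^ 2) ≤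
        ∫ t in (0 : ℝ)..T, (‖Oc (P t)‖ ^ 2 - ‖Od (Q t)‖ ^ 2) := by
      refine intervalIntegral.integral_mono_on hT ?_ ?_ fun t _ => ?_
      · exact Continuous.intervalIntegrable (continuous_const.mul
          ((Complex.continuous_re.comp ((Od.continuous.comp hQc).inner
            (Oc.continuous.comp hPc))).sub (by fun_prop))) _ _
      · exact Continuous.intervalIntegrable (by fun_prop) _ _
      · have := (Complex.re_le_norm _).trans (norm_inner_le_norm (𝕜 := ℂ) (Od (Q t)) (Oc (P t)))
        nlinarith [sq_nonneg (‖Od (Q t)‖ - ‖Oc (P t)‖)]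
    rw [intervalIntegral.integral_sub (Continuous.intervalIntegrable (by fun_prop) _ _)
      (Continuous.intervalIntegrable (by fun_prop) _ _)] at h3
    have h4 := hs Q hQ
    have h5 := sq_nonneg ‖domIncl Kc (P T) - domIncl Kd (Q T)‖
    linarith
  -- `P 0` need not lie in the domain of `Kd`, so it is approximated by points of that domain; the
  -- discrepancy tends to zero.
  obtain ⟨x, hx, hx'⟩ := mem_closure_iff_seq_limit.1 (hd.denseRange (domIncl Kc (P 0)))
  have hl := (hx'.norm.pow 2).const_mul (1 / 4)
  have hr := (((hx'.const_sub (domIncl Kc (P 0))).norm).pow 2).add_const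
    (∫ t in (0 : ℝ)..T, ‖Oc (P t)‖ ^ 2)
  rw [sub_self, norm_zero, zero_pow two_ne_zero, zero_add] at hr
  refine le_of_tendsto_of_tendsto' hl hr fun n => ?_
  obtain ⟨q, hq⟩ := hx n
  rw [← hq]
  exact key q

/-- The conservative companion of a damped trajectory `Q`: it starts at `0`, is driven by `Q`
during one unit of time, and is free afterwards. -/
theorem exists_companion (hc : IsMDissipative Kc) (hd : IsMDissipative Kd)
    {Q : ℝ → GraphDomain Kd} (hQ : IsTrajectory Kd Q) :
    ∃ P : ℝ → GraphDomain Kc, Continuous P ∧ P 0 = 0 ∧ IsTrajectory Kc (fun t => P (t + 1)) ∧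
      ∀ t, 0 ≤ t → HasDerivWithinAt
        (fun s => domIncl Kc (P s) - domIncl Kd (((min s 1 : ℝ) : ℂ) • Q s))
        (domApply Kc (P t) - domApply Kd (((min t 1 : ℝ) : ℂ) • Q t)) (Ici t) t := by
  obtain ⟨Pa, ha, ha0, ha'⟩ := exists_forced_trajectory hc hd hQ
  obtain ⟨Pb, hb, hb0⟩ := exists_trajectory hc (Pa 1)
  let P : ℝ → GraphDomain Kc := fun t => if t ≤ 1 then Pa t else Pb (t - 1)
  have hP1 : ∀ t, t ≤ 1 → P t = Pa t := fun t ht => if_pos ht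
  have hP2 : ∀ t, 1 ≤ t → P t = Pb (t - 1) := by
    intro t ht
    rcases ht.eq_or_lt with rfl | ht
    · rw [hP1 1 le_rfl, sub_self, hb0]
    · exact if_neg (not_le.2 ht)
  refine ⟨P, ?_, ?_, ?_, fun t ht => ?_⟩
  · refine Continuous.if_le ha (hb.1.comp (by fun_prop)) continuous_id continuous_const ?_
    rintro t rfl
    simp [hb0]
  · rw [hP1 0 zero_le_one, ha0]
  · refine ⟨?_, fun t ht => ?_⟩
    · have : Continuous P := by
        refine Continuous.if_le ha (hb.1.comp (by fun_prop)) continuous_id continuous_const ?_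
        rintro t rfl
        simp [hb0]
      exact this.comp (by fun_prop)
    · have e : ∀ s, 0 ≤ s → P (s + 1) = Pb s := fun s hs => by
        rw [hP2 _ (by linarith), add_sub_cancel_right]
      simp only [e t ht]
      exact (hb.2 t ht).congr (fun s hs => by rw [e s hs]) (by rw [e t ht])
  · rcases lt_or_ge t 1 with h1 | h1
    · have e : ∀ s, s < 1 → domIncl Kc (P s) - domIncl Kd (((min s 1 : ℝ) : ℂ) • Q s) =
          domIncl Kc (Pa s) - (s : ℂ) • domIncl Kd (Q s) := fun s hs => by
        rw [hP1 s hs.le, min_eq_left hs.le, map_smul]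
      -- The product rule for `s Q(s)` yields the extra term `Q`, which cancels the forcing of `Pa`.
      have hd1 : HasDerivWithinAt (fun s : ℝ => (s : ℂ)) 1 (Ici 0) t :=
        (hasDerivAt_id t).ofReal_comp.hasDerivWithinAt
      have h2 := ((ha' t ht).sub (hd1.smul (hQ.2 t ht))).mono (Ici_subset_Ici.2 ht)
      have h3 := h2.congr_of_eventuallyEq (f₁ := fun s => domIncl Kc (P s) -
          domIncl Kd (((min s 1 : ℝ) : ℂ) • Q s))
        (Filter.mem_of_superset (mem_nhdsWithin_of_mem_nhds (Iio_mem_nhds h1))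
          fun s hs => e s hs) (e t h1)
      refine h3.congr_deriv ?_
      rw [hP1 t h1.le, min_eq_left h1.le, map_smul]
      module
    · have e : ∀ s, s ∈ Ici t → domIncl Kc (P s) - domIncl Kd (((min s 1 : ℝ) : ℂ) • Q s) =
          domIncl Kc (Pb (s - 1)) - domIncl Kd (Q s) := fun s hs => by
        rw [hP2 s (h1.trans hs), min_eq_right (h1.trans hs), Complex.ofReal_one, one_smul]
      have hsub : HasDerivWithinAt (fun s : ℝ => s - 1) 1 (Ici t) t :=
        ((hasDerivAt_id t).sub_const 1).hasDerivWithinAt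
      have h2 := (hb.2 (t - 1) (by linarith)).scomp t hsub
        (fun s (hs : t ≤ s) => (by linarith : 0 ≤ s - 1))
      rw [one_smul] at h2
      have h3 := (h2.sub ((hQ.2 t ht).mono (Ici_subset_Ici.2 ht))).congr (f₁ := fun s =>
        domIncl Kc (P s) - domIncl Kd (((min s 1 : ℝ) : ℂ) • Q s)) e (e t (mem_Ici.2 le_rfl))
      refine h3.congr_deriv ?_
      rw [hP2 t h1, min_eq_right h1, Complex.ofReal_one, one_smul]

theorem exists_bound_of_shift {F : Type*} [SeminormedAddCommGroup F] {P : ℝ → F}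
    (hP : Continuous P) {C : ℝ} (hC : ∀ t, 0 ≤ t → ‖P (t + 1)‖ ≤ C) :
    ∃ C, ∀ t, 0 ≤ t → ‖P t‖ ≤ C := by
  obtain ⟨C', hC'⟩ := isCompact_Icc.exists_bound_of_continuousOn (s := Icc (0 : ℝ) 1)
    hP.continuousOn
  refine ⟨max C C', fun t ht => ?_⟩
  rcases le_total t 1 with h | h
  · exact (hC' t ⟨ht, h⟩).trans (le_max_right _ _)
  · have := hC (t - 1) (by linarith)
    rw [sub_add_cancel] at this
    exact this.trans (le_max_left _ _)

/-- The closed loop bound in the time domain. -/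
theorem integral_output_le [CompleteSpace W] (hc : IsMDissipative Kc) (hd : IsMDissipative Kd)
    {β M : ℝ} (hβ : 0 < β) (hM : 0 ≤ M) (hF : FrequencyBound Oc Od β M)
    {P : ℝ → GraphDomain Kc} {Q : ℝ → GraphDomain Kd} (hP : Continuous P) (hQ : Continuous Q)
    (h : ∀ t, 0 ≤ t → HasDerivWithinAt (fun s => domIncl Kc (P s) - domIncl Kd (Q s))
      (domApply Kc (P t) - domApply Kd (Q t)) (Ici t) t)
    (h0 : domIncl Kc (P 0) - domIncl Kd (Q 0) = 0) {C : ℝ} (hPC : ∀ t, 0 ≤ t → ‖P t‖ ≤ C)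
    (hQC : ∀ t, 0 ≤ t → ‖Q t‖ ≤ C) :
    ∫ t in Ioi (0 : ℝ), Real.exp (-(2 * β) * t) * ‖Oc (P t) - Od (Q t)‖ ^ 2 ≤
      M ^ 2 * ∫ t in Ioi (0 : ℝ), Real.exp (-(2 * β) * t) * ‖Od (Q t)‖ ^ 2 := by
  -- Complete graph domains let Bochner integrals taken in them commute with the outputs and the
  -- generators.
  have := hc.completeSpace
  have := hd.completeSpace
  have hC0 : 0 ≤ C := (norm_nonneg _).trans (hPC 0 le_rfl)
  have hO : ∀ t, 0 ≤ t → ‖Od (Q t)‖ ≤ ‖Od‖ * C := fun t ht =>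
    (Od.le_opNorm _).trans (by gcongr; exact hQC t ht)
  have hO' : ∀ t, 0 ≤ t → ‖Oc (P t)‖ ≤ ‖Oc‖ * C := fun t ht =>
    (Oc.le_opNorm _).trans (by gcongr; exact hPC t ht)
  refine integral_exp_norm_sq_le_of_laplace_le (C := ‖Oc‖ * C + ‖Od‖ * C) (by fun_prop)
    (by fun_prop) (fun t ht => (norm_sub_le _ _).trans (add_le_add (hO' t ht) (hO t ht)))
    (fun t ht => (hO t ht).trans (le_add_of_nonneg_left (by positivity))) hβ hM fun l hl => ?_
  have hl0 : 0 < l.re := hl ▸ hβ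
  have iP := integrableOn_exp_smul hP hPC hl0
  have iQ := integrableOn_exp_smul hQ hQC hl0
  have hlap := laplace_deriv (C := C + C) (by fun_prop) (by fun_prop) h h0
    (fun t ht => (norm_sub_le _ _).trans (add_le_add ((norm_domIncl_le _ _).trans (hPC t ht))
      ((norm_domIncl_le _ _).trans (hQC t ht))))
    (fun t ht => (norm_sub_le _ _).trans (add_le_add ((norm_domApply_le _ _).trans (hPC t ht))
      ((norm_domApply_le _ _).trans (hQC t ht)))) hl0
  simp only [smul_sub] at hlap ⊢
  rw [integral_sub (integrableOn_exp_smul_clm _ iP) (integrableOn_exp_smul_clm _ iQ),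
    integral_sub (integrableOn_exp_smul_clm _ iP) (integrableOn_exp_smul_clm _ iQ),
    integral_exp_smul_clm _ iP, integral_exp_smul_clm _ iP, integral_exp_smul_clm _ iQ,
    integral_exp_smul_clm _ iQ] at hlap
  rw [integral_sub (integrableOn_exp_smul_clm _ iP) (integrableOn_exp_smul_clm _ iQ),
    integral_exp_smul_clm _ iP, integral_exp_smul_clm _ iQ]
  -- The Laplace transforms of `P` and `Q`, taken in the graph norms, lie in the domains and satisfy
  -- the resolvent relation, so the frequency bound applies to them.
  exact hF l hl _ _ hlap.symm

end Abstract

/-! ### Exponential decay and observability -/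

section Decay

open MeasureTheory

theorem integral_norm_sq_le_exp_mul {W : Type*} [NormedAddCommGroup W] {f : ℝ → W}
    (hf : Continuous f) {C : ℝ} (hC : ∀ t, 0 ≤ t → ‖f t‖ ≤ C) {β : ℝ} (hβ : 0 < β) {a b : ℝ}
    (ha : 0 ≤ a) (hab : a ≤ b) :
    ∫ t in a..b, ‖f t‖ ^ 2 ≤
      Real.exp (2 * β * b) * ∫ t in Ioi (0 : ℝ), Real.exp (-(2 * β) * t) * ‖f t‖ ^ 2 := by
  have h1 : ∫ t in a..b, ‖f t‖ ^ 2 ≤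
      ∫ t in a..b, Real.exp (2 * β * b) * (Real.exp (-(2 * β) * t) * ‖f t‖ ^ 2) := by
    refine intervalIntegral.integral_mono_on hab (Continuous.intervalIntegrable (by fun_prop) _ _)
      (Continuous.intervalIntegrable (by fun_prop) _ _) fun t ht => ?_
    rw [← mul_assoc, ← Real.exp_add]
    refine le_mul_of_one_le_left (by positivity) (Real.one_le_exp ?_)
    nlinarith [ht.2]
  refine h1.trans ?_
  rw [intervalIntegral.integral_const_mul, intervalIntegral.integral_of_le hab]
  refine mul_le_mul_of_nonneg_left ?_ (Real.exp_pos _).le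
  refine setIntegral_mono_set (integrableOn_exp_norm_sq hf hC hβ)
    (Eventually.of_forall fun t => by positivity) ?_
  exact LE.le.eventuallyLE fun t ht => lt_of_le_of_lt ha ht.1

variable {E W : Type*} [NormedAddCommGroup E] [InnerProductSpace ℂ E] [CompleteSpace E]
  [NormedAddCommGroup W] [InnerProductSpace ℂ W]
  {Kc Kd : E →ₗ.[ℂ] E} {Oc : GraphDomain Kc →L[ℂ] W} {Od : GraphDomain Kd →L[ℂ] W}

/-- `Q 1` is reached through the companion `P`: observability on `[1, T + 1]` bounds `P 1`, the
energy identity on `[0, 1]` bounds `P 1 - Q 1`, and both bounds are in terms of the weighted output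
of `Q`. The energy balance of `Q` on `[0, 1]` leads back to `Q 0`. -/
theorem exists_norm_sq_le_of_observable [CompleteSpace W] (hc : IsMDissipative Kc)
    (hd : IsMDissipative Kd) (hE : EnergyIdentity Oc Od) {β M : ℝ} (hβ : 0 < β) (hM : 0 ≤ M)
    (hF : FrequencyBound Oc Od β M) {T c : ℝ} (hT : 0 < T) (hc0 : 0 < c)
    (hobs : ∀ P, IsTrajectory Kc P →
      c * ‖domIncl Kc (P 0)‖ ^ 2 ≤ ∫ t in (0 : ℝ)..T, ‖Oc (P t)‖ ^ 2) :
    ∃ C : ℝ, 0 < C ∧ ∀ Q, IsTrajectory Kd Q → ‖domIncl Kd (Q 0)‖ ^ 2 ≤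
      C * ∫ t in Ioi (0 : ℝ), Real.exp (-(2 * β) * t) * ‖Od (Q t)‖ ^ 2 := by
  -- The summands come from `2 ‖P 1‖²`, `2 ‖P 1 - Q 1‖²` and `2 ∫₀¹ ‖Od Q‖²`, in this order.
  refine ⟨2 * (2 * (Real.exp (2 * β * (T + 1)) * ((1 + M ^ 2))) / c) +
    2 * (Real.exp (2 * β * 1) * (1 + M ^ 2)) + 2 * Real.exp (2 * β * 1), by positivity,
    fun Q hQ => ?_⟩
  obtain ⟨P, hP, hP0, hPtraj, hder⟩ := exists_companion hc hd hQ
  set Q' : ℝ → GraphDomain Kd := fun t => ((min t 1 : ℝ) : ℂ) • Q t with hQ'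
  have hQc := hQ.1
  have hQ'c : Continuous Q' := by fun_prop
  obtain ⟨C₁, hC₁⟩ := hPtraj.exists_bound hc.re_inner_nonpos
  obtain ⟨C₂, hC₂⟩ := exists_bound_of_shift hP hC₁
  obtain ⟨C₃, hC₃⟩ := hQ.exists_bound hd.re_inner_nonpos
  set C := max C₂ C₃
  have hPC : ∀ t, 0 ≤ t → ‖P t‖ ≤ C := fun t ht => (hC₂ t ht).trans (le_max_left _ _)
  have hQC : ∀ t, 0 ≤ t → ‖Q t‖ ≤ C := fun t ht => (hC₃ t ht).trans (le_max_right _ _)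
  have hmin : ∀ t : ℝ, 0 ≤ t → ‖((min t 1 : ℝ) : ℂ)‖ ≤ 1 := fun t ht => by
    rw [Complex.norm_real, Real.norm_of_nonneg (le_min ht zero_le_one)]
    exact min_le_right _ _
  have hQ'C : ∀ t, 0 ≤ t → ‖Q' t‖ ≤ C := fun t ht => by
    rw [hQ', norm_smul]
    exact (mul_le_of_le_one_left (norm_nonneg _) (hmin t ht)).trans (hQC t ht)
  set N := ∫ t in Ioi (0 : ℝ), Real.exp (-(2 * β) * t) * ‖Od (Q t)‖ ^ 2 with hN
  set k : ℝ → W := fun t => Od (Q' t) with hk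
  set g : ℝ → W := fun t => Oc (P t) - k t with hg
  have kc : Continuous k := by fun_prop
  have gc : Continuous g := by fun_prop
  have hOd : ∀ q : GraphDomain Kd, ‖q‖ ≤ C → ‖Od q‖ ≤ ‖Od‖ * C := fun q hq =>
    (Od.le_opNorm q).trans (by gcongr)
  have hkC : ∀ t, 0 ≤ t → ‖k t‖ ≤ ‖Od‖ * C := fun t ht => hOd _ (hQ'C t ht)
  have hgC : ∀ t, 0 ≤ t → ‖g t‖ ≤ ‖Oc‖ * C + ‖Od‖ * C := fun t ht =>
    (norm_sub_le _ _).trans (add_le_add ((Oc.le_opNorm _).trans (by gcongr; exact hPC t ht))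
      (hkC t ht))
  have hvC : ∀ t, 0 ≤ t → ‖Od (Q t)‖ ≤ ‖Od‖ * C := fun t ht => hOd _ (hQC t ht)
  have hkN : ∫ t in Ioi (0 : ℝ), Real.exp (-(2 * β) * t) * ‖k t‖ ^ 2 ≤ N := by
    refine setIntegral_mono_on (integrableOn_exp_norm_sq kc hkC hβ)
      (integrableOn_exp_norm_sq (by fun_prop) hvC hβ) measurableSet_Ioi fun t ht => ?_
    have : ‖k t‖ ≤ ‖Od (Q t)‖ := by
      rw [hk, hQ']
      simp only [map_smul, norm_smul]
      exact mul_le_of_le_one_left (norm_nonneg _) (hmin t (le_of_lt ht))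
    gcongr
  have hgN : ∫ t in Ioi (0 : ℝ), Real.exp (-(2 * β) * t) * ‖g t‖ ^ 2 ≤ M ^ 2 * N := by
    refine (integral_output_le hc hd hβ hM hF hP hQ'c hder ?_ hPC hQ'C).trans
      (mul_le_mul_of_nonneg_left hkN (sq_nonneg M))
    simp [hP0, hQ']
  have hk1 : ∀ {a b : ℝ}, 0 ≤ a → a ≤ b → ∫ t in a..b, (‖g t‖ ^ 2 + ‖k t‖ ^ 2) ≤
      Real.exp (2 * β * b) * ((1 + M ^ 2) * N) := by
    intro a b ha hab
    rw [intervalIntegral.integral_add (Continuous.intervalIntegrable (by fun_prop) _ _)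
      (Continuous.intervalIntegrable (by fun_prop) _ _)]
    have h1 := integral_norm_sq_le_exp_mul gc hgC hβ ha hab
    have h2 := integral_norm_sq_le_exp_mul kc hkC hβ ha hab
    have h3 := mul_le_mul_of_nonneg_left hgN (Real.exp_pos (2 * β * b)).le
    have h4 := mul_le_mul_of_nonneg_left hkN (Real.exp_pos (2 * β * b)).le
    linarith
  have hδ : ‖domIncl Kc (P 1) - domIncl Kd (Q 1)‖ ^ 2 ≤
      Real.exp (2 * β * 1) * ((1 + M ^ 2) * N) := by
    have h1 := norm_sq_sub_eq_of_energyIdentity hE hP hQ'c hder le_rfl zero_le_one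
    have e0 : domIncl Kc (P 0) - domIncl Kd (Q' 0) = 0 := by simp [hP0, hQ']
    have e1 : Q' 1 = Q 1 := by simp [hQ']
    rw [e0, e1, norm_zero, zero_pow two_ne_zero, sub_zero] at h1
    rw [h1]
    refine le_trans ?_ (hk1 le_rfl zero_le_one)
    refine intervalIntegral.integral_mono_on zero_le_one ?_
      (Continuous.intervalIntegrable (by fun_prop) _ _) fun t _ => ?_
    · exact Continuous.intervalIntegrable (continuous_const.mul
          ((Complex.continuous_re.comp (kc.inner (Oc.continuous.comp hP))).sub (by fun_prop))) _ _
    -- As `Oc P = g + k`, the energy production is `2 Re ⟨k, g⟩`, at most `‖g‖² + ‖k‖²`.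
    · have h2 : (inner ℂ (k t) (Oc (P t))).re - ‖k t‖ ^ 2 = (inner ℂ (k t) (g t)).re := by
        rw [hg]
        simp only [inner_sub_right, Complex.sub_re]
        rw [inner_self_eq_norm_sq_to_K, ← Complex.ofReal_re (‖k t‖ ^ 2), Complex.ofReal_pow]
        rfl
      change 2 * ((inner ℂ (k t) (Oc (P t))).re - ‖k t‖ ^ 2) ≤ _
      rw [h2]
      have := (Complex.re_le_norm _).trans (norm_inner_le_norm (𝕜 := ℂ) (k t) (g t))
      nlinarith [sq_nonneg (‖k t‖ - ‖g t‖)]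
  have hp1 : c * ‖domIncl Kc (P 1)‖ ^ 2 ≤
      2 * (Real.exp (2 * β * (T + 1)) * ((1 + M ^ 2) * N)) := by
    have h1 := hobs _ hPtraj
    rw [zero_add, intervalIntegral.integral_comp_add_right (fun t => ‖Oc (P t)‖ ^ 2),
      zero_add] at h1
    refine h1.trans ?_
    refine le_trans ?_ (mul_le_mul_of_nonneg_left (hk1 (b := T + 1) zero_le_one (by linarith))
      zero_le_two)
    rw [← intervalIntegral.integral_const_mul]
    refine intervalIntegral.integral_mono_on (by linarith)
      (Continuous.intervalIntegrable (by fun_prop) _ _)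
      (Continuous.intervalIntegrable (by fun_prop) _ _) fun t _ => ?_
    have h2 : ‖Oc (P t)‖ ≤ ‖g t‖ + ‖k t‖ := by
      have := norm_add_le (g t) (k t)
      rwa [hg, sub_add_cancel] at this
    nlinarith [norm_nonneg (Oc (P t)), sq_nonneg (‖g t‖ - ‖k t‖), norm_nonneg (g t),
      norm_nonneg (k t)]
  have hp2 : ‖domIncl Kc (P 1)‖ ^ 2 ≤
      2 * (Real.exp (2 * β * (T + 1)) * (1 + M ^ 2)) / c * N := by
    rw [div_mul_eq_mul_div, le_div_iff₀ hc0]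
    linarith
  have hq1 : ‖domIncl Kd (Q 1)‖ ^ 2 ≤ 2 * ‖domIncl Kc (P 1)‖ ^ 2 +
      2 * ‖domIncl Kc (P 1) - domIncl Kd (Q 1)‖ ^ 2 := by
    have h1 := norm_sub_le (domIncl Kc (P 1)) (domIncl Kc (P 1) - domIncl Kd (Q 1))
    rw [sub_sub_cancel] at h1
    nlinarith [norm_nonneg (domIncl Kd (Q 1)), sq_nonneg (‖domIncl Kc (P 1)‖ -
      ‖domIncl Kc (P 1) - domIncl Kd (Q 1)‖)]
  have hq0 := hQ.norm_sq_sub_eq hE le_rfl zero_le_one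
  have hq2 := integral_norm_sq_le_exp_mul (f := fun t => Od (Q t)) (by fun_prop) hvC hβ le_rfl
    zero_le_one
  rw [← hN] at hq2
  linarith

/-- Split at `T`. Before it the weight is at most `1` and the dissipation is the energy drop; after
it the weight is at most `e^{-2βT}` and the dissipation is bounded by the initial energy. -/
theorem IsTrajectory.integral_exp_le (hE : EnergyIdentity Oc Od)
    (hd : IsMDissipative Kd) {Q : ℝ → GraphDomain Kd} (hQ : IsTrajectory Kd Q) {β T : ℝ}
    (hβ : 0 < β) (hT : 0 ≤ T) :
    2 * ∫ t in Ioi (0 : ℝ), Real.exp (-(2 * β) * t) * ‖Od (Q t)‖ ^ 2 ≤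
      ‖domIncl Kd (Q 0)‖ ^ 2 - ‖domIncl Kd (Q T)‖ ^ 2 +
        Real.exp (-(2 * β) * T) * ‖domIncl Kd (Q 0)‖ ^ 2 := by
  obtain ⟨C, hC⟩ := hQ.exists_bound hd.re_inner_nonpos
  have hQc := hQ.1
  have hi := integrableOn_exp_norm_sq (f := fun t => Od (Q t)) (by fun_prop)
    (fun t ht => (Od.le_opNorm _).trans (mul_le_mul_of_nonneg_left (hC t ht) (norm_nonneg Od))) hβ
  have hl := (intervalIntegral_tendsto_integral_Ioi 0 hi tendsto_id).const_mul 2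
  refine le_of_tendsto hl ?_
  filter_upwards [eventually_ge_atTop T] with R hR
  have ii : ∀ a b : ℝ, IntervalIntegrable
      (fun t => Real.exp (-(2 * β) * t) * ‖Od (Q t)‖ ^ 2) volume a b := fun a b =>
    Continuous.intervalIntegrable (by fun_prop) _ _
  have ii' : ∀ a b : ℝ, IntervalIntegrable (fun t => ‖Od (Q t)‖ ^ 2) volume a b := fun a b =>
    Continuous.intervalIntegrable (by fun_prop) _ _
  rw [id, ← intervalIntegral.integral_add_adjacent_intervals (ii 0 T) (ii T R)]
  have h1 : ∫ t in (0 : ℝ)..T, Real.exp (-(2 * β) * t) * ‖Od (Q t)‖ ^ 2 ≤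
      ∫ t in (0 : ℝ)..T, ‖Od (Q t)‖ ^ 2 := by
    refine intervalIntegral.integral_mono_on hT (ii _ _) (ii' _ _) fun t ht => ?_
    refine mul_le_of_le_one_left (by positivity) (Real.exp_le_one_iff.2 ?_)
    nlinarith [ht.1]
  have h2 : ∫ t in T..R, Real.exp (-(2 * β) * t) * ‖Od (Q t)‖ ^ 2 ≤
      Real.exp (-(2 * β) * T) * ∫ t in T..R, ‖Od (Q t)‖ ^ 2 := by
    rw [← intervalIntegral.integral_const_mul]
    refine intervalIntegral.integral_mono_on hR (ii _ _) ((ii' _ _).const_mul _) fun t ht => ?_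
    refine mul_le_mul_of_nonneg_right (Real.exp_le_exp.2 ?_) (by positivity)
    nlinarith [ht.1]
  have h3 := hQ.norm_sq_sub_eq hE le_rfl hT
  have h4 := hQ.norm_sq_sub_eq hE hT hR
  have h5 := hQ.norm_domIncl_le hd.re_inner_nonpos hT
  have h6 : 2 * ∫ t in T..R, ‖Od (Q t)‖ ^ 2 ≤ ‖domIncl Kd (Q 0)‖ ^ 2 := by
    have := pow_le_pow_left₀ (norm_nonneg _) h5 2
    linarith [sq_nonneg ‖domIncl Kd (Q R)‖]
  have h7 := mul_le_mul_of_nonneg_left h6 (Real.exp_pos (-(2 * β) * T)).le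
  linarith

/-- Observability of the conservative system implies decay of the damped one. -/
theorem decay_of_observable [CompleteSpace W] (hc : IsMDissipative Kc)
    (hd : IsMDissipative Kd) (hE : EnergyIdentity Oc Od) {β M : ℝ} (hβ : 0 < β) (hM : 0 ≤ M)
    (hF : FrequencyBound Oc Od β M) {T c : ℝ} (hT : 0 < T) (hc0 : 0 < c)
    (hobs : ∀ P, IsTrajectory Kc P →
      c * ‖domIncl Kc (P 0)‖ ^ 2 ≤ ∫ t in (0 : ℝ)..T, ‖Oc (P t)‖ ^ 2) :
    ∃ S : ℝ, 0 < S ∧ ∃ q : ℝ, 0 < q ∧ q < 1 ∧ ∀ Q, IsTrajectory Kd Q →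
      ‖domIncl Kd (Q S)‖ ^ 2 ≤ q * ‖domIncl Kd (Q 0)‖ ^ 2 := by
  obtain ⟨C, hC, h⟩ := exists_norm_sq_le_of_observable hc hd hE hβ hM hF hT hc0 hobs
  have hexp : Tendsto (fun S : ℝ => Real.exp (-(2 * β * S))) atTop (𝓝 0) :=
    Real.tendsto_exp_neg_atTop_nhds_zero.comp (tendsto_id.const_mul_atTop (by positivity))
  -- `S` is chosen so late that `C e^{-2βS} ≤ 1`, which absorbs the tail into the left side.
  obtain ⟨S, hS, hS0⟩ := ((hexp.eventually_lt_const (by positivity : 0 < 1 / (C + 1))).and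
    (eventually_gt_atTop 0)).exists
  refine ⟨S, hS0, 1 - 1 / (C + 1), ?_, ?_, fun Q hQ => ?_⟩
  · rw [sub_pos, div_lt_one (by positivity)]; linarith
  · have : 0 < 1 / (C + 1) := by positivity
    linarith
  · have h1 := h Q hQ
    have h2 := hQ.integral_exp_le hE hd hβ hS0.le
    rw [neg_mul] at h2
    have h3 := sq_nonneg ‖domIncl Kd (Q 0)‖
    set e := Real.exp (-(2 * β * S))
    set a := ‖domIncl Kd (Q 0)‖ ^ 2
    set b := ‖domIncl Kd (Q S)‖ ^ 2
    have h4 : 2 * a ≤ C * (a - b + e * a) := by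
      have := mul_le_mul_of_nonneg_left h2 hC.le
      linarith
    have h5 : e * (C + 1) ≤ 1 := by
      rw [lt_div_iff₀ (by positivity)] at hS
      exact hS.le
    have h6 : C * e * a ≤ 1 * a := by
      refine mul_le_mul_of_nonneg_right ?_ h3
      have : 0 < e := Real.exp_pos _
      linarith
    -- The inequalities so far give `C b ≤ (C - 1) a`; adding `b ≤ a` produces the ratio `C / (C +
    -- 1)`, which lies in `(0, 1)` for every `C > 0`.
    have h7 : b ≤ a :=
      pow_le_pow_left₀ (norm_nonneg _) (hQ.norm_domIncl_le hd.re_inner_nonpos hS0.le) 2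
    have h8 : (1 - 1 / (C + 1)) * a = C * a / (C + 1) := by field_simp; ring
    rw [h8, le_div_iff₀ (by positivity)]
    linarith

omit [CompleteSpace E] in
theorem exponential_of_decay {K : E →ₗ.[ℂ] E} (hK : IsMDissipative K) {S q : ℝ} (hS : 0 < S)
    (hq : 0 < q) (hq1 : q < 1) (h : ∀ Q, IsTrajectory K Q →
      ‖domIncl K (Q S)‖ ^ 2 ≤ q * ‖domIncl K (Q 0)‖ ^ 2) :
    ∃ c : ℝ, 0 < c ∧ ∃ ω : ℝ, 0 < ω ∧ ∀ Q, IsTrajectory K Q → ∀ t : ℝ, 0 ≤ t →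
      ‖domIncl K (Q t)‖ ^ 2 ≤ c * Real.exp (-ω * t) * ‖domIncl K (Q 0)‖ ^ 2 := by
  have hlog : Real.log q < 0 := Real.log_neg hq hq1
  -- The factor `1 / q` makes up for the last incomplete period of length `S`.
  refine ⟨1 / q, by positivity, -Real.log q / S, div_pos (by linarith) hS, fun Q hQ t ht => ?_⟩
  have iter : ∀ n : ℕ, ‖domIncl K (Q (n * S))‖ ^ 2 ≤ q ^ n * ‖domIncl K (Q 0)‖ ^ 2 := by
    intro n
    induction n with
    | zero => simp
    | succ n ih =>
      have := h _ (hQ.shift (a := n * S) (by positivity))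
      rw [zero_add] at this
      have e : ((n + 1 : ℕ) : ℝ) * S = S + n * S := by push_cast; ring
      rw [e, pow_succ' q, mul_assoc]
      exact this.trans (mul_le_mul_of_nonneg_left ih hq.le)
  set n := ⌊t / S⌋₊
  have hn : n * S ≤ t := by
    rw [← le_div_iff₀ hS]
    exact Nat.floor_le (by positivity)
  have hn' : t / S < n + 1 := Nat.lt_floor_add_one _
  have h1 := (hQ.shift (a := n * S) (by positivity)).norm_domIncl_le hK.re_inner_nonpos
    (sub_nonneg.2 hn)
  rw [sub_add_cancel, zero_add] at h1
  refine (pow_le_pow_left₀ (norm_nonneg _) h1 2).trans ((iter n).trans ?_)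
  refine mul_le_mul_of_nonneg_right ?_ (by positivity)
  have h2 : q ^ n = Real.exp (n * Real.log q) := by
    rw [Real.exp_nat_mul, Real.exp_log hq]
  have h3 : 1 / q = Real.exp (-Real.log q) := by
    rw [Real.exp_neg, Real.exp_log hq, one_div]
  rw [h2, h3, ← Real.exp_add, Real.exp_le_exp]
  have h4 : -(-Real.log q / S) * t = Real.log q * (t / S) := by field_simp
  rw [h4]
  nlinarith

/-- Exponential stability of the damped system is equivalent to observability of the conservative
one. -/
theorem exponential_iff_observable [CompleteSpace W] (hc : IsMDissipative Kc)
    (hd : IsMDissipative Kd) (hE : EnergyIdentity Oc Od) {β M : ℝ} (hβ : 0 < β) (hM : 0 ≤ M)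
    (hF : FrequencyBound Oc Od β M) :
    (∃ c : ℝ, 0 < c ∧ ∃ ω : ℝ, 0 < ω ∧ ∀ Q, IsTrajectory Kd Q → ∀ t : ℝ, 0 ≤ t →
      ‖domIncl Kd (Q t)‖ ^ 2 ≤ c * Real.exp (-ω * t) * ‖domIncl Kd (Q 0)‖ ^ 2) ↔
    ∃ T : ℝ, 0 < T ∧ ∃ c : ℝ, 0 < c ∧ ∀ P, IsTrajectory Kc P →
      c * ‖domIncl Kc (P 0)‖ ^ 2 ≤ ∫ t in (0 : ℝ)..T, ‖Oc (P t)‖ ^ 2 := by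
  constructor
  · rintro ⟨c, hc0, ω, hω, h⟩
    have hexp : Tendsto (fun S : ℝ => c * Real.exp (-(ω * S))) atTop (𝓝 (c * 0)) :=
      (Real.tendsto_exp_neg_atTop_nhds_zero.comp (tendsto_id.const_mul_atTop hω)).const_mul c
    rw [mul_zero] at hexp
    obtain ⟨T, hT, hT0⟩ := ((hexp.eventually_lt_const (by positivity : (0 : ℝ) < 1 / 2)).and
      (eventually_gt_atTop 0)).exists
    refine ⟨T, hT0, 1 / 4, by norm_num, fun P hP => observable_of_decay hd hE hT0.le
      (fun Q hQ => (h Q hQ T hT0.le).trans ?_) hP⟩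
    rw [neg_mul]
    gcongr
  · rintro ⟨T, hT, c, hc0, h⟩
    obtain ⟨S, hS, q, hq, hq1, h'⟩ := decay_of_observable hc hd hE hβ hM hF hT hc0 h
    exact exponential_of_decay hd hS hq hq1 h'

end Decay

/-! ### Duality and skew-adjoint operators -/

section Duality

variable {E K : Type*} [NormedAddCommGroup E] [NormedSpace ℂ E]
  [NormedAddCommGroup K] [InnerProductSpace ℂ K]

theorem pivot_apply (j : E →L[ℂ] K) (k : K) (v : E) : pivot j k v = inner ℂ (j v) k := rfl

theorem pivot_injective {j : E →L[ℂ] K} (hj : DenseRange j) : Function.Injective (pivot j) := by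
  rw [injective_iff_map_eq_zero]
  intro k hk
  have h : ∀ x : K, inner ℂ x k = 0 := by
    intro x
    refine hj.induction_on (p := fun x => inner ℂ x k = 0) x
      (isClosed_eq (by fun_prop) continuous_const) fun v => ?_
    rw [← pivot_apply, hk]
    rfl
  exact inner_self_eq_zero.1 (h k)

/-- The Riesz representation of a bounded conjugate-linear functional. -/
theorem exists_inner_eq [CompleteSpace K] (G : AntiDual K) : ∃ k : K, ∀ x, inner ℂ x k = G x := by
  let φ : StrongDual ℂ K :=
    { toFun := fun x => starRingEnd ℂ (G x)
      map_add' := fun x y => by simp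
      map_smul' := fun c x => by simp
      cont := Complex.continuous_conj.comp G.continuous }
  refine ⟨(InnerProductSpace.toDual ℂ K).symm φ, fun x => ?_⟩
  rw [← inner_conj_symm, InnerProductSpace.toDual_symm_apply]
  exact Complex.conj_conj _

theorem inner_self_complex (x : K) : inner ℂ x x = (‖x‖ : ℂ) ^ 2 := inner_self_eq_norm_sq_to_K x

theorem re_inner_self (x : K) : (inner ℂ x x).re = ‖x‖ ^ 2 := by
  rw [inner_self_complex, ← Complex.ofReal_pow, Complex.ofReal_re]

end Duality

/-! ### Skew-adjoint operators and their resolvents -/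

section SkewAdjoint

variable {U : Type*} [NormedAddCommGroup U] [InnerProductSpace ℂ U] [CompleteSpace U]
  {C : U →ₗ.[ℂ] U}

theorem IsSkewAdjointOp.denseRange (hC : IsSkewAdjointOp C) : DenseRange (domIncl C) := by
  have h := hC.1
  rwa [← Subtype.range_coe (s := (C.domain : Set U))] at h

theorem IsSkewAdjointOp.inner_domApply (hC : IsSkewAdjointOp C) (a b : GraphDomain C) :
    inner ℂ (domApply C a) (domIncl C b) = -inner ℂ (domIncl C a) (domApply C b) := by
  have h := LinearPMap.adjoint_isFormalAdjoint hC.1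
  rw [hC.2] at h
  have h1 := h (a : C.domain) (b : C.domain)
  change inner ℂ (-domApply C a) (domIncl C b) = inner ℂ (domIncl C a) (domApply C b) at h1
  rw [inner_neg_left] at h1
  exact neg_eq_iff_eq_neg.1 h1

theorem IsSkewAdjointOp.re_inner (hC : IsSkewAdjointOp C) (a : GraphDomain C) :
    (inner ℂ (domIncl C a) (domApply C a)).re = 0 := by
  have h := hC.inner_domApply a a
  have h2 := inner_conj_symm (𝕜 := ℂ) (domApply C a) (domIncl C a)
  have h3 := congrArg Complex.re h
  rw [← h2, Complex.conj_re, Complex.neg_re] at h3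
  linarith

/-- This is maximality of the domain: the hypothesis puts `y` in the domain of the adjoint, which is
that of `-C`. -/
theorem IsSkewAdjointOp.mem_of_forall (hC : IsSkewAdjointOp C) {y w : U}
    (h : ∀ a : GraphDomain C, inner ℂ w (domIncl C a) = -inner ℂ y (domApply C a)) :
    ∃ b : GraphDomain C, domIncl C b = y ∧ domApply C b = w := by
  have h1 : ∀ x : C.domain, inner ℂ (-w) (x : U) = inner ℂ y (C x) := fun x => by
    rw [inner_neg_left, neg_eq_iff_eq_neg]
    exact h x
  have h2 : (y, -w) ∈ C.adjoint.graph := by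
    rw [LinearPMap.mem_graph_iff]
    exact ⟨⟨y, LinearPMap.mem_adjoint_domain_of_exists y ⟨-w, h1⟩⟩, rfl,
      LinearPMap.adjoint_apply_eq hC.1 _ h1⟩
  rw [hC.2, LinearPMap.mem_graph_iff] at h2
  obtain ⟨b, hb, hb'⟩ := h2
  exact ⟨(b : C.domain), hb, neg_injective hb'⟩

theorem IsSkewAdjointOp.completeSpace (hC : IsSkewAdjointOp C) : CompleteSpace (GraphDomain C) := by
  have h : IsUniformInducing (graphMap C) := ⟨rfl⟩
  rw [completeSpace_iff_isComplete_range h]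
  refine IsClosed.isComplete ?_
  have e : range (graphMap C) = ⋂ a : GraphDomain C, {p : WithLp 2 (U × U) |
      inner ℂ p.snd (domIncl C a) = -inner ℂ p.fst (domApply C a)} := by
    ext p
    simp only [mem_range, mem_iInter, mem_ofPred_eq]
    constructor
    · rintro ⟨b, rfl⟩ a
      exact hC.inner_domApply b a
    · intro hp
      obtain ⟨b, hb, hb'⟩ := hC.mem_of_forall hp
      exact ⟨b, WithLp.ofLp_injective 2 (Prod.ext hb hb')⟩
  rw [e]
  refine isClosed_iInter fun a => isClosed_eq ?_ ?_
  · exact Continuous.inner (WithLp.sndL 2 ℂ U U).continuous continuous_const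
  · exact (Continuous.inner (WithLp.fstL 2 ℂ U U).continuous continuous_const).neg

/-- `1 - ε C` is onto for real `ε ≠ 0`. -/
theorem IsSkewAdjointOp.exists_sub_eq (hC : IsSkewAdjointOp C) {ε : ℝ} (hε : ε ≠ 0) (f : U) :
    ∃ a : GraphDomain C, domIncl C a - (ε : ℂ) • domApply C a = f := by
  have := hC.completeSpace
  set L : GraphDomain C →L[ℂ] U := domIncl C - (ε : ℂ) • domApply C with hL
  -- The cross term vanishes because `⟨a, C a⟩` is purely imaginary; the range of `1 - ε C` is
  -- therefore closed.
  have hsq : ∀ a, ‖L a‖ ^ 2 = ‖domIncl C a‖ ^ 2 + ε ^ 2 * ‖domApply C a‖ ^ 2 := by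
    intro a
    change ‖domIncl C a - (ε : ℂ) • domApply C a‖ ^ 2 = _
    rw [norm_sub_sq (𝕜 := ℂ), inner_smul_right, norm_smul, Complex.norm_real, mul_pow,
      Real.norm_eq_abs, sq_abs]
    have : RCLike.re ((ε : ℂ) * inner ℂ (domIncl C a) (domApply C a)) = 0 := by
      change ((ε : ℂ) * inner ℂ (domIncl C a) (domApply C a)).re = 0
      rw [Complex.re_ofReal_mul, hC.re_inner, mul_zero]
    rw [this]; ring
  have hb : ∀ a, ‖a‖ ≤ (1 + 1 / |ε|) * ‖L a‖ := by
    intro a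
    have hε' : 0 < |ε| := abs_pos.2 hε
    have h0 := hsq a
    rw [← sq_abs ε] at h0
    have h1 : ‖domIncl C a‖ ≤ ‖L a‖ :=
      (abs_le_of_sq_le_sq' (by nlinarith [sq_nonneg (|ε| * ‖domApply C a‖)]) (norm_nonneg _)).2
    have h2 : |ε| * ‖domApply C a‖ ≤ ‖L a‖ :=
      (abs_le_of_sq_le_sq' (by nlinarith [sq_nonneg ‖domIncl C a‖]) (norm_nonneg _)).2
    have h3 : ‖domApply C a‖ ≤ 1 / |ε| * ‖L a‖ := by
      rw [one_div, inv_mul_eq_div, le_div_iff₀ hε']; linarith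
    linarith [norm_graphDomain_le C a]
  have hcl : IsClosed (range L) := by
    have := L.antilipschitz_of_bound (K := ⟨1 + 1 / |ε|, by positivity⟩) hb
    exact this.isClosed_range L.uniformContinuous
  have htop : (LinearMap.range (L : GraphDomain C →ₗ[ℂ] U)).topologicalClosure = ⊤ := by
    rw [Submodule.topologicalClosure_eq_top_iff, Submodule.eq_bot_iff]
    intro y hy
    have h1 : ∀ a : GraphDomain C, inner ℂ y (domIncl C a) = ε * inner ℂ y (domApply C a) := by
      intro a
      have h2 := hy (L a) ⟨a, rfl⟩
      rw [← inner_conj_symm, map_eq_zero] at h2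
      change inner ℂ y (domIncl C a - (ε : ℂ) • domApply C a) = 0 at h2
      rwa [inner_sub_right, inner_smul_right, sub_eq_zero] at h2
    have hε' : (ε : ℂ) ≠ 0 := by exact_mod_cast hε
    -- A vector orthogonal to the range is an eigenvector of `C` with the real nonzero eigenvalue
    -- `-1/ε`, impossible for a skew operator unless it is zero.
    obtain ⟨b, rfl, hb⟩ := hC.mem_of_forall (y := y) (w := -(((ε⁻¹ : ℝ) : ℂ) • y)) fun a => by
      rw [inner_neg_left, inner_smul_left, Complex.conj_ofReal, h1, Complex.ofReal_inv,
        inv_mul_cancel_left₀ hε']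
    have h3 := hC.re_inner b
    rw [hb, inner_neg_right, inner_smul_right, Complex.neg_re, Complex.re_ofReal_mul,
      neg_eq_zero, mul_eq_zero] at h3
    have h4 := h3.resolve_left (inv_ne_zero hε)
    have h5 : (inner ℂ (domIncl C b) (domIncl C b)).re = ‖domIncl C b‖ ^ 2 := by
      rw [inner_self_eq_norm_sq_to_K, ← Complex.ofReal_re (‖domIncl C b‖ ^ 2), Complex.ofReal_pow]
      rfl
    rw [h5] at h4
    exact norm_eq_zero.1 (pow_eq_zero_iff two_ne_zero |>.1 h4)
  have h1 : (f : U) ∈ closure (range L) := by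
    have := congrArg (fun s : Submodule ℂ U => (s : Set U)) htop
    simp only [Submodule.topologicalClosure_coe, Submodule.top_coe, LinearMap.coe_range] at this
    change closure (range L) = univ at this
    rw [this]; trivial
  rw [hcl.closure_eq] at h1
  exact h1

theorem IsSkewAdjointOp.isMDissipative (hC : IsSkewAdjointOp C) : IsMDissipative C := by
  refine ⟨fun x => (hC.re_inner x).le, 1, one_pos, fun f => ?_⟩
  obtain ⟨a, ha⟩ := hC.exists_sub_eq one_ne_zero f
  refine ⟨(a : C.domain), ?_⟩
  rw [Complex.ofReal_one, one_smul] at ha ⊢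
  exact ha

theorem IsSkewAdjointOp.neg_isMDissipative (hC : IsSkewAdjointOp C) : IsMDissipative (-C) := by
  refine ⟨fun x => ?_, 1, one_pos, fun f => ?_⟩
  · rw [LinearPMap.neg_apply, inner_neg_right, Complex.neg_re]
    exact (neg_eq_zero.2 (hC.re_inner (x : C.domain))).le
  · obtain ⟨a, ha⟩ := hC.exists_sub_eq (neg_ne_zero.2 one_ne_zero) f
    refine ⟨(a : C.domain), ?_⟩
    rw [Complex.ofReal_one, one_smul]
    change domIncl C a - -domApply C a = f
    rw [sub_neg_eq_add]
    rw [Complex.ofReal_neg, Complex.ofReal_one, neg_smul, one_smul, sub_neg_eq_add] at ha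
    exact ha

/-! ### The operators `(1 - ε² C²)⁻¹` -/

/-- `r = (1 - ε² C²)⁻¹ u`. -/
def IsSmoothing (C : U →ₗ.[ℂ] U) (ε : ℝ) (u : U) (r : GraphDomain C) : Prop :=
  ∃ s : GraphDomain C, domIncl C s = domApply C r ∧
    domIncl C r - ((ε : ℂ) ^ 2) • domApply C s = u

theorem IsSkewAdjointOp.exists_isSmoothing (hC : IsSkewAdjointOp C) {ε : ℝ} (hε : 0 < ε) (u : U) :
    ∃ r, IsSmoothing C ε u r := by
  -- Factorization `1 - ε² C² = (1 - ε C)(1 + ε C)`.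
  obtain ⟨a, ha⟩ := hC.exists_sub_eq hε.ne' u
  obtain ⟨r, hr⟩ := hC.exists_sub_eq (neg_ne_zero.2 hε.ne') (domIncl C a)
  have hε' : (ε : ℂ) ≠ 0 := by exact_mod_cast hε.ne'
  rw [Complex.ofReal_neg, neg_smul, sub_neg_eq_add] at hr
  refine ⟨r, (ε : ℂ)⁻¹ • (a - r), ?_, ?_⟩
  · rw [map_smul, map_sub, ← hr, add_sub_cancel_left, inv_smul_smul₀ hε']
  · rw [map_smul, map_sub, smul_smul, sq, mul_assoc, mul_inv_cancel₀ hε', mul_one, ← ha, ← hr]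
    module

omit [CompleteSpace U] in
theorem IsSmoothing.sub {ε : ℝ} {u v : U} {r t : GraphDomain C} (hr : IsSmoothing C ε u r)
    (ht : IsSmoothing C ε v t) : IsSmoothing C ε (u - v) (r - t) := by
  obtain ⟨s, hs, hs'⟩ := hr
  obtain ⟨s₂, h₂, h₂'⟩ := ht
  refine ⟨s - s₂, by rw [map_sub, map_sub, hs, h₂], ?_⟩
  rw [← hs', ← h₂', map_sub, map_sub]
  module

/-- Pairing `u = r - ε² C² r` with `r` gives exactly the left side, by skewness. -/
theorem IsSkewAdjointOp.smoothing_norm (hC : IsSkewAdjointOp C) {ε : ℝ} {u : U}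
    {r s : GraphDomain C} (hs : domIncl C s = domApply C r)
    (hr : domIncl C r - ((ε : ℂ) ^ 2) • domApply C s = u) :
    ‖domIncl C r‖ ^ 2 + ε ^ 2 * ‖domIncl C s‖ ^ 2 ≤ ‖domIncl C r‖ * ‖u‖ := by
  have h1 : inner ℂ (domIncl C r) u =
      ((‖domIncl C r‖ ^ 2 + ε ^ 2 * ‖domIncl C s‖ ^ 2 : ℝ) : ℂ) := by
    rw [← hr, inner_sub_right, inner_smul_right, (neg_eq_iff_eq_neg.2 (hC.inner_domApply r s)).symm,
      ← hs,
      inner_self_complex, inner_self_complex]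
    push_cast
    ring
  have h2 := (Complex.re_le_norm _).trans (norm_inner_le_norm (𝕜 := ℂ) (domIncl C r) u)
  rwa [h1, Complex.ofReal_re] at h2

theorem IsSkewAdjointOp.smoothing_norm_le (hC : IsSkewAdjointOp C) {ε : ℝ} {u : U}
    {r : GraphDomain C} (hr : IsSmoothing C ε u r) : ‖domIncl C r‖ ≤ ‖u‖ := by
  obtain ⟨s, hs, hs'⟩ := hr
  have h := hC.smoothing_norm hs hs'
  rcases (norm_nonneg (domIncl C r)).eq_or_lt with h0 | h0
  · rw [← h0]; exact norm_nonneg u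
  · refine le_of_mul_le_mul_left ?_ h0
    nlinarith [sq_nonneg (ε * ‖domIncl C s‖)]

theorem IsSkewAdjointOp.smoothing_mul_norm_le (hC : IsSkewAdjointOp C) {ε : ℝ} (hε : 0 ≤ ε)
    {u : U} {r s : GraphDomain C} (hs : domIncl C s = domApply C r)
    (hr : domIncl C r - ((ε : ℂ) ^ 2) • domApply C s = u) : ε * ‖domIncl C s‖ ≤ ‖u‖ := by
  have h := hC.smoothing_norm hs hr
  have h1 := hC.smoothing_norm_le ⟨s, hs, hr⟩
  refine (sq_le_sq₀ (by positivity) (norm_nonneg _)).1 ?_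
  nlinarith [norm_nonneg (domIncl C r), norm_nonneg u, sq_nonneg ‖domIncl C r‖]

omit [CompleteSpace U] in
/-- `C` commutes with the smoothing operators. -/
theorem IsSmoothing.domApply {ε : ℝ} (hε : ε ≠ 0) {a r : GraphDomain C}
    (h : IsSmoothing C ε (domIncl C a) r) : ∃ s s₂ : GraphDomain C,
      domIncl C s = DynFeedback.domApply C r ∧ domIncl C s₂ = DynFeedback.domApply C s ∧
      domIncl C s - ((ε : ℂ) ^ 2) • DynFeedback.domApply C s₂ = DynFeedback.domApply C a ∧
      domIncl C r - domIncl C a = ((ε : ℂ) ^ 2) • domIncl C s₂ := by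
  obtain ⟨s, hs, hs'⟩ := h
  have hε' : (ε : ℂ) ^ 2 ≠ 0 := pow_ne_zero 2 (by exact_mod_cast hε)
  refine ⟨s, ((ε : ℂ) ^ 2)⁻¹ • (r - a), hs, ?_, ?_, ?_⟩
  · rw [map_smul, map_sub, ← hs', sub_sub_cancel, inv_smul_smul₀ hε']
  · rw [map_smul, map_sub, smul_inv_smul₀ hε', hs, sub_sub_cancel]
  · rw [map_smul, map_sub, smul_inv_smul₀ hε']

theorem IsSkewAdjointOp.norm_smoothing_sub_le (hC : IsSkewAdjointOp C) {ε : ℝ} (hε : 0 < ε)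
    {a r : GraphDomain C} (h : IsSmoothing C ε (domIncl C a) r) :
    ‖domIncl C r - domIncl C a‖ ≤ ε * ‖domApply C a‖ := by
  obtain ⟨s, s₂, -, hs₂, hs, he⟩ := h.domApply hε.ne'
  have h1 := hC.smoothing_mul_norm_le hε.le hs₂ hs
  rw [he, norm_smul, norm_pow, Complex.norm_real, Real.norm_of_nonneg hε.le, sq, mul_assoc]
  gcongr

theorem IsSkewAdjointOp.tendsto_smoothing (hC : IsSkewAdjointOp C) {u : U}
    {r : ℝ → GraphDomain C} (hr : ∀ ε, 0 < ε → IsSmoothing C ε u (r ε)) :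
    Tendsto (fun ε => domIncl C (r ε)) (𝓝[>] 0) (𝓝 u) := by
  rw [Metric.tendsto_nhdsWithin_nhds]
  intro η hη
  obtain ⟨_, ha, a, rfl⟩ := Metric.dense_iff.1 hC.denseRange u (η / 3) (by positivity)
  have ha' : ‖u - domIncl C a‖ < η / 3 := by
    rw [← dist_eq_norm, dist_comm]; exact ha
  refine ⟨η / 3 / (‖domApply C a‖ + 1), by positivity, fun {ε} hε hε' => ?_⟩
  have hε0 : 0 < ε := hε
  rw [dist_zero_right, Real.norm_of_nonneg hε0.le, lt_div_iff₀ (by positivity)] at hε'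
  obtain ⟨t, ht⟩ := hC.exists_isSmoothing hε0 (domIncl C a)
  have h1 := hC.smoothing_norm_le ((hr ε hε0).sub ht)
  have h2 := hC.norm_smoothing_sub_le hε0 ht
  rw [dist_eq_norm]
  have e : domIncl C (r ε) - u = domIncl C (r ε - t) + (domIncl C t - domIncl C a)
      - (u - domIncl C a) := by rw [map_sub]; abel
  rw [e]
  refine (norm_sub_le _ _).trans_lt ?_
  have := norm_add_le (domIncl C (r ε - t)) (domIncl C t - domIncl C a)
  nlinarith

/-- Smoothing commutes with `C`, so the strong convergence in `U` applies to `C a` as well. -/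
theorem IsSkewAdjointOp.tendsto_smoothing_graph (hC : IsSkewAdjointOp C) {a : GraphDomain C}
    {r : ℝ → GraphDomain C} (hr : ∀ ε, 0 < ε → IsSmoothing C ε (domIncl C a) (r ε)) :
    Tendsto r (𝓝[>] 0) (𝓝 a) := by
  have hs : ∀ ε, ∃ s : GraphDomain C, 0 < ε →
      domIncl C s = domApply C (r ε) ∧ IsSmoothing C ε (domApply C a) s := by
    intro ε
    by_cases hε : 0 < ε
    · obtain ⟨s, s₂, h1, h2, h3, -⟩ := (hr ε hε).domApply hε.ne'
      exact ⟨s, fun _ => ⟨h1, s₂, h2, h3⟩⟩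
    · exact ⟨0, fun h => absurd h hε⟩
  choose s hs using hs
  have h1 := hC.tendsto_smoothing hr
  have h2 := hC.tendsto_smoothing (fun ε hε => (hs ε hε).2)
  rw [tendsto_iff_norm_sub_tendsto_zero] at h1 h2 ⊢
  have h3 := h1.add h2
  rw [add_zero] at h3
  refine squeeze_zero' (Eventually.of_forall fun _ => norm_nonneg _) ?_ h3
  filter_upwards [self_mem_nhdsWithin] with ε hε
  rw [(hs ε hε).1, ← map_sub, ← map_sub]
  exact norm_graphDomain_le C _

end SkewAdjoint

/-! ### The feedback operator and the characteristic operator -/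

section FeedbackSpec

variable {U W : Type*} [NormedAddCommGroup U] [InnerProductSpace ℂ U] [CompleteSpace U]
  [NormedAddCommGroup W] [InnerProductSpace ℂ W] [CompleteSpace W]
  {C : U →ₗ.[ℂ] U} (D : W →L[ℂ] AntiDual (GraphDomain C))

/-- The relation is single valued: the only smoothing of `0` is `0`. -/
theorem starExt_graph (hC : IsSkewAdjointOp C) : (starExt C D).graph = starExtGraph C D := by
  refine Submodule.toLinearPMap_graph_eq _ fun p hp hp0 => ?_
  obtain ⟨r, hr, hlim⟩ := hp
  refine tendsto_nhds_unique hlim (Tendsto.congr' ?_ tendsto_const_nhds)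
  filter_upwards [self_mem_nhdsWithin] with ε hε
  have h1 := hC.smoothing_norm_le (hr ε hε)
  rw [hp0, norm_zero, norm_le_zero_iff] at h1
  have h2 : r ε = 0 := domIncl_injective C (by rw [h1, map_zero])
  rw [h2, map_zero]

theorem mem_starExtGraph (hC : IsSkewAdjointOp C) (u : (starExt C D).domain) :
    ((u : U), starExt C D u) ∈ starExtGraph C D := by
  rw [← starExt_graph D hC]
  exact LinearPMap.mem_graph _ u

theorem exists_starExt_eq (hC : IsSkewAdjointOp C) {u : U} {w : W}
    (h : (u, w) ∈ starExtGraph C D) : ∃ hu : u ∈ (starExt C D).domain, starExt C D ⟨u, hu⟩ = w := by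
  rw [← starExt_graph D hC, LinearPMap.mem_graph_iff] at h
  obtain ⟨⟨y, hy⟩, rfl, h2⟩ := h
  exact ⟨hy, h2⟩

theorem starExt_domIncl (hC : IsSkewAdjointOp C) (a : GraphDomain C) :
    ∃ hu : domIncl C a ∈ (starExt C D).domain, starExt C D ⟨domIncl C a, hu⟩ = adj D a := by
  refine exists_starExt_eq D hC ?_
  have hr : ∀ ε : ℝ, ∃ r : GraphDomain C, 0 < ε → IsSmoothing C ε (domIncl C a) r := by
    intro ε
    by_cases hε : 0 < ε
    · obtain ⟨r, hr⟩ := hC.exists_isSmoothing hε (domIncl C a)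
      exact ⟨r, fun _ => hr⟩
    · exact ⟨0, fun h => absurd h hε⟩
  choose r hr using hr
  exact ⟨r, hr, ((adj D).continuous.tendsto _).comp (hC.tendsto_smoothing_graph hr)⟩

theorem feedback_mem_graph (hC : IsSkewAdjointOp C) (q : (feedback C D).domain) :
    ((q : U), feedback C D q) ∈ feedbackGraph C D := by
  refine Submodule.mem_graph_toLinearPMap ?_ q
  rintro ⟨u, f⟩ ⟨h, hp⟩ hp0
  obtain rfl : u = 0 := hp0
  have h1 : starExt C D ⟨0, h⟩ = 0 := (starExt C D).map_zero
  change pivot (domIncl C) f = -extC C 0 - D (starExt C D ⟨0, h⟩) at hp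
  rw [h1, map_zero, map_zero, neg_zero, sub_zero, ← map_zero (pivot (domIncl C))] at hp
  exact pivot_injective hC.denseRange hp

theorem feedback_spec (hC : IsSkewAdjointOp C) (q : (feedback C D).domain) :
    ∃ h : (q : U) ∈ (starExt C D).domain, ∀ a : GraphDomain C,
      inner ℂ (domIncl C a) (feedback C D q) =
        inner ℂ (domApply C a) (q : U) - inner ℂ (adj D a) (starExt C D ⟨q, h⟩) := by
  obtain ⟨h, hp⟩ := feedback_mem_graph D hC q
  refine ⟨h, fun a => ?_⟩
  have h1 := congrArg (fun F : AntiDual (GraphDomain C) => F a) hp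
  rw [inner_adj]
  have h2 : extC C (q : U) a = -inner ℂ (domApply C a) (q : U) := rfl
  change inner ℂ (domIncl C a) (feedback C D q) =
    -(extC C (q : U) a) - D (starExt C D ⟨q, h⟩) a at h1
  rw [h1, h2, neg_neg]

theorem feedback_mem_starExt (hC : IsSkewAdjointOp C) (q : (feedback C D).domain) :
    (q : U) ∈ (starExt C D).domain := (feedback_spec D hC q).1

theorem inner_feedback (hC : IsSkewAdjointOp C) (q : (feedback C D).domain) (a : GraphDomain C) :
    inner ℂ (domIncl C a) (feedback C D q) = inner ℂ (domApply C a) (q : U) -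
      inner ℂ (adj D a) (starExt C D ⟨q, feedback_mem_starExt D hC q⟩) :=
  (feedback_spec D hC q).2 a

/-- The weak equation cannot be tested with `q`, which may lie outside `D(C)`; it is tested with the
smoothings `r ε`. The term `⟨C r, q⟩ = ⟨C r, r - ε² C² r⟩` is purely imaginary by skewness, so only
the output survives in the limit. The symmetric form of the regularization is essential here. -/
theorem re_inner_feedback_self (hC : IsSkewAdjointOp C) (q : (feedback C D).domain) :
    (inner ℂ (q : U) (feedback C D q)).re =
      -‖starExt C D ⟨q, feedback_mem_starExt D hC q⟩‖ ^ 2 := by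
  set w := starExt C D ⟨q, feedback_mem_starExt D hC q⟩ with hw
  obtain ⟨r, hr, hlim⟩ := mem_starExtGraph D hC ⟨q, feedback_mem_starExt D hC q⟩
  have h1 : Tendsto (fun ε => (inner ℂ (domIncl C (r ε)) (feedback C D q)).re) (𝓝[>] 0)
      (𝓝 (inner ℂ (q : U) (feedback C D q)).re) :=
    (Complex.continuous_re.tendsto _).comp
      (Tendsto.inner (hC.tendsto_smoothing hr) tendsto_const_nhds)
  have h2 : Tendsto (fun ε => -(inner ℂ (adj D (r ε)) w).re) (𝓝[>] 0) (𝓝 (-(inner ℂ w w).re)) :=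
    ((Complex.continuous_re.tendsto _).comp (Tendsto.inner hlim tendsto_const_nhds)).neg
  rw [re_inner_self] at h2
  refine tendsto_nhds_unique h1 (h2.congr' ?_)
  filter_upwards [self_mem_nhdsWithin] with ε hε
  obtain ⟨s, hs, hs'⟩ := hr ε hε
  have h3 : (inner ℂ (domApply C (r ε)) (q : U)).re = 0 := by
    change domIncl C (r ε) - ((ε : ℂ) ^ 2) • domApply C s = (q : U) at hs'
    rw [← hs', inner_sub_right, hC.inner_domApply, ← hs, inner_smul_right, Complex.sub_re, hs,
      Complex.neg_re, hC.re_inner, ← Complex.ofReal_pow, ← hs, Complex.re_ofReal_mul, hC.re_inner]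
    simp
  rw [inner_feedback D hC, Complex.sub_re, h3, zero_sub]

theorem re_inner_sub_feedback (hC : IsSkewAdjointOp C) (a : GraphDomain C)
    (q : (feedback C D).domain) :
    (inner ℂ (domIncl C a - q) (-domApply C a - feedback C D q)).re =
      (inner ℂ (starExt C D ⟨q, feedback_mem_starExt D hC q⟩) (adj D a)).re
        - ‖starExt C D ⟨q, feedback_mem_starExt D hC q⟩‖ ^ 2 := by
  have h1 := inner_feedback D hC q a
  have h2 := re_inner_feedback_self D hC q
  have h3 := hC.re_inner a
  have h4 : (inner ℂ (q : U) (domApply C a)).re = (inner ℂ (domApply C a) (q : U)).re := by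
    rw [← inner_conj_symm, Complex.conj_re]
  have h5 : (inner ℂ (starExt C D ⟨q, feedback_mem_starExt D hC q⟩) (adj D a)).re =
      (inner ℂ (adj D a) (starExt C D ⟨q, feedback_mem_starExt D hC q⟩)).re := by
    rw [← inner_conj_symm, Complex.conj_re]
  simp only [inner_sub_left, inner_sub_right, inner_neg_right, Complex.sub_re, Complex.neg_re, h1,
    h2, h3, h4, h5]
  ring

end FeedbackSpec

/-! ### Invertibility of the wave and characteristic operators -/

section CharOp

theorem isInvertible_of_bijective {F G : Type*} [NormedAddCommGroup F] [NormedSpace ℂ F]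
    [CompleteSpace F] [NormedAddCommGroup G] [NormedSpace ℂ G] [CompleteSpace G] {f : F →L[ℂ] G}
    (hf : Function.Bijective f) : f.IsInvertible :=
  ⟨ContinuousLinearEquiv.ofBijective f (LinearMap.ker_eq_bot.2 hf.1)
    (LinearMap.range_eq_top.2 hf.2), by ext; rfl⟩

variable {V X U : Type*}
  [NormedAddCommGroup V] [InnerProductSpace ℂ V] [CompleteSpace V]
  [NormedAddCommGroup X] [InnerProductSpace ℂ X] [CompleteSpace X]
  [NormedAddCommGroup U] [InnerProductSpace ℂ U] [CompleteSpace U]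
  (ι : V →L[ℂ] X) (B : U →L[ℂ] AntiDual V) {C : U →ₗ.[ℂ] U}

omit [CompleteSpace V] [CompleteSpace X] in
theorem waveOp_apply (l : ℂ) (x v : V) :
    waveOp ι l x v = l ^ 2 * inner ℂ (ι v) (ι x) + inner ℂ v x := rfl

omit [CompleteSpace V] [CompleteSpace X] in
theorem re_conj_mul_waveOp {l : ℂ} (x : V) :
    (starRingEnd ℂ l * waveOp ι l x x).re = l.re * (Complex.normSq l * ‖ι x‖ ^ 2 + ‖x‖ ^ 2) := by
  rw [waveOp_apply, inner_self_complex, inner_self_complex]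
  have : starRingEnd ℂ l * (l ^ 2 * (‖ι x‖ : ℂ) ^ 2 + (‖x‖ : ℂ) ^ 2) =
      ((Complex.normSq l * ‖ι x‖ ^ 2 : ℝ) : ℂ) * l + ((‖x‖ ^ 2 : ℝ) : ℂ) * starRingEnd ℂ l := by
    push_cast
    rw [← Complex.mul_conj]
    ring
  rw [this, Complex.add_re, Complex.re_ofReal_mul, Complex.re_ofReal_mul, Complex.conj_re]
  ring

/-- Multiplied by the conjugate of `l`, the form has real part at least `Re l ‖x‖²`, so Lax-Milgram
applies to its Riesz representative. -/
theorem waveOp_isInvertible {l : ℂ} (hl : 0 < l.re) : (waveOp ι l).IsInvertible := by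
  have hl0 : 0 < ‖l‖ := norm_pos_iff.2 fun h => by simp [h] at hl
  let S : V →L[ℂ] V := l ^ 2 • (ContinuousLinearMap.adjoint ι).comp ι + ContinuousLinearMap.id ℂ V
  have hS : ∀ x v, inner ℂ v (S x) = waveOp ι l x v := by
    intro x v
    change inner ℂ v (l ^ 2 • ContinuousLinearMap.adjoint ι (ι x) + x) = _
    rw [inner_add_right, inner_smul_right, ContinuousLinearMap.adjoint_inner_right, waveOp_apply]
  have hcoer : ∀ x, l.re * ‖x‖ ^ 2 ≤ ‖l‖ * ‖inner ℂ x (S x)‖ := by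
    intro x
    have h1 := re_conj_mul_waveOp ι (l := l) x
    have h2 := Complex.re_le_norm (starRingEnd ℂ l * waveOp ι l x x)
    rw [norm_mul, RCLike.norm_conj, h1, ← hS] at h2
    have h3 : 0 ≤ l.re * (Complex.normSq l * ‖ι x‖ ^ 2) :=
      mul_nonneg hl.le (mul_nonneg (Complex.normSq_nonneg l) (sq_nonneg _))
    linarith
  have hunit : IsUnit S := by
    refine ContinuousLinearMap.isUnit_of_forall_le_norm_inner_map S
      (c := ⟨l.re / ‖l‖, by positivity⟩) (by exact_mod_cast div_pos hl hl0) fun x => ?_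
    change ‖x‖ ^ 2 * (l.re / ‖l‖) ≤ _
    rw [norm_inner_symm, mul_div_assoc', div_le_iff₀ hl0]
    linarith [hcoer x]
  refine isInvertible_of_bijective ⟨?_, fun F => ?_⟩
  · rw [injective_iff_map_eq_zero]
    intro x hx
    have h1 := hcoer x
    rw [hS, hx] at h1
    change l.re * ‖x‖ ^ 2 ≤ ‖l‖ * ‖(0 : ℂ)‖ at h1
    rw [norm_zero, mul_zero] at h1
    have h2 : ‖x‖ ^ 2 ≤ 0 := by
      by_contra h
      have := mul_pos hl (not_le.1 h)
      linarith
    exact norm_eq_zero.1 (pow_eq_zero_iff two_ne_zero |>.1 (le_antisymm h2 (sq_nonneg _)))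
  · obtain ⟨k, hk⟩ := exists_inner_eq F
    obtain ⟨x, rfl⟩ : ∃ x, S x = k := by
      obtain ⟨e, he⟩ := hunit
      refine ⟨(↑e⁻¹ : V →L[ℂ] V) k, ?_⟩
      rw [← he]
      exact congrArg (fun f : V →L[ℂ] V => f k) e.mul_inv
    refine ⟨x, ?_⟩
    ext v
    rw [← hS, ← hk]

/-- The bounded operator `l B* (l² + A)⁻¹ B`. -/
def couplingOp (l : ℂ) : U →L[ℂ] U := l • (adj B).comp ((waveOp ι l).inverse.comp B)

/-- With `x = (l² + A)⁻¹ B u`, the real part is that of the wave form at `x` times the conjugate of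
`l`, which is nonnegative. -/
theorem re_inner_couplingOp {l : ℂ} (hl : 0 < l.re) (u : U) :
    0 ≤ (inner ℂ u (couplingOp ι B l u)).re := by
  set x := (waveOp ι l).inverse (B u) with hx
  have h1 : B u = waveOp ι l x := ((waveOp_isInvertible ι hl).inverse_apply_eq).1 hx.symm
  have h2 : inner ℂ u (couplingOp ι B l u) = l * inner ℂ u (adj B x) := by
    rw [← inner_smul_right]; rfl
  rw [h2, ← inner_conj_symm, inner_adj, h1]
  have h3 := re_conj_mul_waveOp ι (l := l) x
  have h4 : (l * starRingEnd ℂ (waveOp ι l x x)).re =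
      (starRingEnd ℂ l * waveOp ι l x x).re := by
    rw [← Complex.conj_re, map_mul, Complex.conj_conj]
  rw [h4, h3]
  exact mul_nonneg hl.le (add_nonneg (mul_nonneg (Complex.normSq_nonneg l) (sq_nonneg _))
    (sq_nonneg _))

omit [CompleteSpace V] [CompleteSpace X] in
theorem charOp_apply (l : ℂ) (u : U) (a : GraphDomain C) : charOp ι B C l u a =
    l * inner ℂ (domIncl C a) u - inner ℂ (domApply C a) u +
      inner ℂ (domIncl C a) (couplingOp ι B l u) := by
  have h : inner ℂ (domIncl C a) (couplingOp ι B l u) = l * inner ℂ (domIncl C a)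
      (adj B ((waveOp ι l).inverse (B u))) := by
    rw [← inner_smul_right]; rfl
  rw [h, sub_eq_add_neg]
  rfl

/-- By duality: the operator is the transpose of `T : D(C) → U`, where `T = Re l - (C + N)` and `N`
is bounded and dissipative. So `T` is bijective, and Riesz representation transfers this to the
transpose. -/
theorem charOp_isInvertible (hC : IsSkewAdjointOp C) {l : ℂ} (hl : 0 < l.re) :
    (charOp ι B C l).IsInvertible := by
  have := hC.completeSpace
  set N : U →L[ℂ] U := -ContinuousLinearMap.adjoint (couplingOp ι B l)
    + ((l.im : ℂ) * Complex.I) • ContinuousLinearMap.id ℂ U with hN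
  have hNa : ∀ u, N u = -ContinuousLinearMap.adjoint (couplingOp ι B l) u
    + ((l.im : ℂ) * Complex.I) • u := fun u => rfl
  have hNd : ∀ u, (inner ℂ u (N u)).re ≤ 0 := by
    intro u
    have h1 := re_inner_couplingOp ι B hl u
    have h2 : (inner ℂ (couplingOp ι B l u) u).re = (inner ℂ u (couplingOp ι B l u)).re := by
      rw [← inner_conj_symm, Complex.conj_re]
    have h3 : ((l.im : ℂ) * Complex.I * ((‖u‖ ^ 2 : ℝ) : ℂ)).re = 0 := by
      rw [mul_comm, Complex.re_ofReal_mul, Complex.re_ofReal_mul, Complex.I_re, mul_zero, mul_zero]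
    rw [hNa, inner_add_right, inner_neg_right, ContinuousLinearMap.adjoint_inner_right,
      inner_smul_right, inner_self_complex, Complex.add_re, Complex.neg_re, h2,
      ← Complex.ofReal_pow, h3]
    linarith
  have hK := hC.isMDissipative.vadd N hNd
  let T : GraphDomain C →L[ℂ] U := starRingEnd ℂ l • domIncl C - domApply C +
    (ContinuousLinearMap.adjoint (couplingOp ι B l)).comp (domIncl C)
  have hT : ∀ a : GraphDomain C, T a = (l.re : ℂ) • domIncl C a -
      (N (domIncl C a) + domApply C a) := by
    intro a
    have h1 : starRingEnd ℂ l = (l.re : ℂ) - (l.im : ℂ) * Complex.I := by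
      apply Complex.ext <;> simp
    change starRingEnd ℂ l • domIncl C a - domApply C a +
      ContinuousLinearMap.adjoint (couplingOp ι B l) (domIncl C a) = _
    rw [hNa, h1]
    module
  have hchar : ∀ u a, charOp ι B C l u a = inner ℂ (T a) u := by
    intro u a
    change _ = inner ℂ (starRingEnd ℂ l • domIncl C a - domApply C a +
      ContinuousLinearMap.adjoint (couplingOp ι B l) (domIncl C a)) u
    rw [charOp_apply, inner_add_left, inner_sub_left, inner_smul_left, Complex.conj_conj,
      ContinuousLinearMap.adjoint_inner_left]
  have hTb : Function.Bijective T := by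
    refine ⟨?_, fun f => ?_⟩
    · rw [injective_iff_map_eq_zero]
      intro a ha
      have h1 := norm_le_of_re_inner_nonpos (l := l.re) (hK.1 (a : C.domain))
      change l.re * ‖domIncl C a‖ ≤ ‖(l.re : ℂ) • domIncl C a -
        (N (domIncl C a) + domApply C a)‖ at h1
      rw [← hT, ha, norm_zero] at h1
      have h2 : ‖domIncl C a‖ = 0 := by nlinarith [norm_nonneg (domIncl C a)]
      exact domIncl_injective C (by rw [norm_eq_zero.1 h2, map_zero])
    · obtain ⟨a, ha⟩ := hK.surjective hl f
      exact ⟨(a : C.domain), (hT _).trans ha⟩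
  obtain ⟨e, he⟩ := isInvertible_of_bijective hTb
  have he' : ∀ a, T a = e a := fun a => by rw [← he]; rfl
  refine isInvertible_of_bijective ⟨?_, fun F => ?_⟩
  · rw [injective_iff_map_eq_zero]
    intro u hu
    obtain ⟨a, ha⟩ := hTb.2 u
    have h1 := hchar u a
    rw [hu, ha] at h1
    exact inner_self_eq_zero.1 h1.symm
  · obtain ⟨u, hu⟩ := exists_inner_eq (F.comp (e.symm : U →L[ℂ] GraphDomain C))
    refine ⟨u, ?_⟩
    ext a
    rw [hchar, hu, he']
    change F (e.symm (e a)) = F a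
    rw [e.symm_apply_apply]

end CharOp

/-! ### The coupled system -/

section System

variable {V X U : Type*}
  [NormedAddCommGroup V] [InnerProductSpace ℂ V]
  [NormedAddCommGroup X] [InnerProductSpace ℂ X]
  [NormedAddCommGroup U] [InnerProductSpace ℂ U] [CompleteSpace U]
  {ι : V →L[ℂ] X} (B : U →L[ℂ] AntiDual V) (K : U →ₗ.[ℂ] U)

theorem snd_eq_zero_of_mem_systemGraph (hι : Function.Injective ι) (hι' : DenseRange ι)
    {p : EnergySpace V X U × EnergySpace V X U} (hp : p ∈ systemGraph ι B K) (h0 : p.1 = 0) :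
    p.2 = 0 := by
  obtain ⟨z, x', y', u'⟩ := p
  obtain rfl : z = 0 := h0
  obtain ⟨h1, h2, h3, h4⟩ := hp
  have hx : x' = 0 := hι (h1.symm.trans (map_zero ι).symm)
  subst hx
  have hy : y' = 0 := by
    refine pivot_injective hι' ?_
    change formOp V 0 + B 0 = -pivot ι y' at h2
    rw [map_zero, map_zero, add_zero, eq_comm, neg_eq_zero] at h2
    rw [h2, map_zero]
  have hu : u' = 0 := by
    change u' = adj B 0 + K ⟨0, h3⟩ at h4
    rw [map_zero, zero_add] at h4
    rw [h4]
    exact K.map_zero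
  rw [hy, hu]
  rfl

variable {B K}

theorem systemOp_mem_graph (hι : Function.Injective ι) (hι' : DenseRange ι)
    (z : GraphDomain (systemOp ι B K)) :
    (domIncl _ z, domApply _ z) ∈ systemGraph ι B K :=
  Submodule.mem_graph_toLinearPMap
    (fun _ hp h0 => snd_eq_zero_of_mem_systemGraph B K hι hι' hp h0) z

theorem exists_domIncl_eq_of_mem_systemGraph (hι : Function.Injective ι) (hι' : DenseRange ι)
    {p : EnergySpace V X U × EnergySpace V X U} (hp : p ∈ systemGraph ι B K) :
    ∃ z : GraphDomain (systemOp ι B K), domIncl _ z = p.1 ∧ domApply _ z = p.2 := by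
  rw [← Submodule.toLinearPMap_graph_eq _
    (fun _ hp h0 => snd_eq_zero_of_mem_systemGraph B K hι hι' hp h0)] at hp
  obtain ⟨z, h1, h2⟩ := (LinearPMap.mem_graph_iff _).1 hp
  exact ⟨z, h1, h2⟩

/-- The energy balance of the wave part. -/
theorem re_inner_energySpace {z z' : EnergySpace V X U} (h1 : z.snd.fst = ι z'.fst)
    (h2 : formOp V z.fst + B z.snd.snd = -pivot ι z'.snd.fst) :
    (inner ℂ z z').re = (inner ℂ z.snd.snd (z'.snd.snd - adj B z'.fst)).re := by
  have h3 := congrArg (fun F : AntiDual V => (F z'.fst).re) h2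
  change (inner ℂ z'.fst z.fst + B z.snd.snd z'.fst).re = (-inner ℂ (ι z'.fst) z'.snd.fst).re at h3
  rw [← inner_adj, ← h1] at h3
  have h4 : (inner ℂ z.fst z'.fst).re = (inner ℂ z'.fst z.fst).re := by
    rw [← inner_conj_symm, Complex.conj_re]
  have h5 : (inner ℂ z.snd.snd (adj B z'.fst)).re = (inner ℂ (adj B z'.fst) z.snd.snd).re := by
    rw [← inner_conj_symm, Complex.conj_re]
  rw [WithLp.prod_inner_apply, WithLp.prod_inner_apply]
  change (inner ℂ z.fst z'.fst + (inner ℂ z.snd.fst z'.snd.fst +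
    inner ℂ z.snd.snd z'.snd.snd)).re = _
  simp only [inner_sub_right, Complex.add_re, Complex.sub_re, Complex.neg_re] at h3 ⊢
  linarith

/-- The wave part does not depend on the third-component operator and is skew, so the difference of
the graph elements loses energy only through `K` and `L`. -/
theorem re_inner_sub_of_mem_systemGraph {K L : U →ₗ.[ℂ] U}
    {p q : EnergySpace V X U × EnergySpace V X U} (hp : p ∈ systemGraph ι B K)
    (hq : q ∈ systemGraph ι B L) : ∃ hu : p.1.snd.snd ∈ K.domain,
    ∃ hv : q.1.snd.snd ∈ L.domain, (inner ℂ (p.1 - q.1) (p.2 - q.2)).re =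
      (inner ℂ (p.1.snd.snd - q.1.snd.snd) (K ⟨_, hu⟩ - L ⟨_, hv⟩)).re := by
  obtain ⟨h1, h2, hu, h3⟩ := hp
  obtain ⟨k1, k2, hv, k3⟩ := hq
  refine ⟨hu, hv, ?_⟩
  rw [re_inner_energySpace (ι := ι) (B := B)]
  · simp only [WithLp.sub_fst, WithLp.sub_snd, h3, k3, map_sub]
    congr 2
    abel
  · simp only [WithLp.sub_fst, WithLp.sub_snd, h1, k1, map_sub]
  · simp only [WithLp.sub_fst, WithLp.sub_snd, map_sub]
    rw [sub_add_sub_comm, h2, k2]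
    abel

theorem re_inner_systemOp (hι : Function.Injective ι) (hι' : DenseRange ι)
    (z : GraphDomain (systemOp ι B K)) : ∃ hu : (domIncl _ z).snd.snd ∈ K.domain,
    (inner ℂ (domIncl _ z) (domApply _ z)).re =
      (inner ℂ (domIncl _ z).snd.snd (K ⟨_, hu⟩)).re := by
  obtain ⟨h1, h2, hu, h3⟩ := systemOp_mem_graph hι hι' z
  refine ⟨hu, ?_⟩
  rw [re_inner_energySpace (ι := ι) (B := B) h1 h2]
  congr 2
  exact sub_eq_of_eq_add' h3

/-- Elimination at `λ = 1`: `y = x - f₁` and `x = (1 + A)⁻¹ (G - B u)` reduce the resolvent equation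
to one for `1 + B* (1 + A)⁻¹ B - K` on `U`, where the coupling is a bounded monotone perturbation.
-/
theorem systemOp_isMDissipative [CompleteSpace V] [CompleteSpace X] (hι : Function.Injective ι)
    (hι' : DenseRange ι) (hK : IsMDissipative K) : IsMDissipative (systemOp ι B K) := by
  refine ⟨fun z => ?_, 1, one_pos, fun f => ?_⟩
  · obtain ⟨hu, h⟩ := re_inner_systemOp hι hι' (z : GraphDomain (systemOp ι B K))
    exact h.trans_le (hK.1 ⟨_, hu⟩)
  have hl : (0 : ℝ) < (1 : ℂ).re := one_pos
  have hW := waveOp_isInvertible ι hl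
  set G : AntiDual V := pivot ι (ι f.fst + f.snd.fst) with hG
  obtain ⟨u, hu⟩ := (hK.vadd (-couplingOp ι B 1) (fun u => by
    have := re_inner_couplingOp ι B hl u
    change (inner ℂ u (-couplingOp ι B 1 u)).re ≤ 0
    rw [inner_neg_right, Complex.neg_re]
    linarith)).surjective one_pos (f.snd.snd - adj B f.fst + adj B ((waveOp ι 1).inverse G))
  have hud : (u : U) ∈ K.domain := u.2
  set x : V := (waveOp ι 1).inverse (G - B u) with hx
  have hxW : waveOp ι 1 x = G - B u := ((hW.inverse_apply_eq).1 hx.symm).symm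
  have hxB : adj B x = adj B ((waveOp ι 1).inverse G) - couplingOp ι B 1 u := by
    have : couplingOp ι B 1 u = adj B ((waveOp ι 1).inverse (B u)) := one_smul ℂ _
    rw [hx, map_sub, map_sub, this]
  have hu' : (u : U) + couplingOp ι B 1 u - K ⟨u, hud⟩ =
      f.snd.snd - adj B f.fst + adj B ((waveOp ι 1).inverse G) := by
    rw [← hu, Complex.ofReal_one, one_smul]
    change _ = (u : U) - (-couplingOp ι B 1 u + K ⟨u, hud⟩)
    abel
  let z : EnergySpace V X U := WithLp.toLp 2 (x, WithLp.toLp 2 (ι (x - f.fst), (u : U)))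
  have hmem : (z, z - f) ∈ systemGraph ι B K := by
    refine ⟨rfl, ?_, hud, ?_⟩
    · change formOp V x + B u = -pivot ι (ι (x - f.fst) - f.snd.fst)
      have h1 : waveOp ι 1 x = pivot ι (ι x) + formOp V x := by
        change ((1 : ℂ) ^ 2 • pivot ι (ι x)) + formOp V x = _
        rw [one_pow, one_smul]
      have h2 : pivot ι (ι (x - f.fst) - f.snd.fst) = pivot ι (ι x) - G := by
        rw [hG, ← map_sub, map_sub ι, sub_sub]
      rw [h2, neg_sub, ← add_right_inj (pivot ι (ι x)), ← add_assoc, ← h1, hxW]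
      abel
    · change (u : U) - f.snd.snd = adj B (x - f.fst) + K ⟨u, hud⟩
      rw [map_sub, hxB]
      rw [← sub_eq_zero] at hu' ⊢
      rw [← hu']
      abel
  obtain ⟨w, hw1, hw2⟩ := exists_domIncl_eq_of_mem_systemGraph hι hι' hmem
  refine ⟨(w : (systemOp ι B K).domain), ?_⟩
  change ((1 : ℝ) : ℂ) • domIncl _ w - domApply _ w = f
  rw [hw1, hw2, Complex.ofReal_one, one_smul, sub_sub_cancel]

end System

/-! ### Outputs of the coupled system -/

section Outputs

variable {V X U W : Type*}
  [NormedAddCommGroup V] [InnerProductSpace ℂ V]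
  [NormedAddCommGroup X] [InnerProductSpace ℂ X]
  [NormedAddCommGroup U] [InnerProductSpace ℂ U] [CompleteSpace U]
  [NormedAddCommGroup W] [InnerProductSpace ℂ W] [CompleteSpace W]
  {ι : V →L[ℂ] X} (hι : Function.Injective ι) (hι' : DenseRange ι)
  {B : U →L[ℂ] AntiDual V}

/-- The projection `(x, y, u) ↦ u` from the domain of the system to the domain of `K`. -/
def controlState {K : U →ₗ.[ℂ] U} : GraphDomain (systemOp ι B K) →L[ℂ] GraphDomain K :=
  LinearMap.mkContinuous
    { toFun := fun z => (⟨(domIncl _ z).snd.snd, (systemOp_mem_graph hι hι' z).2.2.fst⟩ : K.domain)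
      map_add' := fun _ _ => Subtype.ext rfl
      map_smul' := fun _ _ => Subtype.ext rfl } (2 + ‖adj B‖) fun z => by
    obtain ⟨-, -, hu, h⟩ := systemOp_mem_graph hι hι' z
    refine (norm_graphDomain_le K _).trans ?_
    change ‖(domIncl _ z).snd.snd‖ + ‖K ⟨(domIncl _ z).snd.snd, hu⟩‖ ≤ _
    -- The equation recovers `K u` from the image under the system operator, so the graph norm of
    -- `u` is controlled.
    have h1 : K ⟨(domIncl _ z).snd.snd, hu⟩ =
      (domApply _ z).snd.snd - adj B (domApply _ z).fst := (sub_eq_of_eq_add' h).symm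
    have h2 : ‖(domIncl _ z).snd.snd‖ ≤ ‖z‖ := (WithLp.norm_snd_le _ _).trans
      ((WithLp.norm_snd_le _ _).trans (norm_domIncl_le _ z))
    have h3 : ‖(domApply _ z).snd.snd‖ ≤ ‖z‖ := (WithLp.norm_snd_le _ _).trans
      ((WithLp.norm_snd_le _ _).trans (norm_domApply_le _ z))
    have h4 : ‖(domApply _ z).fst‖ ≤ ‖z‖ :=
      (WithLp.norm_fst_le _ _).trans (norm_domApply_le _ z)
    have h5 := (adj B).le_of_opNorm_le_of_le le_rfl h4
    rw [h1]
    linarith [norm_sub_le (domApply _ z).snd.snd (adj B (domApply _ z).fst)]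

theorem domApply_controlState {K : U →ₗ.[ℂ] U} (z : GraphDomain (systemOp ι B K)) :
    (domApply _ z).snd.snd = adj B (domApply _ z).fst + domApply K (controlState hι hι' z) :=
  (systemOp_mem_graph hι hι' z).2.2.snd

/-- The identity from the domain of `-C` to the domain of `C`. -/
def negDomain (C : U →ₗ.[ℂ] U) : GraphDomain (-C) →L[ℂ] GraphDomain C :=
  LinearMap.mkContinuous
    { toFun := fun a => ((a : (-C).domain) : C.domain)
      map_add' := fun _ _ => rfl
      map_smul' := fun _ _ => rfl } 1 fun a => by
    rw [one_mul]
    refine (sq_le_sq₀ (norm_nonneg _) (norm_nonneg _)).1 ?_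
    rw [norm_sq_graphDomain, norm_sq_graphDomain]
    have h : domApply (-C) a = -domApply C ((a : (-C).domain) : C.domain) := rfl
    rw [h, norm_neg]
    exact le_rfl

omit [CompleteSpace U] in
theorem domApply_negDomain {C : U →ₗ.[ℂ] U} (a : GraphDomain (-C)) :
    domApply (-C) a = -domApply C (negDomain C a) := rfl

variable {C : U →ₗ.[ℂ] U} (D : W →L[ℂ] AntiDual (GraphDomain C)) (hC : IsSkewAdjointOp C)

/-- The output `D* u` on the domain of `-C - D D*`. -/
def feedbackOutput : GraphDomain (feedback C D) →L[ℂ] W :=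
  LinearMap.mkContinuous
    { toFun := fun q => starExt C D ⟨domIncl _ q, feedback_mem_starExt D hC q⟩
      map_add' := fun p q => (starExt C D).map_add ⟨domIncl _ p, feedback_mem_starExt D hC p⟩
        ⟨domIncl _ q, feedback_mem_starExt D hC q⟩
      map_smul' := fun c q => (starExt C D).map_smul c
        ⟨domIncl _ q, feedback_mem_starExt D hC q⟩ } 1 fun q => by
    rw [one_mul]
    refine (sq_le_sq₀ (norm_nonneg _) (norm_nonneg _)).1 ?_
    have h1 := re_inner_feedback_self D hC q
    have h2 := (Complex.abs_re_le_norm _).trans (norm_inner_le_norm (𝕜 := ℂ) (domIncl _ q)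
      (domApply _ q))
    have h3 := (neg_le_abs _).trans (h2.trans (mul_le_mul (norm_domIncl_le _ q)
      (norm_domApply_le _ q) (norm_nonneg _) (norm_nonneg _)))
    change ‖starExt C D ⟨domIncl _ q, feedback_mem_starExt D hC q⟩‖ ^ 2 ≤ _
    change (inner ℂ (domIncl _ q) (domApply _ q)).re =
      -‖starExt C D ⟨domIncl _ q, feedback_mem_starExt D hC q⟩‖ ^ 2 at h1
    linarith [sq ‖q‖]

/-- The output of the conservative system. -/
def conservativeOutput : GraphDomain (conservativeOp ι B C) →L[ℂ] W :=
  (adj D).comp ((negDomain C).comp (controlState hι hι'))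

/-- The output of the damped system. -/
def dampedOutput : GraphDomain (dampedOp ι B C D) →L[ℂ] W :=
  (feedbackOutput D hC).comp (controlState hι hι')

theorem obsOut_eq (p : GraphDomain (conservativeOp ι B C)) :
    obsOut C D (domIncl _ p).snd.snd = conservativeOutput hι hι' D p :=
  dif_pos (negDomain C (controlState hι hι' p) : C.domain).2

theorem energyIdentity_system :
    EnergyIdentity (conservativeOutput (B := B) hι hι' D)
      (dampedOutput (B := B) hι hι' D hC) := by
  intro p q
  obtain ⟨hu, hv, h⟩ := re_inner_sub_of_mem_systemGraph (systemOp_mem_graph hι hι' p)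
    (systemOp_mem_graph hι hι' q)
  exact h.trans (re_inner_sub_feedback D hC (negDomain C (controlState hι hι' p))
    (controlState hι hι' q))

variable [CompleteSpace V] [CompleteSpace X]

/-- The difference of the conservative and the damped state is driven by the damped output. -/
theorem charOp_sub_eq {l : ℂ} (hl : 0 < l.re) {p : GraphDomain (systemOp ι B (-C))}
    {q : GraphDomain (systemOp ι B (feedback C D))}
    (h : l • (domIncl _ p - domIncl _ q) = domApply _ p - domApply _ q) :
    charOp ι B C l (domIncl C (negDomain C (controlState hι hι' p)) -
      domIncl (feedback C D) (controlState hι hι' q)) = D (dampedOutput hι hι' D hC q) := by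
  obtain ⟨h1, h2, -⟩ := systemOp_mem_graph hι hι' p
  obtain ⟨k1, k2, -⟩ := systemOp_mem_graph hι hι' q
  dsimp only at h1 h2 k1 k2
  have h3 := domApply_controlState hι hι' p
  have k3 := domApply_controlState hι hι' q
  set c := negDomain C (controlState hι hι' p) with hc
  set d := controlState hι hι' q with hd
  have e1 := congrArg (fun z : EnergySpace V X U => z.fst) h
  have e2 := congrArg (fun z : EnergySpace V X U => z.snd.fst) h
  have e3 := congrArg (fun z : EnergySpace V X U => z.snd.snd) h
  simp only [WithLp.smul_fst, WithLp.smul_snd, WithLp.sub_fst, WithLp.sub_snd] at e1 e2 e3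
  set x : V := (domIncl _ p).fst - (domIncl _ q).fst with hx
  set u : U := domIncl C c - domIncl (feedback C D) d with hu
  have hu' : (domIncl _ p).snd.snd - (domIncl _ q).snd.snd = u := rfl
  -- The first two components of the resolvent relation combine into `(l² + A) x = -B u`.
  have hwave : waveOp ι l x = -B u := by
    have i1 : waveOp ι l x = pivot ι (l • l • ι x) + formOp V x := by
      rw [map_smul, map_smul, smul_smul, ← sq]
      rfl
    have i2 : formOp V x + B u = -pivot ι (l • l • ι x) := by
      have : l • l • ι x = (domApply _ p).snd.fst - (domApply _ q).snd.fst := by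
        rw [← e2, h1, k1, ← map_sub, ← e1, map_smul]
      rw [this, hx, ← hu', map_sub, map_sub, map_sub, sub_add_sub_comm, h2, k2]
      abel
    rw [i1, ← sub_eq_zero, sub_neg_eq_add, add_assoc, i2, add_neg_cancel]
  have hcoup : couplingOp ι B l u = -adj B ((domApply _ p).fst - (domApply _ q).fst) := by
    have i1 : (waveOp ι l).inverse (B u) = -x := by
      rw [(waveOp_isInvertible ι hl).inverse_apply_eq, map_neg, hwave, neg_neg]
    change l • adj B ((waveOp ι l).inverse (B u)) = _
    rw [i1, ← e1, map_neg, map_smul, smul_neg]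
  have hstate : l • u + couplingOp ι B l u = -domApply C c - domApply (feedback C D) d := by
    rw [hcoup, ← hu', e3, h3, k3, map_sub, domApply_negDomain]
    abel
  ext a
  have i1 := inner_feedback D hC d a
  have i2 := hC.inner_domApply a c
  change inner ℂ (domIncl C a) (domApply (feedback C D) d) =
    inner ℂ (domApply C a) (domIncl (feedback C D) d) -
      inner ℂ (adj D a) (feedbackOutput D hC d) at i1
  change _ = D (feedbackOutput D hC d) a
  rw [charOp_apply, ← inner_smul_right, sub_add_eq_add_sub, ← inner_add_right, hstate,
    inner_sub_right, inner_neg_right, i1, ← inner_adj, hu, inner_sub_right, i2]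
  ring

/-- `charOp_sub_eq` identifies the difference of third components with the inverse characteristic
operator applied to `D w`, where `w` is the damped output; linearity of the extended `D*` then turns
the output difference into `-H(l) w`. -/
theorem frequencyBound_of_transferBound (hD : TransferBound ι B C D) :
    ∃ β : ℝ, 0 < β ∧ ∃ M : ℝ, 0 ≤ M ∧
      FrequencyBound (conservativeOutput (B := B) hι hι' D) (dampedOutput (B := B) hι hι' D hC)
        β M := by
  obtain ⟨H, hH, β, hβ, M, hM⟩ := hD
  refine ⟨β, hβ, M, (norm_nonneg _).trans (hM β (Complex.ofReal_re β)), fun l hl p q h => ?_⟩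
  have hl0 : 0 < l.re := hl ▸ hβ
  obtain ⟨hu, hHw⟩ := hH l hl0 (dampedOutput hι hι' D hC q)
  set c := negDomain C (controlState hι hι' p) with hc
  have e1 : (charOp ι B C l).inverse (D (dampedOutput hι hι' D hC q)) =
      domIncl C c - domIncl (feedback C D) (controlState hι hι' q) :=
    ((charOp_isInvertible ι B hC hl0).inverse_apply_eq).2 (charOp_sub_eq hι hι' D hC hl0 h).symm
  obtain ⟨hc1, hc2⟩ := starExt_domIncl D hC c
  have e2 : starExt C D ⟨_, hu⟩ = adj D c - dampedOutput hι hι' D hC q := by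
    rw [← hc2]
    refine (congrArg (starExt C D) (Subtype.ext e1)).trans ((starExt C D).map_sub ⟨_, hc1⟩
      ⟨_, feedback_mem_starExt D hC (controlState hι hι' q)⟩)
  change ‖adj D c - _‖ ≤ _
  rw [← e2, ← norm_neg, ← hHw]
  exact (H l).le_of_opNorm_le (hM l hl) _

omit [CompleteSpace V] [CompleteSpace X] in
-- For bounded `D₀` the output difference is `D₀* δ_u`, and on `Re l = 1` the energy identity reads
-- `‖δ‖² = Re ⟨w, D₀* δ_u⟩`. Hence `‖δ‖ ≤ ‖D₀‖ ‖w‖` and the bound `‖D₀‖²`; the transfer function is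
-- not needed.
theorem frequencyBound_of_isBoundedInto (hD : IsBoundedInto C D) :
    ∃ β : ℝ, 0 < β ∧ ∃ M : ℝ, 0 ≤ M ∧
      FrequencyBound (conservativeOutput (B := B) hι hι' D) (dampedOutput (B := B) hι hι' D hC)
        β M := by
  obtain ⟨D₀, hD₀⟩ := hD
  have hadj : ∀ a, adj D a = ContinuousLinearMap.adjoint D₀ (domIncl C a) := by
    intro a
    refine ext_inner_right ℂ fun k => ?_
    rw [inner_adj, ContinuousLinearMap.adjoint_inner_left, hD₀]
    rfl
  have hstar : ∀ u : (starExt C D).domain,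
      starExt C D u = ContinuousLinearMap.adjoint D₀ (u : U) := by
    intro u
    obtain ⟨r, hr, hlim⟩ := mem_starExtGraph D hC u
    refine tendsto_nhds_unique hlim ?_
    simp only [hadj]
    exact ((ContinuousLinearMap.adjoint D₀).continuous.tendsto _).comp (hC.tendsto_smoothing hr)
  refine ⟨1, one_pos, ‖D₀‖ * ‖D₀‖, by positivity, fun l hl p q h => ?_⟩
  have hE := energyIdentity_system hι hι' D hC p q
  set δ := domIncl (conservativeOp ι B C) p - domIncl (dampedOp ι B C D) q with hδ
  set w := dampedOutput hι hι' D hC q with hw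
  have e1 : conservativeOutput hι hι' D p - w =
      ContinuousLinearMap.adjoint D₀ δ.snd.snd := by
    have i1 : conservativeOutput hι hι' D p = ContinuousLinearMap.adjoint D₀
      (domIncl (conservativeOp ι B C) p).snd.snd := hadj _
    have i2 : w = ContinuousLinearMap.adjoint D₀ (domIncl (dampedOp ι B C D) q).snd.snd :=
      hstar _
    rw [i1, i2, ← map_sub]
    rfl
  have e2 : ‖δ.snd.snd‖ ≤ ‖δ‖ := (WithLp.norm_snd_le _ _).trans (WithLp.norm_snd_le _ _)
  have e3 : ‖conservativeOutput hι hι' D p - w‖ ≤ ‖D₀‖ * ‖δ‖ := by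
    rw [e1]
    refine (ContinuousLinearMap.le_of_opNorm_le_of_le _ le_rfl e2).trans_eq ?_
    rw [LinearIsometryEquiv.norm_map]
  have e4 : ‖δ‖ ^ 2 = (inner ℂ w (conservativeOutput hι hι' D p - w)).re := by
    rw [inner_sub_right, Complex.sub_re, re_inner_self, ← hE, ← h, inner_smul_right,
      inner_self_complex, ← Complex.ofReal_pow, mul_comm, Complex.re_ofReal_mul, hl, mul_one]
  have e5 : ‖δ‖ ^ 2 ≤ ‖w‖ * (‖D₀‖ * ‖δ‖) := e4.trans_le ((Complex.re_le_norm _).trans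
    ((norm_inner_le_norm _ _).trans (mul_le_mul_of_nonneg_left e3 (norm_nonneg _))))
  have e6 : ‖δ‖ ≤ ‖D₀‖ * ‖w‖ := by
    rcases (norm_nonneg δ).eq_or_lt with h0 | h0
    · rw [← h0]; positivity
    · refine le_of_mul_le_mul_right ?_ h0
      linarith [sq ‖δ‖]
  refine e3.trans ?_
  rw [mul_assoc]
  exact mul_le_mul_of_nonneg_left e6 (norm_nonneg _)

omit [CompleteSpace V] [CompleteSpace X] in
theorem exponentiallyStable_iff : ExponentiallyStable ι B C D ↔
    ∃ c : ℝ, 0 < c ∧ ∃ ω : ℝ, 0 < ω ∧ ∀ Q, IsTrajectory (dampedOp ι B C D) Q → ∀ t : ℝ, 0 ≤ t →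
      ‖domIncl _ (Q t)‖ ^ 2 ≤ c * Real.exp (-ω * t) * ‖domIncl _ (Q 0)‖ ^ 2 := by
  refine exists_congr fun c => and_congr_right fun _ => exists_congr fun ω =>
    and_congr_right fun _ => ⟨fun h Q hQ t ht => ?_, fun h z₀ _ z hz t ht => ?_⟩
  · have h1 := h _ (Q 0 : (dampedOp ι B C D).domain).2 _ hQ.isSolution t ht
    simp only [energy] at h1
    linarith
  · obtain ⟨Q, hQ, hQz⟩ := hz.exists_trajectory
    have h1 := h Q hQ t ht
    rw [hQz t ht, hQz 0 le_rfl] at h1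
    simp only [energy]
    linarith

omit [CompleteSpace V] [CompleteSpace X] in
theorem observable_iff : Observable ι B C D ↔
    ∃ T : ℝ, 0 < T ∧ ∃ c : ℝ, 0 < c ∧ ∀ P, IsTrajectory (conservativeOp ι B C) P →
      c * ‖domIncl _ (P 0)‖ ^ 2 ≤
        ∫ t in (0 : ℝ)..T, ‖conservativeOutput hι hι' D (P t)‖ ^ 2 := by
  refine exists_congr fun T => and_congr_right fun hT => exists_congr fun c =>
    and_congr_right fun _ => ⟨fun h P hP => ?_, fun h z₀ _ z hz => ?_⟩
  · have h1 := h _ (P 0 : (conservativeOp ι B C).domain).2 _ hP.isSolution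
    simp only [obsOut_eq hι hι'] at h1
    exact h1
  · obtain ⟨P, hP, hPz⟩ := hz.exists_trajectory
    have h1 := h P hP
    rw [hPz 0 le_rfl, hz.1] at h1
    refine h1.trans_eq (intervalIntegral.integral_congr fun t ht => ?_)
    rw [uIcc_of_le hT.le] at ht
    simp only [← hPz t ht.1, obsOut_eq hι hι']

end Outputs

end DynFeedback

end

/-! ### The equivalence theorem -/

theorem mainTheorem1 {V X U W : Type*}
    [NormedAddCommGroup V] [InnerProductSpace ℂ V] [CompleteSpace V]
    [NormedAddCommGroup X] [InnerProductSpace ℂ X] [CompleteSpace X]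
    [NormedAddCommGroup U] [InnerProductSpace ℂ U] [CompleteSpace U]
    [NormedAddCommGroup W] [InnerProductSpace ℂ W] [CompleteSpace W]
    (ι : V →L[ℂ] X) (hι : Function.Injective ι) (hι' : DenseRange ι)
    (B : U →L[ℂ] AntiDual V)
    (C : U →ₗ.[ℂ] U) (hC : IsSkewAdjointOp C)
    (D : W →L[ℂ] AntiDual (GraphDomain C))
    (hCD : IsMDissipative (feedback C D))
    (hD : TransferBound ι B C D ∨ IsBoundedInto C D) :
    ExponentiallyStable ι B C D ↔ Observable ι B C D := by
  obtain ⟨β, hβ, M, hM, hF⟩ : ∃ β : ℝ, 0 < β ∧ ∃ M : ℝ, 0 ≤ M ∧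
      FrequencyBound (conservativeOutput (B := B) hι hι' D) (dampedOutput (B := B) hι hι' D hC)
        β M :=
    hD.elim (frequencyBound_of_transferBound hι hι' D hC)
      (frequencyBound_of_isBoundedInto hι hι' D hC)
  rw [exponentiallyStable_iff, observable_iff hι hι']
  exact exponential_iff_observable (systemOp_isMDissipative hι hι' hC.neg_isMDissipative)
    (systemOp_isMDissipative hι hι' hCD) (energyIdentity_system hι hι' D hC) hβ hM hF
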